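/- **Setting.** Manifolds are finite-dimensional, smooth, Hausdorff and second countable. Let $(S,\omega)$ be a symplectic manifold and $H:S\to\mathbb R$ a smooth function; $X_f$ is defined by $i_{X_f}\omega=df$ and $\{f,g\}_S=\omega(X_f,X_g)$. Let $\mathbb R^\times$ be either $\mathbb R^+$ or $\mathbb R\setminus\{0\}$, let $\phi$ be a principal action of $\mathbb R^\times$ on $S$ with $\phi_s^*\omega=s\,\omega$ and $H\circ\phi_s=sH$ (a scaling symmetry), and let $\Phi$ be a principal action of a Lie group $G$ on $S$ with $\Phi_g^*\omega=\omega$ and $H\circ\Phi_g=H$, such that $\Phi_g\circ\phi_s=\phi_s\circ\Phi_g$ for all $g,s$. Here an action is principal if it is smooth and free and its orbit space is a manifold over which the quotient map is a locally trivial principal bundle. Assume that the induced actions of $\mathbb R^\times$ on $P=S/G$ and of $G$ on $C=S/\mathbb R^\times$ are principal as well. A Kirillov structure on a real line bundle $V\to B$ is a Lie bracket $[\cdot,\cdot]$ on $\Gamma(V^*)$ such that for every $h_2\in\Gamma(V^*)$ there is a smooth vector field $X_{h_2}$ on $B$ (the symbol, or Hamiltonian vector field, of $h_2$) with $[fh_1,h_2]=f[h_1,h_2]+X_{h_2}(f)\,h_1$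 for all $f\in C^\infty(B)$, $h_1\in\Gamma(V^*)$. *First $G$, then $\mathbb R^\times$.* $P=S/G$ has the Poisson bracket with $\{f_1,f_2\}_P\circ\wp_S=\{f_1\circ\wp_S,f_2\circ\wp_S\}_S$, and the function $H^G$ with $H^G\circ\wp_S=H$, where $\wp_S:S\to P$ is the projection. Let $L=(P\times\mathbb R)/\mathbb R^\times\to P/\mathbb R^\times$ be the quotient by $s\cdot(y,t)=(sy,t/s)$. A section $h$ of $L^*$ corresponds to the homogeneous function $H_h(y)=h([y])([y,1])$ on $P$. The bracket on $\Gamma(L^*)$ is given by $H_{[h_1,h_2]_{L^*}}=-\{H_{h_1},H_{h_2}\}_P$, and the section $h_{H^G}$ by $H_{h_{H^G}}=H^G$. *First $\mathbb R^\times$, then $G$.* Let $p_S:S\to C=S/\mathbb R^\times$ be the projection, $\Delta$ the infinitesimal generator of $\phi$, $\lambda=-i_\Delta\omega$, $\mathcal D=Tp_S(\ker\lambda)$, and $\mathcal D^\circ\subset T^*C$ the annihilator of $\mathcal D$, a line bundle over $C$. For $x\in S$ let $\alpha_x\in\mathcal D^\circ_{p_S(x)}$ be the covector with $\alpha_x\circ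 T_xp_S=\lambda_x$. A section $h$ of $(\mathcal D^\circ)^*$ corresponds to the homogeneous function $H_h(x)=h(p_S(x))(\alpha_x)$ on $S$. The bracket on $\Gamma((\mathcal D^\circ)^*)$ is given by $H_{[h_1,h_2]}=-\{H_{h_1},H_{h_2}\}_S$, and the section $h_H$ by $H_{h_H}=H$. The group $G$ acts on $\mathcal D^\circ$ by cotangent lift, with quotient line bundle $\mathcal D^\circ/G\to C/G$; every section of $(\mathcal D^\circ/G)^*$ is induced by a ($G$-invariant) section $h$ of $(\mathcal D^\circ)^*$, and is then denoted by $h^G$. The bracket on $\Gamma((\mathcal D^\circ/G)^*)$ is given by $[h_1^G,h_2^G]=([h_1,h_2])^G$, and $h_H^G$ is the section induced by $h_H$. **Theorem.** These brackets and sections exist, the brackets are Kirillov structures on $L$, $\mathcal D^\circ$ and $\mathcal D^\circ/G$, and: 1. There is an isomorphism of real line bundles $(\Psi,\psi)$ from $L\to (S/G)/\mathbb R^\times$ to $\mathcal D^\circ/G\to (S/\mathbb R^\times)/G$, with $\psi$ a diffeomorphism, given by $\psi([[x]])=[[x]]$ and $\Psi([[x],t])=[t\,\alpha_x]$ for $x\in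 S$, $t\in\mathbb R$. 2. $h_{H^G}=\Psi^*\circ h_H^G\circ\psi$. 3. $[\Psi^*\circ k_1\circ\psi,\ \Psi^*\circ k_2\circ\psi]_{L^*}=\Psi^*\circ[k_1,k_2]\circ\psi$ for all sections $k_1,k_2$ of $(\mathcal D^\circ/G)^*$, with the bracket of $\Gamma((\mathcal D^\circ/G)^*)$ on the right. 4. The Hamiltonian vector fields $X_{h_{H^G}}$ on $(S/G)/\mathbb R^\times$ and $X_{h_H^G}$ on $(S/\mathbb R^\times)/G$ are $\psi$-related: $T\psi\circ X_{h_{H^G}}=X_{h_H^G}\circ\psi$. So both orders of reduction give equivalent Kirillov Hamiltonian systems. -/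

import Mathlib

open scoped Manifold ContDiff
open Bundle

/-! ### The multiplicative group -/

section ScalingGroup

variable (Γ : Subgroup ℝˣ) [Fact (Γ = ⊤ ∨ Γ = Units.posSubgroup ℝ)]

/-- The coordinate `s ↦ (s : ℝ)` on `Γ`, where `Γ` is `ℝ ∖ {0}` or `(0, ∞)`. -/
def scalingCoord {Γ : Subgroup ℝˣ} (s : Γ) : ℝ := ((s : ℝˣ) : ℝ)

theorem isOpenEmbedding_scalingCoord :
    Topology.IsOpenEmbedding (scalingCoord : Γ → ℝ) := by
  have hopen : IsOpen (Γ : Set ℝˣ) := by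
    rcases (Fact.out : Γ = ⊤ ∨ Γ = Units.posSubgroup ℝ) with h | h
    · rw [h]; exact isOpen_univ
    · have : (Γ : Set ℝˣ) = (fun u : ℝˣ => (u : ℝ)) ⁻¹' Set.Ioi 0 := by
        ext u; rw [h]; simp [Units.mem_posSubgroup]
      rw [this]
      exact isOpen_Ioi.preimage Units.continuous_val
  exact Units.isOpenEmbedding_val.comp hopen.isOpenEmbedding_subtypeVal

/-- `Γ` is an open submanifold of `ℝ`. -/
noncomputable instance : ChartedSpace ℝ Γ :=
  (isOpenEmbedding_scalingCoord Γ).singletonChartedSpace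

instance : IsManifold 𝓘(ℝ, ℝ) ∞ Γ :=
  (isOpenEmbedding_scalingCoord Γ).isManifold_singleton

theorem contMDiff_scalingCoord :
    ContMDiff 𝓘(ℝ, ℝ) 𝓘(ℝ, ℝ) ∞ (scalingCoord : Γ → ℝ) :=
  contMDiff_isOpenEmbedding (isOpenEmbedding_scalingCoord Γ)

instance : LieGroup 𝓘(ℝ, ℝ) ∞ Γ where
  contMDiff_mul := by
    apply ContMDiff.of_comp_isOpenEmbedding (isOpenEmbedding_scalingCoord Γ)
    have : (scalingCoord : Γ → ℝ) ∘ (fun x : Γ × Γ => x.1 * x.2) =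
      fun x : Γ × Γ => scalingCoord x.1 * scalingCoord x.2 := by ext; simp [scalingCoord]
    rw [this]
    exact ((contMDiff_scalingCoord Γ).comp contMDiff_fst).mul
      ((contMDiff_scalingCoord Γ).comp contMDiff_snd)
  contMDiff_inv := by
    apply ContMDiff.of_comp_isOpenEmbedding (isOpenEmbedding_scalingCoord Γ)
    have : (scalingCoord : Γ → ℝ) ∘ (fun x : Γ => x⁻¹) =
      fun x : Γ => (scalingCoord x)⁻¹ := by ext; simp [scalingCoord]
    rw [this]
    intro x
    have h : ContMDiffAt 𝓘(ℝ, ℝ) 𝓘(ℝ, ℝ) ∞ (fun r : ℝ => r⁻¹) (scalingCoord x) := by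
      rw [contMDiffAt_iff_contDiffAt]
      exact contDiffAt_inv ℝ (by simp [scalingCoord])
    exact h.comp x (contMDiff_scalingCoord Γ x)

end ScalingGroup

section orb
/-- The orbit space `M/G`, with the quotient topology. -/
abbrev Orb (G M : Type*) [Group G] [MulAction G M] : Type _ := MulAction.orbitRel.Quotient G M

/-- The projection `M → M/G`. -/
abbrev orb (G : Type*) {M : Type*} [Group G] [MulAction G M] (x : M) : Orb G M :=
  Quotient.mk _ x

variable {G H M : Type*} [Group G] [Group H] [MulAction G M] [MulAction H M]

theorem orb_eq_orb {x y : M} : orb G x = orb G y ↔ ∃ g : G, g • y = x := by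
  rw [Quotient.eq]; exact Iff.rfl

/-- The action of `H` induced on `M/G` when the actions of `G` and `H` commute. -/
instance [SMulCommClass G H M] : MulAction H (Orb G M) where
  smul h := Quotient.map (fun x => h • x) (by
    rintro _ y ⟨g, rfl⟩
    exact ⟨g, smul_comm g h y⟩)
  one_smul := by
    rintro ⟨x⟩
    exact congrArg (orb G) (one_smul H x)
  mul_smul := by
    rintro h h' ⟨x⟩
    exact congrArg (orb G) (mul_smul h h' x)

theorem smul_orb [SMulCommClass G H M] (h : H) (x : M) : h • orb G x = orb G (h • x) := rfl

theorem exists_smul_orb_eq_out [SMulCommClass H G M] (x : M) (b : Orb G (Orb H M))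
    (hx : orb G (orb H x) = b) : ∃ g : G, orb H (g • x) = b.out :=
  orb_eq_orb.mp ((Quotient.out_eq b).trans hx.symm)
end orb


section sympl
variable {E : Type*} [NormedAddCommGroup E] [NormedSpace ℝ E] {M : Type*} [TopologicalSpace M] [ChartedSpace E M]

/-- The differential of a function, as a covector. -/
noncomputable def differential (f : M → ℝ) (x : M) : TangentSpace 𝓘(ℝ, E) x →L[ℝ] ℝ :=
  mfderiv 𝓘(ℝ, E) 𝓘(ℝ, ℝ) f x

/-- Smoothness of a vector field. -/
def IsSmoothField [IsManifold 𝓘(ℝ, E) ∞ M] (X : ∀ x : M, TangentSpace 𝓘(ℝ, E) x) : Prop :=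
  ContMDiff 𝓘(ℝ, E) 𝓘(ℝ, E).tangent ∞ (fun x => (⟨x, X x⟩ : TangentBundle 𝓘(ℝ, E) M))

/-- The 2-form is closed: its exterior derivative, expressed by the values on smooth vector
fields, vanishes. -/
def IsClosedForm [IsManifold 𝓘(ℝ, E) ∞ M]
    (form : ∀ x : M, TangentSpace 𝓘(ℝ, E) x →L[ℝ] TangentSpace 𝓘(ℝ, E) x →L[ℝ] ℝ) :
    Prop :=
  ∀ X Y Z : (∀ x : M, TangentSpace 𝓘(ℝ, E) x),
    IsSmoothField X → IsSmoothField Y → IsSmoothField Z → ∀ x,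
    differential (fun y => form y (Y y) (Z y)) x (X x)
      - differential (fun y => form y (X y) (Z y)) x (Y x)
      + differential (fun y => form y (X y) (Y y)) x (Z x)
      - form x (VectorField.mlieBracket 𝓘(ℝ, E) X Y x) (Z x)
      + form x (VectorField.mlieBracket 𝓘(ℝ, E) X Z x) (Y x)
      - form x (VectorField.mlieBracket 𝓘(ℝ, E) Y Z x) (X x) = 0

variable (E M) in
/-- A symplectic form: a smooth non-degenerate closed 2-form. -/
structure SymplecticForm [IsManifold 𝓘(ℝ, E) ∞ M] where
  form : ∀ x : M, TangentSpace 𝓘(ℝ, E) x →L[ℝ] TangentSpace 𝓘(ℝ, E) x →L[ℝ] ℝ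
  contMDiff_form : ContMDiff 𝓘(ℝ, E) (𝓘(ℝ, E).prod 𝓘(ℝ, E →L[ℝ] E →L[ℝ] ℝ)) ∞
    (fun x => TotalSpace.mk' (E →L[ℝ] E →L[ℝ] ℝ)
      (E := fun x : M => TangentSpace 𝓘(ℝ, E) x →L[ℝ] TangentSpace 𝓘(ℝ, E) x →L[ℝ] ℝ) x (form x))
  skew : ∀ x v w, form x v w = - form x w v
  nondegenerate : ∀ x v, (∀ w, form x v w = 0) → v = 0
  closed : IsClosedForm form
end sympl

section principal

variable {EG E EB G M : Type*}
  [NormedAddCommGroup EG] [NormedSpace ℝ EG] [NormedAddCommGroup E] [NormedSpace ℝ E]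
  [NormedAddCommGroup EB] [NormedSpace ℝ EB]
  [Group G] [TopologicalSpace G] [ChartedSpace EG G]
  [TopologicalSpace M] [ChartedSpace E M] [MulAction G M] [ChartedSpace EB (Orb G M)]

variable (EG E EB G M) in
/-- The action of `G` on `M` is principal, and the given manifold structure on the orbit space is
that of the quotient: the action is smooth and free, the projection `M → M/G` is smooth, and it is
a locally trivial principal bundle. A local trivialization over `U` is given by a section `σ`,
smooth on `U`, and by the smooth map `τ` with `x = τ x • σ [x]`; the trivialization is
`x ↦ ([x], τ x)`, with inverse `(c, g) ↦ g • σ c`. The values of `σ` and `τ` off `U` and its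
preimage play no role. -/
structure IsPrincipalAction : Prop where
  contMDiff_smul : ContMDiff (𝓘(ℝ, EG).prod 𝓘(ℝ, E)) 𝓘(ℝ, E) ∞ (fun p : G × M => p.1 • p.2)
  contMDiff_orb : ContMDiff 𝓘(ℝ, E) 𝓘(ℝ, EB) ∞ (orb G : M → Orb G M)
  free : ∀ (g : G) (x : M), g • x = x → g = 1
  locally_trivial : ∀ b : Orb G M, ∃ U : Set (Orb G M), IsOpen U ∧ b ∈ U ∧
    ∃ σ : Orb G M → M, (∀ c, orb G (σ c) = c) ∧ ContMDiffOn 𝓘(ℝ, EB) 𝓘(ℝ, E) ∞ σ U ∧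
    ∃ τ : M → G, ContMDiffOn 𝓘(ℝ, E) 𝓘(ℝ, EG) ∞ τ (orb G ⁻¹' U) ∧
      ∀ x, orb G x ∈ U → τ x • σ (orb G x) = x

namespace IsPrincipalAction

theorem smul_left_injective (h : IsPrincipalAction EG E EB G M)
    {g g' : G} {x : M} (e : g • x = g' • x) : g = g' := by
  have : (g'⁻¹ * g) • x = x := by rw [mul_smul, e, inv_smul_smul]
  have := h.free _ _ this
  exact (inv_mul_eq_one.mp this).symm

theorem contMDiff_const_smul (h : IsPrincipalAction EG E EB G M)
    [IsManifold 𝓘(ℝ, E) ∞ M] (g : G) : ContMDiff 𝓘(ℝ, E) 𝓘(ℝ, E) ∞ (fun x : M => g • x) :=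
  h.contMDiff_smul.comp (contMDiff_const.prodMk contMDiff_id)

/-- The group element relating two smooth maps with the same projection is smooth. -/
theorem exists_div (h : IsPrincipalAction EG E EB G M)
    [LieGroup 𝓘(ℝ, EG) ∞ G] {EN N : Type*} [NormedAddCommGroup EN] [NormedSpace ℝ EN] [TopologicalSpace N]
    [ChartedSpace EN N] {U : Set N} (hU : IsOpen U) {a b : N → M}
    (ha : ContMDiffOn 𝓘(ℝ, EN) 𝓘(ℝ, E) ∞ a U) (hb : ContMDiffOn 𝓘(ℝ, EN) 𝓘(ℝ, E) ∞ b U)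
    (hab : ∀ n ∈ U, orb G (a n) = orb G (b n)) :
    ∃ g : N → G, ContMDiffOn 𝓘(ℝ, EN) 𝓘(ℝ, EG) ∞ g U ∧ ∀ n ∈ U, b n = g n • a n := by
  classical
  have key : ∀ n : N, ∃ g : G, n ∈ U → b n = g • a n := by
    intro n
    by_cases hn : n ∈ U
    · obtain ⟨g, hg⟩ := orb_eq_orb.mp (hab n hn).symm
      exact ⟨g, fun _ => hg.symm⟩
    · exact ⟨1, fun h => absurd h hn⟩
  choose g hg using key
  refine ⟨g, ?_, hg⟩
  intro n hn
  obtain ⟨V, hV, hnV, σ, hσ, -, τ, hτ, hτσ⟩ := h.locally_trivial (orb G (a n))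
  have haC : ContMDiffAt 𝓘(ℝ, EN) 𝓘(ℝ, E) ∞ a n := ha.contMDiffAt (hU.mem_nhds hn)
  have hbC : ContMDiffAt 𝓘(ℝ, EN) 𝓘(ℝ, E) ∞ b n := hb.contMDiffAt (hU.mem_nhds hn)
  have hopen : IsOpen (orb G ⁻¹' V : Set M) := hV.preimage h.contMDiff_orb.continuous
  have h1 : ContMDiffAt 𝓘(ℝ, EN) 𝓘(ℝ, EG) ∞ (fun m => τ (a m)) n :=
    (hτ.contMDiffAt (hopen.mem_nhds hnV)).comp n haC
  have h2 : ContMDiffAt 𝓘(ℝ, EN) 𝓘(ℝ, EG) ∞ (fun m => τ (b m)) n :=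
    (hτ.contMDiffAt (hopen.mem_nhds (by simpa [← hab n hn] using hnV))).comp n hbC
  have h3 : ContMDiffAt 𝓘(ℝ, EN) 𝓘(ℝ, EG) ∞ (fun m => τ (b m) * (τ (a m))⁻¹) n := h2.mul h1.inv
  refine (h3.congr_of_eventuallyEq ?_).contMDiffWithinAt
  filter_upwards [hU.mem_nhds hn, haC.continuousAt.preimage_mem_nhds (hopen.mem_nhds hnV)]
    with m hm hmV
  have hmV' : orb G (a m) ∈ V := hmV
  apply h.smul_left_injective (x := a m)
  rw [← hg m hm, mul_smul]
  have e1 := hτσ (a m) hmV'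
  have e2 := hτσ (b m) (by rw [← hab m hm]; exact hmV')
  have : (τ (a m))⁻¹ • a m = σ (orb G (a m)) := by rw [inv_smul_eq_iff, e1]
  rw [this, hab m hm, e2]

end IsPrincipalAction
end principal

section frames

variable {EB B : Type*} [NormedAddCommGroup EB] [NormedSpace ℝ EB] [TopologicalSpace B]
  [ChartedSpace EB B]

variable (EB) in
/-- Local frames of a family of one-dimensional spaces, through their coordinates: `coord i b` is
the coordinate of `V b` with respect to the `i`-th frame, defined over the open set `dom i`, and
the changes of frame are smooth. -/
structure LineFrames (V : B → Type*) [∀ b, AddCommGroup (V b)] [∀ b, Module ℝ (V b)]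
    [∀ b, TopologicalSpace (V b)] where
  dom : B → Set B
  isOpen_dom : ∀ i, IsOpen (dom i)
  mem_dom : ∀ i, i ∈ dom i
  coord : ∀ i b : B, V b ≃L[ℝ] ℝ
  contMDiffOn_coord : ∀ i j, ContMDiffOn 𝓘(ℝ, EB) 𝓘(ℝ, ℝ) ∞
    (fun b => coord j b ((coord i b).symm 1)) (dom i ∩ dom j)

namespace LineFrames

variable {V : B → Type*} [∀ b, AddCommGroup (V b)] [∀ b, Module ℝ (V b)]
    [∀ b, TopologicalSpace (V b)] (Φ : LineFrames EB V)

/-- The local trivialization of a frame. -/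
noncomputable def pretriv (i : B) : Pretrivialization ℝ (π ℝ V) where
  toFun v := (v.1, Φ.coord i v.1 v.2)
  invFun p := ⟨p.1, (Φ.coord i p.1).symm p.2⟩
  source := π ℝ V ⁻¹' Φ.dom i
  target := Φ.dom i ×ˢ Set.univ
  map_source' v hv := ⟨hv, trivial⟩
  map_target' p hp := hp.1
  left_inv' v _ := by simp
  right_inv' p _ := by simp
  open_target := (Φ.isOpen_dom i).prod isOpen_univ
  baseSet := Φ.dom i
  open_baseSet := Φ.isOpen_dom i
  source_eq := rfl
  target_eq := rfl
  proj_toFun _ _ := rfl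

theorem pretriv_symm (i b : B) (hb : b ∈ Φ.dom i) (r : ℝ) :
    (Φ.pretriv i).symm b r = (Φ.coord i b).symm r := by
  have := (Φ.pretriv i).symm_apply hb r
  rw [this]
  rfl

theorem coord_eq (i j b : B) (r : ℝ) :
    Φ.coord j b ((Φ.coord i b).symm r) = Φ.coord j b ((Φ.coord i b).symm 1) * r := by
  have : (Φ.coord i b).symm r = r • (Φ.coord i b).symm 1 := by
    rw [← map_smul, smul_eq_mul, mul_one]
  rw [this, map_smul, smul_eq_mul, mul_comm]

/-- The vector bundle with prescribed smooth local frames. -/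
noncomputable def prebundle : VectorPrebundle ℝ ℝ V where
  pretrivializationAtlas := Set.range Φ.pretriv
  pretrivialization_linear' := by
    rintro _ ⟨i, rfl⟩
    exact ⟨fun b _ => (Φ.coord i b).toLinearMap.isLinear⟩
  pretrivializationAt := Φ.pretriv
  mem_base_pretrivializationAt := Φ.mem_dom
  pretrivialization_mem_atlas _ := ⟨_, rfl⟩
  exists_coordChange := by
    rintro _ ⟨i, rfl⟩ _ ⟨j, rfl⟩
    refine ⟨fun b => ContinuousLinearMap.mul ℝ ℝ (Φ.coord j b ((Φ.coord i b).symm 1)), ?_, ?_⟩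
    · exact (ContinuousLinearMap.mul ℝ ℝ).continuous.comp_continuousOn
        (Φ.contMDiffOn_coord i j).continuousOn
    · intro b hb r
      rw [Φ.pretriv_symm i b hb.1]
      exact (Φ.coord_eq i j b r).symm
  totalSpaceMk_isInducing b := by
    have h1 : Topology.IsInducing (fun r : ℝ => (b, r)) := Topology.isInducing_const_prod.2 .id
    exact h1.comp (Φ.coord b b).toHomeomorph.isInducing

theorem prebundle_isContMDiff : Φ.prebundle.IsContMDiff 𝓘(ℝ, EB) ∞ where
  exists_contMDiffCoordChange := by
    rintro _ ⟨i, rfl⟩ _ ⟨j, rfl⟩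
    refine ⟨fun b => ContinuousLinearMap.mul ℝ ℝ (Φ.coord j b ((Φ.coord i b).symm 1)), ?_, ?_⟩
    · exact (ContinuousLinearMap.mul ℝ ℝ).contMDiff.comp_contMDiffOn (Φ.contMDiffOn_coord i j)
    · intro b hb r
      rw [Φ.pretriv_symm i b hb.1]
      exact (Φ.coord_eq i j b r).symm

end LineFrames
end frames
section curves

theorem IsPrincipalAction.exists_section {EG E EB G M : Type*}
    [NormedAddCommGroup EG] [NormedSpace ℝ EG] [NormedAddCommGroup E] [NormedSpace ℝ E]
    [NormedAddCommGroup EB] [NormedSpace ℝ EB]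
    [Group G] [TopologicalSpace G] [ChartedSpace EG G] [LieGroup 𝓘(ℝ, EG) ∞ G]
    [TopologicalSpace M] [ChartedSpace E M] [IsManifold 𝓘(ℝ, E) ∞ M]
    [MulAction G M] [ChartedSpace EB (Orb G M)]
    (h : IsPrincipalAction EG E EB G M) (x : M) :
    ∃ σ : Orb G M → M, (∀ c, orb G (σ c) = c) ∧ σ (orb G x) = x ∧
      ContMDiffAt 𝓘(ℝ, EB) 𝓘(ℝ, E) ∞ σ (orb G x) ∧
      ∃ ρ : M → G, ρ x = 1 ∧ ContMDiffAt 𝓘(ℝ, E) 𝓘(ℝ, EG) ∞ ρ x ∧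
        ∀ᶠ y in nhds x, ρ y • σ (orb G y) = y := by
  obtain ⟨U, hU, hxU, σ, hσ, hσs, τ, hτ, hτσ⟩ := h.locally_trivial (orb G x)
  have hopen : IsOpen (orb G ⁻¹' U : Set M) := hU.preimage h.contMDiff_orb.continuous
  refine ⟨fun c => τ x • σ c, ?_, hτσ x hxU, ?_, fun y => τ y * (τ x)⁻¹, mul_inv_cancel _, ?_, ?_⟩
  · intro c
    rw [← hσ c, orb_eq_orb, hσ c]
    exact ⟨τ x, rfl⟩
  · exact (h.contMDiff_const_smul (τ x)).contMDiffAt.comp _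
      (hσs.contMDiffAt (hU.mem_nhds hxU))
  · exact (hτ.contMDiffAt (hopen.mem_nhds hxU)).mul contMDiffAt_const
  · filter_upwards [hopen.mem_nhds hxU] with y hy
    rw [mul_smul, inv_smul_smul, hτσ y hy]

/-- The tangent map read in the model spaces. -/
noncomputable def tmap (E E' : Type*) {M M' : Type*} [NormedAddCommGroup E] [NormedSpace ℝ E]
    [NormedAddCommGroup E'] [NormedSpace ℝ E'] [TopologicalSpace M] [ChartedSpace E M]
    [TopologicalSpace M'] [ChartedSpace E' M'] (f : M → M') (x : M) : E →L[ℝ] E' :=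
  mfderiv 𝓘(ℝ, E) 𝓘(ℝ, E') f x

section tmap
variable {E E' E'' M M' M'' : Type*} [NormedAddCommGroup E] [NormedSpace ℝ E]
  [NormedAddCommGroup E'] [NormedSpace ℝ E'] [NormedAddCommGroup E''] [NormedSpace ℝ E'']
  [TopologicalSpace M] [ChartedSpace E M] [TopologicalSpace M'] [ChartedSpace E' M']
  [TopologicalSpace M''] [ChartedSpace E'' M'']

theorem tmap_comp {f : M → M'} {g : M' → M''} {x : M} {y : M'}
    (hg : MDifferentiableAt 𝓘(ℝ, E') 𝓘(ℝ, E'') g y)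
    (hf : MDifferentiableAt 𝓘(ℝ, E) 𝓘(ℝ, E') f x) (hy : f x = y) :
    tmap E E'' (fun z => g (f z)) x = (tmap E' E'' g y).comp (tmap E E' f x) :=  by
  subst hy
  exact mfderiv_comp x hg hf

theorem tmap_id (x : M) : tmap E E (fun y : M => y) x = ContinuousLinearMap.id ℝ E := mfderiv_id

theorem tmap_congr {f g : M → M'} {x : M} (h : f =ᶠ[nhds x] g) : tmap E E' f x = tmap E E' g x :=
  Filter.EventuallyEq.mfderiv_eq h

theorem tmap_comp₂ {a : M' → M'' → M''} {f : M → M'} {g : M → M''} {x : M} {y : M'} {z : M''}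
    (ha : MDifferentiableAt (𝓘(ℝ, E').prod 𝓘(ℝ, E'')) 𝓘(ℝ, E'') (fun p : M' × M'' => a p.1 p.2) (y, z))
    (hf : MDifferentiableAt 𝓘(ℝ, E) 𝓘(ℝ, E') f x)
    (hg : MDifferentiableAt 𝓘(ℝ, E) 𝓘(ℝ, E'') g x) (hy : f x = y) (hz : g x = z) (u : E) :
    tmap E E'' (fun w => a (f w) (g w)) x u =
      tmap E' E'' (fun w => a w z) y (tmap E E' f x u) +
        tmap E'' E'' (fun w => a y w) z (tmap E E'' g x u) := by
  subst hy hz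
  have h1 := mfderiv_comp x ha (hf.prodMk hg)
  rw [hf.mfderiv_prod hg, mfderiv_prod_eq_add_comp ha] at h1
  exact congrArg (fun L : E →L[ℝ] E'' => L u) h1

end tmap

variable {E EB M : Type*} [NormedAddCommGroup E] [NormedSpace ℝ E]
  [NormedAddCommGroup EB] [NormedSpace ℝ EB]
  (Γ : Subgroup ℝˣ) [Fact (Γ = ⊤ ∨ Γ = Units.posSubgroup ℝ)]
  [TopologicalSpace M] [ChartedSpace E M] [MulAction Γ M] [ChartedSpace EB (Orb Γ M)]

/-- The infinitesimal generator `Δ` of the action of `Γ`: the velocity of `s ↦ s • x` at `s = 1`. -/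
noncomputable def eulerField (x : M) : TangentSpace 𝓘(ℝ, E) x :=
  mfderiv 𝓘(ℝ, ℝ) 𝓘(ℝ, E) (fun s : Γ => s • x) 1 (1 : ℝ)


variable {Γ}

variable (E Γ) in
/-- The infinitesimal generator read in the model space. -/
noncomputable def eulerVec (x : M) : E := tmap ℝ E (fun s : Γ => s • x) 1 1

theorem eulerField_eq (x : M) : eulerField Γ x = eulerVec E Γ x := rfl

theorem tmap_smul_left_apply (x : M) (r : ℝ) :
    tmap ℝ E (fun s : Γ => s • x) 1 r = r • eulerVec E Γ x := by
  have h := (tmap ℝ E (fun s : Γ => s • x) 1).map_smul r 1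
  rw [smul_eq_mul, mul_one] at h
  exact h

theorem eulerField_of_equivariant {E' M' : Type*} [NormedAddCommGroup E'] [NormedSpace ℝ E']
    [TopologicalSpace M'] [ChartedSpace E' M'] [MulAction Γ M']
    (hM : ContMDiff (𝓘(ℝ, ℝ).prod 𝓘(ℝ, E)) 𝓘(ℝ, E) ∞ (fun p : Γ × M => p.1 • p.2))
    {f : M → M'} {x : M} (hf : MDifferentiableAt 𝓘(ℝ, E) 𝓘(ℝ, E') f x)
    (hfe : ∀ (s : Γ) (y : M), f (s • y) = s • f y) :
    tmap E E' f x (eulerVec E Γ x) = eulerVec E' Γ (f x) := by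
  have h1 : MDifferentiableAt 𝓘(ℝ, ℝ) 𝓘(ℝ, E) (fun s : Γ => s • x) 1 :=
    ((hM.comp (contMDiff_id.prodMk contMDiff_const)).mdifferentiable (by simp)) 1
  have h2 := tmap_comp hf h1 (one_smul _ _)
  simp only [hfe] at h2
  unfold eulerVec
  rw [h2]
  rfl

theorem IsPrincipalAction.ker_tmap_orb [IsManifold 𝓘(ℝ, E) ∞ M]
    (h : IsPrincipalAction ℝ E EB Γ M) (x : M) (u : E)
    (hu : tmap E EB (orb Γ) x u = 0) :
    ∃ r : ℝ, u = r • eulerVec E Γ x := by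
  obtain ⟨σ, hσ, hσx, hσs, ρ, hρx, hρs, hρσ⟩ := h.exists_section x
  have hp : MDifferentiableAt 𝓘(ℝ, E) 𝓘(ℝ, EB) (orb Γ : M → Orb Γ M) x :=
    h.contMDiff_orb.mdifferentiable (by simp) x
  have hσd := hσs.mdifferentiableAt (by simp)
  have hρd := hρs.mdifferentiableAt (by simp)
  have hσp : MDifferentiableAt 𝓘(ℝ, E) 𝓘(ℝ, E) (fun y : M => σ (orb Γ y)) x := hσd.comp x hp
  have ha : MDifferentiableAt (𝓘(ℝ, ℝ).prod 𝓘(ℝ, E)) 𝓘(ℝ, E)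
      (fun p : Γ × M => p.1 • p.2) (1, x) := h.contMDiff_smul.mdifferentiable (by simp) _
  have h1 := tmap_comp₂ (a := fun (s : Γ) (y : M) => s • y) ha hρd hσp hρx hσx u
  rw [tmap_congr hρσ, tmap_id, tmap_comp hσd hp rfl, ContinuousLinearMap.comp_apply, hu, map_zero,
    map_zero, add_zero, tmap_smul_left_apply] at h1
  exact ⟨_, h1⟩

theorem IsPrincipalAction.eulerField_ne_zero [IsManifold 𝓘(ℝ, E) ∞ M]
    (h : IsPrincipalAction ℝ E EB Γ M) (x : M) : eulerVec E Γ x ≠ 0 := by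
  intro h0
  obtain ⟨σ, hσ, hσx, hσs, ρ, hρx, hρs, hρσ⟩ := h.exists_section x
  have hρd := hρs.mdifferentiableAt (by simp)
  have h1 : MDifferentiableAt 𝓘(ℝ, ℝ) 𝓘(ℝ, E) (fun s : Γ => s • x) 1 :=
    ((h.contMDiff_smul.comp (contMDiff_id.prodMk contMDiff_const)).mdifferentiable (by simp)) 1
  have hev : (fun s : Γ => ρ (s • x)) =ᶠ[nhds 1] fun s => s := by
    have : Filter.Tendsto (fun s : Γ => s • x) (nhds 1) (nhds x) := by
      have := h1.continuousAt.tendsto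
      rwa [one_smul] at this
    filter_upwards [this.eventually hρσ] with s hs
    have e : orb Γ (s • x) = orb Γ x := orb_eq_orb.mpr ⟨s, rfl⟩
    rw [e, hσx] at hs
    exact h.smul_left_injective hs
  have h2 := tmap_comp hρd h1 (one_smul _ _)
  rw [tmap_congr hev, tmap_id] at h2
  have h3 := congrArg (fun L : ℝ →L[ℝ] ℝ => L 1) h2
  have h4 : (1 : ℝ) = tmap E ℝ ρ x (eulerVec E Γ x) := h3
  rw [h0, map_zero] at h4
  exact one_ne_zero h4

end curves
section assoc

theorem scalingCoord_ne_zero {Γ : Subgroup ℝˣ} (s : Γ) : scalingCoord s ≠ 0 := Units.ne_zero _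

theorem scalingCoord_mul {Γ : Subgroup ℝˣ} (s t : Γ) :
    scalingCoord (s * t) = scalingCoord s * scalingCoord t := by
  simp [scalingCoord]

theorem scalingCoord_one {Γ : Subgroup ℝˣ} : scalingCoord (1 : Γ) = 1 := rfl

variable {Γ : Subgroup ℝˣ} [Fact (Γ = ⊤ ∨ Γ = Units.posSubgroup ℝ)]
  {E EB M : Type*} [NormedAddCommGroup E] [NormedSpace ℝ E]
  [NormedAddCommGroup EB] [NormedSpace ℝ EB]
  [TopologicalSpace M] [ChartedSpace E M] [MulAction Γ M] [ChartedSpace EB (Orb Γ M)]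

variable (Γ M) in
/-- The orbit relation of the action `s • (x, t) = (s • x, t / s)` of `Γ` on `M × ℝ`. -/
def assocSetoid : Setoid (M × ℝ) where
  r p q := ∃ s : Γ, q = (s • p.1, p.2 / scalingCoord s)
  iseqv :=
    { refl := fun p => ⟨1, by simp [scalingCoord_one]⟩
      symm := by
        rintro p _ ⟨s, rfl⟩
        refine ⟨s⁻¹, ?_⟩
        have h := scalingCoord_ne_zero s
        have h2 : scalingCoord s⁻¹ = (scalingCoord s)⁻¹ := by simp [scalingCoord]
        ext
        · simp
        · simp [h2, h]
      trans := by
        rintro p _ _ ⟨s, rfl⟩ ⟨t, rfl⟩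
        exact ⟨t * s, Prod.ext (mul_smul t s p.1).symm (by
          simp [scalingCoord_mul, div_div, mul_comm])⟩ }

variable (Γ M) in
/-- The total space `(M × ℝ)/Γ` as a set. -/
abbrev AssocLine : Type _ := Quotient (assocSetoid Γ M)

/-- The projection `(M × ℝ)/Γ → M/Γ`, `[(x, t)] ↦ [x]`. -/
def AssocLine.proj : AssocLine Γ M → Orb Γ M :=
  Quotient.lift (fun p => orb Γ p.1) (by
    rintro p _ ⟨s, rfl⟩
    exact orb_eq_orb.mpr ⟨s⁻¹, by simp⟩)

/-- The fibre of `(M × ℝ)/Γ → M/Γ` over `k`. -/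
def AssocFiber (_ : IsPrincipalAction ℝ E EB Γ M) (k : Orb Γ M) : Type _ :=
  {q : AssocLine Γ M // q.proj = k}

variable (h : IsPrincipalAction ℝ E EB Γ M)

/-- The element `[(x, t)]` in the fibre over `[x]`. -/
def AssocFiber.mk (x : M) (t : ℝ) : AssocFiber h (orb Γ x) :=
  ⟨Quotient.mk _ (x, t), rfl⟩

namespace AssocFiber

/-- `[(x, t)]` in the fibre over `k = [x]`. -/
def mkAt (x : M) (k : Orb Γ M) (hx : orb Γ x = k) (t : ℝ) : AssocFiber h k :=
  ⟨Quotient.mk _ (x, t), hx⟩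

theorem mkAt_bijective (x : M) (k : Orb Γ M) (hx : orb Γ x = k) :
    Function.Bijective (mkAt h x k hx) := by
  constructor
  · intro t t' e
    obtain ⟨s, hs⟩ := Quotient.exact (congrArg Subtype.val e)
    have h1 : s = 1 := h.free s x (congrArg Prod.fst hs).symm
    have h2 := congrArg Prod.snd hs
    simpa [h1, scalingCoord_one] using h2.symm
  · rintro ⟨q, hq⟩
    induction q using Quotient.inductionOn with
    | h p =>
      obtain ⟨y, t⟩ := p
      obtain ⟨s, hs⟩ := orb_eq_orb.mp (hq.trans hx.symm)
      refine ⟨t * scalingCoord s, Subtype.ext (Quotient.sound ⟨s, ?_⟩)⟩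
      simp [hs, scalingCoord_ne_zero]

/-- The bijection `[(x, t)] ↦ t` of the fibre over `k = [x]` with `ℝ`, for one choice of `x`. -/
noncomputable def outEquiv (k : Orb Γ M) : AssocFiber h k ≃ ℝ :=
  (Equiv.ofBijective _ (mkAt_bijective h k.out k (Quotient.out_eq k))).symm

/-- The vector space structure with `a [(x, t)] + b [(x, u)] = [(x, a t + b u)]`. -/
noncomputable instance (k : Orb Γ M) : AddCommGroup (AssocFiber h k) := (outEquiv h k).addCommGroup

noncomputable instance (k : Orb Γ M) : Module ℝ (AssocFiber h k) := (outEquiv h k).module ℝ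

noncomputable instance (k : Orb Γ M) : TopologicalSpace (AssocFiber h k) :=
  TopologicalSpace.induced (outEquiv h k) inferInstance

/-- The bijection `[(x, t)] ↦ t` as an isomorphism of topological vector spaces. -/
noncomputable def outLin (k : Orb Γ M) : AssocFiber h k ≃L[ℝ] ℝ :=
  { (outEquiv h k).linearEquiv ℝ with
    continuous_toFun := continuous_induced_dom
    continuous_invFun := by
      refine continuous_induced_rng.mpr ?_
      have : (outEquiv h k) ∘ (outEquiv h k).symm = id := by ext; simp
      exact this ▸ continuous_id }

theorem outLin_symm (k : Orb Γ M) (t : ℝ) :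
    (outLin h k).symm t = mkAt h k.out k (Quotient.out_eq k) t := rfl

theorem mkAt_eq (x y : M) (k : Orb Γ M) (hx : orb Γ x = k) (hy : orb Γ y = k) (s : Γ)
    (hs : y = s • x) (t : ℝ) : mkAt h y k hy t = mkAt h x k hx (t * scalingCoord s) := by
  subst hs
  refine Subtype.ext (Quotient.sound ((assocSetoid Γ M).symm ⟨s, ?_⟩))
  simp [scalingCoord_ne_zero]

/-- The coordinate with respect to the basis vector `[(x, 1)]` of a fibre. -/
noncomputable def coord (x : M) (k : Orb Γ M) (hx : orb Γ x = k) : AssocFiber h k ≃L[ℝ] ℝ := by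
  refine ContinuousLinearEquiv.trans (outLin h k) ?_
  have hs : ∃ s : Γ, x = s • k.out :=
    (orb_eq_orb.mp (hx.trans (Quotient.out_eq k).symm)).imp fun _ h => h.symm
  exact ContinuousLinearEquiv.smulLeft (Units.mk0 _ (scalingCoord_ne_zero hs.choose))⁻¹

theorem coord_symm (x : M) (k : Orb Γ M) (hx : orb Γ x = k) (t : ℝ) :
    (coord h x k hx).symm t = mkAt h x k hx t := by
  have hs : ∃ s : Γ, x = s • k.out :=
    (orb_eq_orb.mp (hx.trans (Quotient.out_eq k).symm)).imp fun _ h => h.symm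
  rw [mkAt_eq h k.out x k (Quotient.out_eq k) hx hs.choose hs.choose_spec, ← outLin_symm]
  have e : t * scalingCoord hs.choose =
      ((Units.mk0 _ (scalingCoord_ne_zero hs.choose))⁻¹)⁻¹ • t := by
    rw [inv_inv, mul_comm]
    rfl
  rw [e]
  rfl

theorem coord_mkAt (x : M) (k : Orb Γ M) (hx : orb Γ x = k) (t : ℝ) :
    coord h x k hx (mkAt h x k hx t) = t := by
  rw [← coord_symm, ContinuousLinearEquiv.apply_symm_apply]

/-- The smooth frames `k ↦ [(σ k, 1)]` of `(M × ℝ)/Γ`, for smooth local sections `σ` of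
`M → M/Γ`. -/
noncomputable def frames [IsManifold 𝓘(ℝ, EB) ∞ (Orb Γ M)] : LineFrames EB (AssocFiber h) where
  dom i := (h.locally_trivial i).choose
  isOpen_dom i := (h.locally_trivial i).choose_spec.1
  mem_dom i := (h.locally_trivial i).choose_spec.2.1
  coord i k := coord h ((h.locally_trivial i).choose_spec.2.2.choose k) k
    ((h.locally_trivial i).choose_spec.2.2.choose_spec.1 k)
  contMDiffOn_coord i j := by
    set a := (h.locally_trivial i).choose_spec.2.2.choose with ha
    set b := (h.locally_trivial j).choose_spec.2.2.choose with hb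
    have hai := (h.locally_trivial i).choose_spec.2.2.choose_spec
    have hbi := (h.locally_trivial j).choose_spec.2.2.choose_spec
    rw [← ha] at hai
    rw [← hb] at hbi
    set U := (h.locally_trivial i).choose ∩ (h.locally_trivial j).choose with hUdef
    have hU : IsOpen U :=
      (h.locally_trivial i).choose_spec.1.inter (h.locally_trivial j).choose_spec.1
    obtain ⟨g, hg, hgab⟩ := h.exists_div hU (hbi.2.1.mono Set.inter_subset_right)
      (hai.2.1.mono Set.inter_subset_left) (fun n _ => (hbi.1 n).trans (hai.1 n).symm)
    refine ((contMDiff_scalingCoord Γ).comp_contMDiffOn hg).congr ?_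
    intro k hk
    rw [coord_symm, mkAt_eq h (b k) (a k) k (hbi.1 k) (hai.1 k) (g k) (hgab k hk), coord_mkAt,
      one_mul]
    rfl

variable [IsManifold 𝓘(ℝ, EB) ∞ (Orb Γ M)]

noncomputable instance : TopologicalSpace (TotalSpace ℝ (AssocFiber h)) :=
  (frames h).prebundle.totalSpaceTopology

noncomputable instance : FiberBundle ℝ (AssocFiber h) := (frames h).prebundle.toFiberBundle

instance : VectorBundle ℝ ℝ (AssocFiber h) := (frames h).prebundle.toVectorBundle

instance : ContMDiffVectorBundle ∞ ℝ (AssocFiber h) 𝓘(ℝ, EB) :=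
  letI := (frames h).prebundle_isContMDiff
  (frames h).prebundle.contMDiffVectorBundle 𝓘(ℝ, EB)

end AssocFiber
end assoc
section sympl2
variable {E : Type*} [NormedAddCommGroup E] [NormedSpace ℝ E] {M : Type*} [TopologicalSpace M] [ChartedSpace E M] [IsManifold 𝓘(ℝ, E) ∞ M]

namespace SymplecticForm
variable (Ω : SymplecticForm E M)

/-- The Hamiltonian vector field `X_f`, defined by `i_{X_f} ω = df`. -/
noncomputable def hamiltonianField (f : M → ℝ) (x : M) : TangentSpace 𝓘(ℝ, E) x :=
  Function.invFun (fun v => Ω.form x v) (differential f x)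

/-- The Poisson bracket `{f, g} = ω(X_f, X_g)`. -/
noncomputable def poisson (f g : M → ℝ) (x : M) : ℝ :=
  Ω.form x (Ω.hamiltonianField f x) (Ω.hamiltonianField g x)

end SymplecticForm
end sympl2

section system
variable (E E₁ E₂ E₃ E₄ EG S G : Type*) (Γ : Subgroup ℝˣ) [Fact (Γ = ⊤ ∨ Γ = Units.posSubgroup ℝ)]
  [NormedAddCommGroup E] [NormedSpace ℝ E] [NormedAddCommGroup E₁] [NormedSpace ℝ E₁]
  [NormedAddCommGroup E₂] [NormedSpace ℝ E₂] [NormedAddCommGroup E₃] [NormedSpace ℝ E₃]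
  [NormedAddCommGroup E₄] [NormedSpace ℝ E₄] [NormedAddCommGroup EG] [NormedSpace ℝ EG]
  [TopologicalSpace S] [ChartedSpace E S] [IsManifold 𝓘(ℝ, E) ∞ S]
  [Group G] [TopologicalSpace G] [ChartedSpace EG G]
  [MulAction G S] [MulAction Γ S] [SMulCommClass G Γ S] [SMulCommClass Γ G S]
  [ChartedSpace E₁ (Orb G S)] [ChartedSpace E₂ (Orb Γ S)]
  [ChartedSpace E₃ (Orb Γ (Orb G S))] [ChartedSpace E₄ (Orb G (Orb Γ S))]

/-- A symplectic Hamiltonian system `(S, ω, H)`, `ω = sympl`, `H = ham`, with a scaling symmetry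
(a principal action of `Γ` with `φ_s^* ω = s ω` and `H ∘ φ_s = s H`) and a symplectic symmetry (a
principal action of `G` preserving `ω` and `H`). The two actions commute, which is a class
assumption, and the actions they induce on the orbit spaces `S/G` and `S/Γ` are principal too. -/
structure CompatibleSystem where
  sympl : SymplecticForm E S
  ham : S → ℝ
  contMDiff_ham : ContMDiff 𝓘(ℝ, E) 𝓘(ℝ, ℝ) ∞ ham
  principal_scaling : IsPrincipalAction ℝ E E₂ Γ S
  form_scaling : ∀ (s : Γ) (x : S) (v w : TangentSpace 𝓘(ℝ, E) x),
    sympl.form (s • x) (mfderiv 𝓘(ℝ, E) 𝓘(ℝ, E) (fun y : S => s • y) x v)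
      (mfderiv 𝓘(ℝ, E) 𝓘(ℝ, E) (fun y : S => s • y) x w) = scalingCoord s * sympl.form x v w
  ham_scaling : ∀ (s : Γ) (x : S), ham (s • x) = scalingCoord s * ham x
  principal_symmetry : IsPrincipalAction EG E E₁ G S
  form_symmetry : ∀ (g : G) (x : S) (v w : TangentSpace 𝓘(ℝ, E) x),
    sympl.form (g • x) (mfderiv 𝓘(ℝ, E) 𝓘(ℝ, E) (fun y : S => g • y) x v)
      (mfderiv 𝓘(ℝ, E) 𝓘(ℝ, E) (fun y : S => g • y) x w) = sympl.form x v w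
  ham_symmetry : ∀ (g : G) (x : S), ham (g • x) = ham x
  principal_scaling_quotient : IsPrincipalAction ℝ E₁ E₃ Γ (Orb G S)
  principal_symmetry_quotient : IsPrincipalAction EG E₂ E₄ G (Orb Γ S)
end system

namespace CompatibleSystem
variable {E E₁ E₂ E₃ E₄ EG S G : Type*} {Γ : Subgroup ℝˣ} [Fact (Γ = ⊤ ∨ Γ = Units.posSubgroup ℝ)]
  [NormedAddCommGroup E] [NormedSpace ℝ E] [NormedAddCommGroup E₁] [NormedSpace ℝ E₁]
  [NormedAddCommGroup E₂] [NormedSpace ℝ E₂] [NormedAddCommGroup E₃] [NormedSpace ℝ E₃]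
  [NormedAddCommGroup E₄] [NormedSpace ℝ E₄] [NormedAddCommGroup EG] [NormedSpace ℝ EG]
  [TopologicalSpace S] [ChartedSpace E S] [IsManifold 𝓘(ℝ, E) ∞ S]
  [Group G] [TopologicalSpace G] [ChartedSpace EG G]
  [MulAction G S] [MulAction Γ S] [SMulCommClass G Γ S] [SMulCommClass Γ G S]
  [ChartedSpace E₁ (Orb G S)] [ChartedSpace E₂ (Orb Γ S)]
  [ChartedSpace E₃ (Orb Γ (Orb G S))] [ChartedSpace E₄ (Orb G (Orb Γ S))]
  (sys : CompatibleSystem E E₁ E₂ E₃ E₄ EG S G Γ)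

/-- The 1-form `λ = -i_Δ ω`. -/
noncomputable def liouville (x : S) : TangentSpace 𝓘(ℝ, E) x →L[ℝ] ℝ :=
  -(sys.sympl.form x (eulerField Γ x))

/-- The contact distribution `𝒟 = Tp(ker λ)` on `C = S/Γ`, where `p : S → C` is the projection. -/
noncomputable def contactDistribution : Set (TangentBundle 𝓘(ℝ, E₂) (Orb Γ S)) :=
  tangentMap 𝓘(ℝ, E) 𝓘(ℝ, E₂) (orb Γ) '' {u | sys.liouville u.1 u.2 = 0}

/-- The annihilator of `𝒟` in the cotangent space at `c`. -/
def annihilator (c : Orb Γ S) : Submodule ℝ (TangentSpace 𝓘(ℝ, E₂) c →L[ℝ] ℝ) where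
  carrier := {α | ∀ v : TangentSpace 𝓘(ℝ, E₂) c,
    (⟨c, v⟩ : TangentBundle 𝓘(ℝ, E₂) (Orb Γ S)) ∈ sys.contactDistribution → α v = 0}
  add_mem' ha hb v hv := by simp [ha v hv, hb v hv]
  zero_mem' v _ := rfl
  smul_mem' r a ha v hv := by simp [ha v hv]

theorem mem_contactDistribution (c : Orb Γ S) (v : E₂) :
    (⟨c, v⟩ : TangentBundle 𝓘(ℝ, E₂) (Orb Γ S)) ∈ sys.contactDistribution ↔
      ∃ (y : S) (u : E), orb Γ y = c ∧ sys.liouville y u = 0 ∧ tmap E E₂ (orb Γ) y u = v := by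
  constructor
  · rintro ⟨⟨y, u⟩, hu, e⟩
    cases e
    exact ⟨y, u, rfl, hu, rfl⟩
  · rintro ⟨y, u, rfl, hu, rfl⟩
    exact ⟨⟨y, u⟩, hu, rfl⟩

theorem tmap_orb_surjective (sys : CompatibleSystem E E₁ E₂ E₃ E₄ EG S G Γ)
    (x : S) :
    Function.Surjective (tmap E E₂ (orb Γ) x) := by
  obtain ⟨σ, hσ, hσx, hσs, -⟩ := sys.principal_scaling.exists_section x
  have hp : MDifferentiableAt 𝓘(ℝ, E) 𝓘(ℝ, E₂) (orb Γ : S → Orb Γ S) x :=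
    sys.principal_scaling.contMDiff_orb.mdifferentiable (by simp) x
  have h := tmap_comp hp (hσs.mdifferentiableAt (by simp)) hσx
  simp only [hσ] at h
  rw [tmap_id] at h
  intro v
  exact ⟨_, (congrArg (fun L : E₂ →L[ℝ] E₂ => L v) h).symm⟩

theorem liouville_smul (s : Γ) (x : S) (u : E) :
    sys.liouville (s • x) (tmap E E (fun y : S => s • y) x u) =
      scalingCoord s * sys.liouville x u := by
  have hs : MDifferentiableAt 𝓘(ℝ, E) 𝓘(ℝ, E) (fun y : S => s • y) x :=
    (sys.principal_scaling.contMDiff_const_smul s).mdifferentiable (by simp) x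
  have h := eulerField_of_equivariant sys.principal_scaling.contMDiff_smul hs
    (fun t y => by rw [smul_smul, smul_smul, mul_comm])
  have h2 := sys.form_scaling s x (eulerVec E Γ x) u
  have h3 : sys.sympl.form (s • x) (eulerVec E Γ (s • x)) (tmap E E (fun y : S => s • y) x u) =
      scalingCoord s * sys.sympl.form x (eulerVec E Γ x) u := by
    rw [← h]; exact h2
  show -(sys.sympl.form (s • x) (eulerVec E Γ (s • x)) (tmap E E (fun y : S => s • y) x u)) =
    scalingCoord s * -(sys.sympl.form x (eulerVec E Γ x) u)
  rw [h3]; ring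

theorem liouville_symmetry (g : G) (x : S) (u : E) :
    sys.liouville (g • x) (tmap E E (fun y : S => g • y) x u) = sys.liouville x u := by
  have hs : MDifferentiableAt 𝓘(ℝ, E) 𝓘(ℝ, E) (fun y : S => g • y) x :=
    (sys.principal_symmetry.contMDiff_const_smul g).mdifferentiable (by simp) x
  have h := eulerField_of_equivariant sys.principal_scaling.contMDiff_smul hs
    (fun t y => smul_comm g t y)
  have h2 := sys.form_symmetry g x (eulerVec E Γ x) u
  have h3 : sys.sympl.form (g • x) (eulerVec E Γ (g • x)) (tmap E E (fun y : S => g • y) x u) =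
      sys.sympl.form x (eulerVec E Γ x) u := by
    rw [← h]; exact h2
  exact congrArg Neg.neg h3

theorem tmap_orb_smul (sys : CompatibleSystem E E₁ E₂ E₃ E₄ EG S G Γ)
    (s : Γ) (x : S) (u : E) :
    tmap E E₂ (orb Γ) (s • x) (tmap E E (fun y : S => s • y) x u) = tmap E E₂ (orb Γ) x u := by
  have hs : MDifferentiableAt 𝓘(ℝ, E) 𝓘(ℝ, E) (fun y : S => s • y) x :=
    (sys.principal_scaling.contMDiff_const_smul s).mdifferentiable (by simp) x
  have hp : MDifferentiableAt 𝓘(ℝ, E) 𝓘(ℝ, E₂) (orb Γ : S → Orb Γ S) (s • x) :=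
    sys.principal_scaling.contMDiff_orb.mdifferentiable (by simp) _
  have h := tmap_comp hp hs rfl
  have e : (fun y : S => orb Γ (s • y)) = orb Γ := by
    ext y; exact orb_eq_orb.mpr ⟨s, rfl⟩
  rw [e] at h
  exact (congrArg (fun L : E →L[ℝ] E₂ => L u) h).symm

theorem tmap_orb_symmetry (sys : CompatibleSystem E E₁ E₂ E₃ E₄ EG S G Γ)
    [IsManifold 𝓘(ℝ, E₂) ∞ (Orb Γ S)] (g : G) (x : S) (u : E) :
    tmap E E₂ (orb Γ) (g • x) (tmap E E (fun y : S => g • y) x u) =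
      tmap E₂ E₂ (fun c : Orb Γ S => g • c) (orb Γ x) (tmap E E₂ (orb Γ) x u) := by
  have hs : MDifferentiableAt 𝓘(ℝ, E) 𝓘(ℝ, E) (fun y : S => g • y) x :=
    (sys.principal_symmetry.contMDiff_const_smul g).mdifferentiable (by simp) x
  have hp : ∀ y, MDifferentiableAt 𝓘(ℝ, E) 𝓘(ℝ, E₂) (orb Γ : S → Orb Γ S) y :=
    sys.principal_scaling.contMDiff_orb.mdifferentiable (by simp)
  have hg : MDifferentiableAt 𝓘(ℝ, E₂) 𝓘(ℝ, E₂) (fun c : Orb Γ S => g • c) (orb Γ x) :=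
    (sys.principal_symmetry_quotient.contMDiff_const_smul g).mdifferentiable (by simp) _
  have h1 := tmap_comp (hp (g • x)) hs rfl
  have h2 := tmap_comp hg (hp x) rfl
  have h3 := h1.symm.trans h2
  exact congrArg (fun L : E →L[ℝ] E₂ => L u) h3

theorem liouville_eulerVec (x : S) (r : ℝ) : sys.liouville x (r • eulerVec E Γ x) = 0 := by
  have h : sys.sympl.form x (eulerVec E Γ x) (eulerVec E Γ x) = 0 := by
    have := sys.sympl.skew x (eulerVec E Γ x) (eulerVec E Γ x)
    linarith
  have h2 := (sys.liouville x).map_smul r (eulerVec E Γ x)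
  have h3 : sys.liouville x (eulerVec E Γ x) = 0 := by
    show -(sys.sympl.form x (eulerVec E Γ x) (eulerVec E Γ x)) = 0
    rw [h, neg_zero]
  rw [h3, smul_zero] at h2
  exact h2

theorem exists_liouville_ne_zero (x : S) : ∃ u : E, sys.liouville x u ≠ 0 := by
  by_contra hc
  push Not at hc
  refine sys.principal_scaling.eulerField_ne_zero x (sys.sympl.nondegenerate x _ fun w => ?_)
  have h : -(sys.sympl.form x (eulerVec E Γ x) w) = 0 := hc w
  linarith

theorem mem_contactDistribution_orb (x : S) (v : E₂) :
    (⟨orb Γ x, v⟩ : TangentBundle 𝓘(ℝ, E₂) (Orb Γ S)) ∈ sys.contactDistribution ↔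
      ∃ u : E, sys.liouville x u = 0 ∧ tmap E E₂ (orb Γ) x u = v := by
  rw [mem_contactDistribution]
  constructor
  · rintro ⟨y, u, hy, hu, rfl⟩
    obtain ⟨s, rfl⟩ := orb_eq_orb.mp hy.symm
    refine ⟨tmap E E (fun z : S => s • z) y u, ?_, sys.tmap_orb_smul s y u⟩
    rw [sys.liouville_smul, hu, mul_zero]
  · rintro ⟨u, hu, rfl⟩
    exact ⟨x, u, rfl, hu, rfl⟩

/-- The values of an annihilator on lifts determine it. -/
theorem annihilator_ext {c : Orb Γ S} {α β : sys.annihilator c} (x : S)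
    (h : ∀ u : E, α.1 (tmap E E₂ (orb Γ) x u) = β.1 (tmap E E₂ (orb Γ) x u)) : α = β := by
  refine Subtype.ext (ContinuousLinearMap.ext fun v => ?_)
  obtain ⟨u, rfl⟩ := sys.tmap_orb_surjective x v
  exact h u

theorem exists_covector (x : S) (c : Orb Γ S) (hx : orb Γ x = c) :
    ∃ α : sys.annihilator c, ∀ u : E, α.1 (tmap E E₂ (orb Γ) x u) = sys.liouville x u := by
  subst hx
  obtain ⟨σ, hσ, hσx, hσs, ρ, hρx, hρs, hρσ⟩ := sys.principal_scaling.exists_section x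
  have hp : MDifferentiableAt 𝓘(ℝ, E) 𝓘(ℝ, E₂) (orb Γ : S → Orb Γ S) x :=
    sys.principal_scaling.contMDiff_orb.mdifferentiable (by simp) x
  have hσd := hσs.mdifferentiableAt (by simp)
  have hρd := hρs.mdifferentiableAt (by simp)
  have hσp : MDifferentiableAt 𝓘(ℝ, E) 𝓘(ℝ, E) (fun y : S => σ (orb Γ y)) x := hσd.comp x hp
  have ha : MDifferentiableAt (𝓘(ℝ, ℝ).prod 𝓘(ℝ, E)) 𝓘(ℝ, E)
      (fun p : Γ × S => p.1 • p.2) (1, x) :=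
    sys.principal_scaling.contMDiff_smul.mdifferentiable (by simp) _
  let lam : E →L[ℝ] ℝ := sys.liouville x
  have key : ∀ u : E, lam (tmap E₂ E σ (orb Γ x) (tmap E E₂ (orb Γ) x u)) = lam u := by
    intro u
    have h1 := tmap_comp₂ (a := fun (s : Γ) (y : S) => s • y) ha hρd hσp hρx hσx u
    rw [tmap_congr hρσ, tmap_id, tmap_comp hσd hp rfl, tmap_smul_left_apply] at h1
    simp only [one_smul, tmap_id, ContinuousLinearMap.comp_apply, ContinuousLinearMap.id_apply]
      at h1
    have h2 := congrArg lam h1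
    rw [map_add, show lam (_ • _) = 0 from sys.liouville_eulerVec x _, zero_add] at h2
    exact h2.symm
  refine ⟨⟨lam.comp (tmap E₂ E σ (orb Γ x)), ?_⟩, key⟩
  intro v hv
  obtain ⟨u, hu, rfl⟩ := (sys.mem_contactDistribution_orb x v).mp hv
  exact (key u).trans hu

/-- The covector `α` of `𝒟°` at `c = [x]` such that `α (T_x p u) = λ_x u` for every `u`. -/
noncomputable def covectorAt (x : S) (c : Orb Γ S) (hx : orb Γ x = c) : sys.annihilator c :=
  (sys.exists_covector x c hx).choose

theorem covectorAt_apply (x : S) (c : Orb Γ S) (hx : orb Γ x = c) (u : E) :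
    (sys.covectorAt x c hx).1 (tmap E E₂ (orb Γ) x u) = sys.liouville x u :=
  (sys.exists_covector x c hx).choose_spec u

end CompatibleSystem
namespace CompatibleSystem
variable {E E₁ E₂ E₃ E₄ EG S G : Type*} {Γ : Subgroup ℝˣ} [Fact (Γ = ⊤ ∨ Γ = Units.posSubgroup ℝ)]
  [NormedAddCommGroup E] [NormedSpace ℝ E] [NormedAddCommGroup E₁] [NormedSpace ℝ E₁]
  [NormedAddCommGroup E₂] [NormedSpace ℝ E₂] [NormedAddCommGroup E₃] [NormedSpace ℝ E₃]
  [NormedAddCommGroup E₄] [NormedSpace ℝ E₄] [NormedAddCommGroup EG] [NormedSpace ℝ EG]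
  [TopologicalSpace S] [ChartedSpace E S] [IsManifold 𝓘(ℝ, E) ∞ S]
  [Group G] [TopologicalSpace G] [ChartedSpace EG G]
  [MulAction G S] [MulAction Γ S] [SMulCommClass G Γ S] [SMulCommClass Γ G S]
  [ChartedSpace E₁ (Orb G S)] [ChartedSpace E₂ (Orb Γ S)]
  [ChartedSpace E₃ (Orb Γ (Orb G S))] [ChartedSpace E₄ (Orb G (Orb Γ S))]
  (sys : CompatibleSystem E E₁ E₂ E₃ E₄ EG S G Γ)

theorem covectorAt_smul (sys : CompatibleSystem E E₁ E₂ E₃ E₄ EG S G Γ) (x y : S) (c : Orb Γ S)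
    (hx : orb Γ x = c) (hy : orb Γ y = c) (s : Γ) (hs : y = s • x) :
    sys.covectorAt y c hy = scalingCoord s • sys.covectorAt x c hx := by
  subst hs
  refine sys.annihilator_ext x fun u => ?_
  have h1 := sys.covectorAt_apply (s • x) c hy (tmap E E (fun y : S => s • y) x u)
  rw [sys.tmap_orb_smul, sys.liouville_smul] at h1
  rw [h1, ← sys.covectorAt_apply x c hx u]
  rfl

theorem covectorAt_ne_zero (x : S) (c : Orb Γ S) (hx : orb Γ x = c) :
    sys.covectorAt x c hx ≠ 0 := by
  intro h0
  obtain ⟨u, hu⟩ := sys.exists_liouville_ne_zero x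
  apply hu
  rw [← sys.covectorAt_apply x c hx u, h0]
  rfl

theorem exists_eq_smul_covectorAt (x : S) (c : Orb Γ S) (hx : orb Γ x = c)
    (α : sys.annihilator c) : ∃ t : ℝ, α = t • sys.covectorAt x c hx := by
  subst hx
  obtain ⟨w, hw⟩ := sys.exists_liouville_ne_zero x
  let lam : E →L[ℝ] ℝ := sys.liouville x
  let a : E →L[ℝ] ℝ := (show E₂ →L[ℝ] ℝ from α.1).comp (tmap E E₂ (orb Γ) x)
  have ha : ∀ u : E, lam u = 0 → a u = 0 := fun u hu =>
    α.2 _ ((sys.mem_contactDistribution_orb x _).mpr ⟨u, hu, rfl⟩)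
  refine ⟨a w / lam w, sys.annihilator_ext x fun u => ?_⟩
  have h1 : lam (u - (lam u / lam w) • w) = 0 := by
    rw [map_sub, map_smul, smul_eq_mul, div_mul_cancel₀ (lam u) (show lam w ≠ 0 from hw), sub_self]
  have h2 := ha _ h1
  rw [map_sub, map_smul, smul_eq_mul, sub_eq_zero] at h2
  have h3 : a u = a w / lam w * lam u := by rw [h2]; ring
  have h4 : lam u = (sys.covectorAt x _ rfl).1 (tmap E E₂ (orb Γ) x u) :=
    (sys.covectorAt_apply x _ rfl u).symm
  rw [h4] at h3
  exact h3

/-- The fibre of `𝒟°` over `c`. -/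
def AnnFiber (c : Orb Γ S) : Type _ := sys.annihilator c

namespace AnnFiber

noncomputable instance (c : Orb Γ S) : AddCommGroup (sys.AnnFiber c) :=
  inferInstanceAs (AddCommGroup (sys.annihilator c))

noncomputable instance (c : Orb Γ S) : Module ℝ (sys.AnnFiber c) :=
  inferInstanceAs (Module ℝ (sys.annihilator c))

instance (c : Orb Γ S) : TopologicalSpace (sys.AnnFiber c) :=
  inferInstanceAs (TopologicalSpace (sys.annihilator c))

instance (c : Orb Γ S) : T2Space (sys.AnnFiber c) :=
  inferInstanceAs (T2Space (sys.annihilator c : Submodule ℝ (E₂ →L[ℝ] ℝ)))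

instance (c : Orb Γ S) : IsTopologicalAddGroup (sys.AnnFiber c) :=
  inferInstanceAs (IsTopologicalAddGroup (sys.annihilator c : Submodule ℝ (E₂ →L[ℝ] ℝ)))

instance (c : Orb Γ S) : ContinuousSMul ℝ (sys.AnnFiber c) :=
  inferInstanceAs (ContinuousSMul ℝ (sys.annihilator c : Submodule ℝ (E₂ →L[ℝ] ℝ)))

end AnnFiber

/-- The element `α_x` of `𝒟°` determined by `α_x ∘ T_x p = λ_x`. -/
noncomputable def covector (x : S) : sys.AnnFiber (orb Γ x) := sys.covectorAt x (orb Γ x) rfl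

/-- The coordinate on a fibre of `𝒟°` with respect to the covector defined by `x`. -/
noncomputable def coordAt (x : S) (c : Orb Γ S) (hx : orb Γ x = c) : sys.AnnFiber c ≃L[ℝ] ℝ :=
  ((LinearEquiv.ofBijective (LinearMap.toSpanSingleton ℝ (sys.AnnFiber c) (sys.covectorAt x c hx))
    ⟨smul_left_injective ℝ (sys.covectorAt_ne_zero x c hx), fun α =>
      (sys.exists_eq_smul_covectorAt x c hx α).imp fun _ h => h.symm⟩).toContinuousLinearEquiv).symm

theorem coordAt_symm (x : S) (c : Orb Γ S) (hx : orb Γ x = c) (t : ℝ) :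
    (sys.coordAt x c hx).symm t = t • (sys.covectorAt x c hx : sys.AnnFiber c) := rfl

theorem coordAt_coordAt_symm (x y : S) (c : Orb Γ S) (hx : orb Γ x = c) (hy : orb Γ y = c) (s : Γ)
    (hs : y = s • x) (t : ℝ) :
    sys.coordAt x c hx ((sys.coordAt y c hy).symm t) = scalingCoord s * t := by
  rw [← ContinuousLinearEquiv.eq_symm_apply, coordAt_symm, coordAt_symm,
    sys.covectorAt_smul x y c hx hy s hs, mul_comm]
  exact smul_smul t (scalingCoord s) (sys.covectorAt x c hx)

/-- The smooth frames `σ^* λ` of the line bundle `𝒟° → C`, for smooth local sections `σ` of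
`S → C`: the covector of `σ c` is the value at `c` of the pull-back of `λ` by `σ`. -/
noncomputable def annFrames : LineFrames E₂ sys.AnnFiber where
  dom i := (sys.principal_scaling.locally_trivial i).choose
  isOpen_dom i := (sys.principal_scaling.locally_trivial i).choose_spec.1
  mem_dom i := (sys.principal_scaling.locally_trivial i).choose_spec.2.1
  coord i k := sys.coordAt ((sys.principal_scaling.locally_trivial i).choose_spec.2.2.choose k) k
    ((sys.principal_scaling.locally_trivial i).choose_spec.2.2.choose_spec.1 k)
  contMDiffOn_coord i j := by
    set a := (sys.principal_scaling.locally_trivial i).choose_spec.2.2.choose with ha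
    set b := (sys.principal_scaling.locally_trivial j).choose_spec.2.2.choose with hb
    have hai := (sys.principal_scaling.locally_trivial i).choose_spec.2.2.choose_spec
    have hbi := (sys.principal_scaling.locally_trivial j).choose_spec.2.2.choose_spec
    rw [← ha] at hai
    rw [← hb] at hbi
    set U := (sys.principal_scaling.locally_trivial i).choose ∩
      (sys.principal_scaling.locally_trivial j).choose with hUdef
    have hU : IsOpen U := (sys.principal_scaling.locally_trivial i).choose_spec.1.inter
      (sys.principal_scaling.locally_trivial j).choose_spec.1
    obtain ⟨g, hg, hgab⟩ := sys.principal_scaling.exists_div hU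
      (hbi.2.1.mono Set.inter_subset_right) (hai.2.1.mono Set.inter_subset_left)
      (fun n _ => (hbi.1 n).trans (hai.1 n).symm)
    refine ((contMDiff_scalingCoord Γ).comp_contMDiffOn hg).congr ?_
    intro k hk
    rw [sys.coordAt_coordAt_symm (b k) (a k) k (hbi.1 k) (hai.1 k) (g k) (hgab k hk), mul_one]
    rfl

noncomputable instance : TopologicalSpace (TotalSpace ℝ sys.AnnFiber) :=
  sys.annFrames.prebundle.totalSpaceTopology

noncomputable instance : FiberBundle ℝ sys.AnnFiber := sys.annFrames.prebundle.toFiberBundle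

instance : VectorBundle ℝ ℝ sys.AnnFiber := sys.annFrames.prebundle.toVectorBundle

instance [IsManifold 𝓘(ℝ, E₂) ∞ (Orb Γ S)] : ContMDiffVectorBundle ∞ ℝ sys.AnnFiber 𝓘(ℝ, E₂) :=
  letI := sys.annFrames.prebundle_isContMDiff
  sys.annFrames.prebundle.contMDiffVectorBundle 𝓘(ℝ, E₂)

theorem annFiber_mk_eq (sys : CompatibleSystem E E₁ E₂ E₃ E₄ EG S G Γ)
    {c d : Orb Γ S} (hc : c = d) {α : sys.AnnFiber c} {β : sys.AnnFiber d}
    (h : ∀ v : E₂, α.1 v = β.1 v) :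
    (⟨c, α⟩ : TotalSpace ℝ sys.AnnFiber) = ⟨d, β⟩ := by
  subst hc
  exact congrArg _ (Subtype.ext (ContinuousLinearMap.ext h))

theorem exists_local_lift (sys : CompatibleSystem E E₁ E₂ E₃ E₄ EG S G Γ) (b : Orb G (Orb Γ S)) :
    ∃ U : Set (Orb G (Orb Γ S)), IsOpen U ∧ b ∈ U ∧ ∃ ξ : Orb G (Orb Γ S) → S,
      (∀ c, orb G (orb Γ (ξ c)) = c) ∧ ContMDiffOn 𝓘(ℝ, E₄) 𝓘(ℝ, E) ∞ ξ U := by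
  obtain ⟨V, hV, hbV, τ, hτ, hτs, -⟩ := sys.principal_symmetry_quotient.locally_trivial b
  obtain ⟨U, hU, hbU, σ, hσ, hσs, -⟩ := sys.principal_scaling.locally_trivial (τ b)
  refine ⟨V ∩ τ ⁻¹' U, hτs.continuousOn.isOpen_inter_preimage hV hU, ⟨hbV, hbU⟩,
    fun c => σ (τ c), fun c => by rw [hσ, hτ], ?_⟩
  exact hσs.comp (hτs.mono Set.inter_subset_left) fun c hc => hc.2

section action
variable [IsManifold 𝓘(ℝ, E₂) ∞ (Orb Γ S)]

theorem mem_contactDistribution_symmetry (sys : CompatibleSystem E E₁ E₂ E₃ E₄ EG S G Γ)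
    (g : G) (c : Orb Γ S) (v : E₂)
    (hv : (⟨c, v⟩ : TangentBundle 𝓘(ℝ, E₂) (Orb Γ S)) ∈ sys.contactDistribution) :
    tangentMap 𝓘(ℝ, E₂) 𝓘(ℝ, E₂) (fun c : Orb Γ S => g • c) ⟨c, v⟩ ∈ sys.contactDistribution := by
  obtain ⟨y, u, rfl, hu, rfl⟩ := (sys.mem_contactDistribution c v).mp hv
  refine (sys.mem_contactDistribution _ _).mpr ⟨g • y, tmap E E (fun y : S => g • y) y u, rfl, ?_,
    sys.tmap_orb_symmetry g y u⟩
  rw [sys.liouville_symmetry, hu]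

theorem tmap_inv_smul (sys : CompatibleSystem E E₁ E₂ E₃ E₄ EG S G Γ) (g : G) (c : Orb Γ S) (v : E₂) :
    tmap E₂ E₂ (fun c : Orb Γ S => g⁻¹ • c) (g • c) (tmap E₂ E₂ (fun c : Orb Γ S => g • c) c v) =
      v := by
  have hg : ∀ (g : G) c, MDifferentiableAt 𝓘(ℝ, E₂) 𝓘(ℝ, E₂) (fun c : Orb Γ S => g • c) c :=
    fun g => (sys.principal_symmetry_quotient.contMDiff_const_smul g).mdifferentiable (by simp)
  have h := tmap_comp (hg g⁻¹ (g • c)) (hg g c) rfl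
  simp only [inv_smul_smul] at h
  rw [tmap_id] at h
  exact (congrArg (fun L : E₂ →L[ℝ] E₂ => L v) h).symm

/-- The cotangent lift `α ↦ α ∘ T(g⁻¹)` of the action of `G`. -/
noncomputable def cotangentLift (g : G) (c : Orb Γ S) (α : sys.AnnFiber c) : sys.AnnFiber (g • c) :=
  ⟨(show E₂ →L[ℝ] ℝ from α.1).comp (tmap E₂ E₂ (fun d : Orb Γ S => g⁻¹ • d) (g • c)), by
    intro v hv
    have h := sys.mem_contactDistribution_symmetry g⁻¹ (g • c) v hv
    obtain ⟨y, u, hy, hu, e⟩ := (sys.mem_contactDistribution _ _).mp h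
    have hy : orb Γ y = c := Eq.trans hy (inv_smul_smul g c)
    exact α.2 _ ((sys.mem_contactDistribution _ _).mpr ⟨y, u, hy, hu, e⟩)⟩

/-- The action of `G` on `𝒟°` by cotangent lift. -/
noncomputable instance : MulAction G (TotalSpace ℝ sys.AnnFiber) where
  smul g p := ⟨g • p.1, sys.cotangentLift g p.1 p.2⟩
  one_smul := by
    rintro ⟨c, α⟩
    refine sys.annFiber_mk_eq (one_smul G c) fun v => ?_
    have h : tmap E₂ E₂ (fun d : Orb Γ S => (1 : G)⁻¹ • d) ((1 : G) • c) v = v := by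
      simp only [inv_one, one_smul, tmap_id]
      rfl
    exact congrArg (show E₂ →L[ℝ] ℝ from α.1) h
  mul_smul := by
    rintro g k ⟨c, α⟩
    refine sys.annFiber_mk_eq (mul_smul g k c) fun v => ?_
    have hg : ∀ (g : G) c, MDifferentiableAt 𝓘(ℝ, E₂) 𝓘(ℝ, E₂) (fun c : Orb Γ S => g • c) c :=
      fun g => (sys.principal_symmetry_quotient.contMDiff_const_smul g).mdifferentiable (by simp)
    have h := tmap_comp (x := (g * k) • c) (hg k⁻¹ (k • c)) (hg g⁻¹ ((g * k) • c))
      (by rw [mul_smul, inv_smul_smul])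
    have h2 : tmap E₂ E₂ (fun d : Orb Γ S => (g * k)⁻¹ • d) ((g * k) • c) v =
        tmap E₂ E₂ (fun d : Orb Γ S => k⁻¹ • d) (k • c)
          (tmap E₂ E₂ (fun d : Orb Γ S => g⁻¹ • d) (g • k • c) v) := by
      rw [← mul_smul g k c]
      simp only [mul_inv_rev, mul_smul k⁻¹ g⁻¹]
      exact congrArg (fun L : E₂ →L[ℝ] E₂ => L v) h
    exact congrArg (show E₂ →L[ℝ] ℝ from α.1) h2

theorem smul_annFiber (g : G) (c : Orb Γ S) (α : sys.AnnFiber c) :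
    g • (⟨c, α⟩ : TotalSpace ℝ sys.AnnFiber) = ⟨g • c, sys.cotangentLift g c α⟩ := rfl

theorem cotangentLift_covector (g : G) (x : S) (t : ℝ) :
    sys.cotangentLift g (orb Γ x) (t • sys.covector x) = t • sys.covector (g • x) := by
  refine sys.annihilator_ext (g • x) fun u' => ?_
  obtain ⟨u, rfl⟩ : ∃ u, u' = tmap E E (fun y : S => g • y) x u := by
    have hg : ∀ (g : G) c, MDifferentiableAt 𝓘(ℝ, E) 𝓘(ℝ, E) (fun c : S => g • c) c :=
      fun g => (sys.principal_symmetry.contMDiff_const_smul g).mdifferentiable (by simp)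
    have h := tmap_comp (hg g x) (hg g⁻¹ (g • x)) (inv_smul_smul g x)
    simp only [smul_inv_smul] at h
    rw [tmap_id] at h
    exact ⟨_, congrArg (fun L : E →L[ℝ] E => L u') h⟩
  have h1 : sys.covectorAt (g • x) (g • orb Γ x) rfl =
      sys.covectorAt (g • x) (orb Γ (g • x)) rfl := rfl
  have h2 := sys.covectorAt_apply (g • x) (g • orb Γ x) rfl (tmap E E (fun y : S => g • y) x u)
  have h3 := sys.covectorAt_apply x (orb Γ x) rfl u
  rw [sys.liouville_symmetry] at h2
  have h4 : tmap E₂ E₂ (fun d : Orb Γ S => g⁻¹ • d) (g • orb Γ x)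
      (tmap E E₂ (orb Γ) (g • x) (tmap E E (fun y : S => g • y) x u)) =
      tmap E E₂ (orb Γ) x u := by
    rw [sys.tmap_orb_symmetry, sys.tmap_inv_smul]
  show t * (sys.covectorAt x (orb Γ x) rfl).1 (tmap E₂ E₂ (fun d : Orb Γ S => g⁻¹ • d)
    (g • orb Γ x) (tmap E E₂ (orb Γ) (g • x) (tmap E E (fun y : S => g • y) x u))) =
    t * (sys.covectorAt (g • x) (g • orb Γ x) rfl).1
      (tmap E E₂ (orb Γ) (g • x) (tmap E E (fun y : S => g • y) x u))
  rw [h4, h2, h3]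

/-- The projection `𝒟°/G → C/G`. -/
noncomputable def annProj : Orb G (TotalSpace ℝ sys.AnnFiber) → Orb G (Orb Γ S) :=
  Quotient.lift (fun p => orb G p.1) (by
    rintro _ p ⟨g, rfl⟩
    exact orb_eq_orb.mpr ⟨g, rfl⟩)

/-- The fibre of `𝒟°/G → C/G` over `b`. -/
def AnnQuot (b : Orb G (Orb Γ S)) : Type _ :=
  {q : Orb G (TotalSpace ℝ sys.AnnFiber) // sys.annProj q = b}

namespace AnnQuot

/-- The class of `α ∈ 𝒟°` in the fibre over `b`. -/
noncomputable def mkAt (c : Orb Γ S) (b : Orb G (Orb Γ S)) (hc : orb G c = b) (α : sys.AnnFiber c) :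
    sys.AnnQuot b := ⟨orb G ⟨c, α⟩, hc⟩

theorem mkAt_smul (c d : Orb Γ S) (b : Orb G (Orb Γ S)) (hc : orb G c = b) (hd : orb G d = b)
    (g : G) (α : sys.AnnFiber c) (β : sys.AnnFiber d) (h : (⟨d, β⟩ : TotalSpace ℝ sys.AnnFiber) = g • ⟨c, α⟩) :
    mkAt sys d b hd β = mkAt sys c b hc α :=
  Subtype.ext (orb_eq_orb.mpr ⟨g, h.symm⟩)

theorem mkAt_bijective (c : Orb Γ S) (b : Orb G (Orb Γ S)) (hc : orb G c = b) :
    Function.Bijective (mkAt sys c b hc) := by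
  constructor
  · intro α β e
    obtain ⟨g, hg⟩ := orb_eq_orb.mp (congrArg Subtype.val e)
    have h1 : g = 1 := sys.principal_symmetry_quotient.free g c (congrArg TotalSpace.proj hg)
    rw [h1, one_smul] at hg
    exact (TotalSpace.mk_inj.mp hg).symm
  · rintro ⟨q, hq⟩
    induction q using Quotient.inductionOn with
    | h p =>
      obtain ⟨d, α⟩ := p
      obtain ⟨g, rfl⟩ := orb_eq_orb.mp (hc.trans hq.symm)
      exact ⟨sys.cotangentLift g d α, Subtype.ext (orb_eq_orb.mpr ⟨g, rfl⟩)⟩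

/-- The identification of the fibre of `𝒟°/G` over `b = [c]` with the fibre of `𝒟°` over `c`, for
one choice of `c`. -/
noncomputable def outEquiv (b : Orb G (Orb Γ S)) : sys.AnnQuot b ≃ sys.AnnFiber b.out :=
  (Equiv.ofBijective _ (mkAt_bijective sys b.out b (Quotient.out_eq b))).symm

/-- The vector space structure with `a [α] + b [β] = [a α + b β]` for `α` and `β` over the same point. -/
noncomputable instance (b : Orb G (Orb Γ S)) : AddCommGroup (sys.AnnQuot b) :=
  (outEquiv sys b).addCommGroup

noncomputable instance (b : Orb G (Orb Γ S)) : Module ℝ (sys.AnnQuot b) :=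
  (outEquiv sys b).module ℝ

noncomputable instance (b : Orb G (Orb Γ S)) : TopologicalSpace (sys.AnnQuot b) :=
  TopologicalSpace.induced (outEquiv sys b) inferInstance

/-- The identification as an isomorphism of topological vector spaces. -/
noncomputable def outLin (b : Orb G (Orb Γ S)) : sys.AnnQuot b ≃L[ℝ] sys.AnnFiber b.out :=
  { (outEquiv sys b).linearEquiv ℝ with
    continuous_toFun := continuous_induced_dom
    continuous_invFun := by
      refine continuous_induced_rng.mpr ?_
      have : (outEquiv sys b) ∘ (outEquiv sys b).symm = id := by ext; simp
      exact this ▸ continuous_id }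

/-- The coordinate on a fibre of `𝒟°/G` with respect to the class of the covector of `x`. -/
noncomputable def coordAt (x : S) (b : Orb G (Orb Γ S)) (hx : orb G (orb Γ x) = b) :
    sys.AnnQuot b ≃L[ℝ] ℝ :=
  (outLin sys b).trans (sys.coordAt ((exists_smul_orb_eq_out x b hx).choose • x) b.out
    (exists_smul_orb_eq_out x b hx).choose_spec)

theorem coordAt_symm (x : S) (b : Orb G (Orb Γ S)) (hx : orb G (orb Γ x) = b) (t : ℝ) :
    (coordAt sys x b hx).symm t =
      mkAt sys (orb Γ x) b hx (t • sys.covector x) := by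
  have key : ∀ (c : Orb Γ S) (hc : orb G c = b) (g : G) (hg : orb Γ (g • x) = c),
      mkAt sys c b hc (t • (sys.covectorAt (g • x) c hg : sys.AnnFiber c)) =
      mkAt sys (orb Γ x) b hx (t • sys.covector x) := by
    rintro _ hc g rfl
    refine mkAt_smul sys _ _ b hx hc g _ _ ?_
    exact (congrArg (TotalSpace.mk (F := ℝ) (g • orb Γ x)) (sys.cotangentLift_covector g x t)).symm
  exact key b.out (Quotient.out_eq b) _ (exists_smul_orb_eq_out x b hx).choose_spec

theorem coordAt_coordAt_symm (x y : S) (b : Orb G (Orb Γ S)) (hx : orb G (orb Γ x) = b)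
    (hy : orb G (orb Γ y) = b) (g : G) (s : Γ) (hs : y = s • g • x) (t : ℝ) :
    coordAt sys x b hx ((coordAt sys y b hy).symm t) = scalingCoord s * t := by
  subst hs
  rw [← ContinuousLinearEquiv.eq_symm_apply, coordAt_symm, coordAt_symm]
  refine mkAt_smul sys _ _ b hx hy g _ _ ?_
  refine Eq.trans ?_
    (congrArg (TotalSpace.mk (F := ℝ) (g • orb Γ x)) (sys.cotangentLift_covector g x _)).symm
  have h1 : orb Γ (s • g • x) = g • orb Γ x := orb_eq_orb.mpr ⟨s, rfl⟩
  refine sys.annFiber_mk_eq h1 fun v => ?_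
  have h2 := sys.covectorAt_smul (g • x) (s • g • x) (g • orb Γ x) rfl h1 s rfl
  have h3 : ∀ (d : Orb Γ S) (hd : orb Γ (s • g • x) = d) (v : E₂),
      (sys.covectorAt (s • g • x) _ rfl).1 v = (sys.covectorAt (s • g • x) d hd).1 v := by
    rintro _ rfl _; rfl
  show t * (sys.covectorAt (s • g • x) _ rfl).1 v =
    (scalingCoord s * t) * (sys.covectorAt (g • x) (g • orb Γ x) rfl).1 v
  rw [h3 _ h1 v, h2]
  show t * (scalingCoord s * (sys.covectorAt (g • x) (g • orb Γ x) rfl).1 v) = _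
  ring

end AnnQuot

variable [LieGroup 𝓘(ℝ, EG) ∞ G]

/-- The smooth frames `b ↦ [α_{ξ b}]` of `𝒟°/G`, for smooth local maps `ξ : C/G → S` lifting the
points of `C/G`. -/
noncomputable def annQuotFrames : LineFrames E₄ sys.AnnQuot where
  dom i := (sys.exists_local_lift i).choose
  isOpen_dom i := (sys.exists_local_lift i).choose_spec.1
  mem_dom i := (sys.exists_local_lift i).choose_spec.2.1
  coord i k := AnnQuot.coordAt sys ((sys.exists_local_lift i).choose_spec.2.2.choose k) k
    ((sys.exists_local_lift i).choose_spec.2.2.choose_spec.1 k)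
  contMDiffOn_coord i j := by
    set a := (sys.exists_local_lift i).choose_spec.2.2.choose with ha
    set b := (sys.exists_local_lift j).choose_spec.2.2.choose with hb
    have hai := (sys.exists_local_lift i).choose_spec.2.2.choose_spec
    have hbi := (sys.exists_local_lift j).choose_spec.2.2.choose_spec
    rw [← ha] at hai
    rw [← hb] at hbi
    set U := (sys.exists_local_lift i).choose ∩ (sys.exists_local_lift j).choose with hUdef
    have hU : IsOpen U :=
      (sys.exists_local_lift i).choose_spec.1.inter (sys.exists_local_lift j).choose_spec.1
    have haU := hai.2.mono (Set.inter_subset_left : U ⊆ _)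
    have hbU := hbi.2.mono (Set.inter_subset_right : U ⊆ _)
    have hp := sys.principal_scaling.contMDiff_orb
    obtain ⟨g, hg, hgab⟩ := sys.principal_symmetry_quotient.exists_div hU
      (hp.comp_contMDiffOn hbU) (hp.comp_contMDiffOn haU)
      (fun n _ => (hbi.1 n).trans (hai.1 n).symm)
    obtain ⟨s, hs, hsab⟩ := sys.principal_scaling.exists_div hU
      (sys.principal_symmetry.contMDiff_smul.comp_contMDiffOn (hg.prodMk hbU)) haU
      (fun n hn => (hgab n hn).symm)
    refine ((contMDiff_scalingCoord Γ).comp_contMDiffOn hs).congr ?_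
    intro k hk
    rw [AnnQuot.coordAt_coordAt_symm sys (b k) (a k) k (hbi.1 k) (hai.1 k) (g k) (s k) (hsab k hk),
      mul_one]
    rfl

noncomputable instance : TopologicalSpace (TotalSpace ℝ sys.AnnQuot) :=
  sys.annQuotFrames.prebundle.totalSpaceTopology

noncomputable instance : FiberBundle ℝ sys.AnnQuot := sys.annQuotFrames.prebundle.toFiberBundle

instance : VectorBundle ℝ ℝ sys.AnnQuot := sys.annQuotFrames.prebundle.toVectorBundle

instance [IsManifold 𝓘(ℝ, E₄) ∞ (Orb G (Orb Γ S))] :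
    ContMDiffVectorBundle ∞ ℝ sys.AnnQuot 𝓘(ℝ, E₄) :=
  letI := sys.annQuotFrames.prebundle_isContMDiff
  sys.annQuotFrames.prebundle.contMDiffVectorBundle 𝓘(ℝ, E₄)

end action

end CompatibleSystem
namespace CompatibleSystem
variable {E E₁ E₂ E₃ E₄ EG S G : Type*} {Γ : Subgroup ℝˣ} [Fact (Γ = ⊤ ∨ Γ = Units.posSubgroup ℝ)]
  [NormedAddCommGroup E] [NormedSpace ℝ E] [NormedAddCommGroup E₁] [NormedSpace ℝ E₁]
  [NormedAddCommGroup E₂] [NormedSpace ℝ E₂] [NormedAddCommGroup E₃] [NormedSpace ℝ E₃]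
  [NormedAddCommGroup E₄] [NormedSpace ℝ E₄] [NormedAddCommGroup EG] [NormedSpace ℝ EG]
  [TopologicalSpace S] [ChartedSpace E S] [IsManifold 𝓘(ℝ, E) ∞ S]
  [Group G] [TopologicalSpace G] [ChartedSpace EG G]
  [MulAction G S] [MulAction Γ S] [SMulCommClass G Γ S] [SMulCommClass Γ G S]
  [ChartedSpace E₁ (Orb G S)] [ChartedSpace E₂ (Orb Γ S)]
  [ChartedSpace E₃ (Orb Γ (Orb G S))] [ChartedSpace E₄ (Orb G (Orb Γ S))]
  (sys : CompatibleSystem E E₁ E₂ E₃ E₄ EG S G Γ)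


/-- The symplectic form read in the model space. -/
noncomputable def formL (x : S) : E →L[ℝ] E →L[ℝ] ℝ := sys.sympl.form x

/-- The Hamiltonian vector field read in the model space. -/
noncomputable def hamVec (f : S → ℝ) (x : S) : E := sys.sympl.hamiltonianField f x

theorem formL_hamVec [FiniteDimensional ℝ E] (f : S → ℝ) (x : S) :
    sys.formL x (sys.hamVec f x) = tmap E ℝ f x := by
  have hinj : Function.Injective (fun v : E => sys.formL x v) := by
    intro v w h
    have : v - w = 0 := sys.sympl.nondegenerate x (v - w) fun u => by
      have h2 : sys.formL x (v - w) = 0 := by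
        rw [map_sub, show sys.formL x v = sys.formL x w from h, sub_self]
      exact congrArg (fun L : E →L[ℝ] ℝ => L u) h2
    exact sub_eq_zero.mp this
  have hsurj : Function.Surjective (fun v : E => sys.formL x v) := by
    have hd : Module.finrank ℝ E = Module.finrank ℝ (E →L[ℝ] ℝ) := by
      rw [← (LinearMap.toContinuousLinearMap (𝕜 := ℝ) (E := E) (F' := ℝ)).finrank_eq]
      exact (Subspace.dual_finrank_eq).symm
    exact (LinearMap.injective_iff_surjective_of_finrank_eq_finrank hd
      (f := (sys.formL x).toLinearMap)).mp hinj
  exact Function.invFun_eq (hsurj (tmap E ℝ f x))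

theorem tmap_invariant (sys : CompatibleSystem E E₁ E₂ E₃ E₄ EG S G Γ) {f : S → ℝ} (hf : ∀ (g : G) x, f (g • x) = f x)
    (g : G) (x : S) (u : E) :
    tmap E ℝ f (g • x) (tmap E E (fun y : S => g • y) x u) = tmap E ℝ f x u := by
  have hs : ∀ (g : G) (x : S), MDifferentiableAt 𝓘(ℝ, E) 𝓘(ℝ, E) (fun y : S => g • y) x :=
    fun g => (sys.principal_symmetry.contMDiff_const_smul g).mdifferentiable (by simp)
  by_cases hd : MDifferentiableAt 𝓘(ℝ, E) 𝓘(ℝ, ℝ) f (g • x)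
  · have h := tmap_comp hd (hs g x) rfl
    simp only [hf] at h
    exact (congrArg (fun L : E →L[ℝ] ℝ => L u) h).symm
  · have hd2 : ¬ MDifferentiableAt 𝓘(ℝ, E) 𝓘(ℝ, ℝ) f x := by
      intro h
      apply hd
      have h2 : MDifferentiableAt 𝓘(ℝ, E) 𝓘(ℝ, ℝ) f (g⁻¹ • g • x) := by rwa [inv_smul_smul]
      have h3 := h2.comp (g • x) (hs g⁻¹ (g • x))
      have h4 : f ∘ (fun y : S => g⁻¹ • y) = f := funext fun y => hf _ _
      rwa [h4] at h3
    have e1 : tmap E ℝ f (g • x) = 0 := mfderiv_zero_of_not_mdifferentiableAt hd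
    have e2 : tmap E ℝ f x = 0 := mfderiv_zero_of_not_mdifferentiableAt hd2
    rw [e1, e2]
    rfl

theorem poisson_symmetry [FiniteDimensional ℝ E] (sys : CompatibleSystem E E₁ E₂ E₃ E₄ EG S G Γ) {f k : S → ℝ}
    (hf : ∀ (g : G) x, f (g • x) = f x) (hk : ∀ (g : G) x, k (g • x) = k x) (g : G) (x : S) :
    sys.sympl.poisson f k (g • x) = sys.sympl.poisson f k x := by
  have hs : ∀ (g : G) (x : S), MDifferentiableAt 𝓘(ℝ, E) 𝓘(ℝ, E) (fun y : S => g • y) x :=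
    fun g => (sys.principal_symmetry.contMDiff_const_smul g).mdifferentiable (by simp)
  have key : ∀ {f : S → ℝ}, (∀ (g : G) x, f (g • x) = f x) →
      sys.hamVec f (g • x) = tmap E E (fun y : S => g • y) x (sys.hamVec f x) := by
    intro f hf
    rw [← sub_eq_zero]
    refine sys.sympl.nondegenerate (g • x) _ fun w' => ?_
    have h := tmap_comp (hs g x) (hs g⁻¹ (g • x)) (inv_smul_smul g x)
    simp only [smul_inv_smul] at h
    rw [tmap_id] at h
    obtain ⟨w, rfl⟩ : ∃ w, w' = tmap E E (fun y : S => g • y) x w :=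
      ⟨_, congrArg (fun L : E →L[ℝ] E => L w') h⟩
    have h1 := congrArg (fun L : E →L[ℝ] ℝ => L (tmap E E (fun y : S => g • y) x w))
      (sys.formL_hamVec f (g • x))
    have h2 := congrArg (fun L : E →L[ℝ] ℝ => L w) (sys.formL_hamVec f x)
    have h3 : sys.formL (g • x) (tmap E E (fun y : S => g • y) x (sys.hamVec f x))
      (tmap E E (fun y : S => g • y) x w) = sys.formL x (sys.hamVec f x) w :=
      sys.form_symmetry g x (sys.hamVec f x) w
    have h4 := sys.tmap_invariant hf g x w
    show sys.formL (g • x) (sys.hamVec f (g • x) -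
      tmap E E (fun y : S => g • y) x (sys.hamVec f x)) (tmap E E (fun y : S => g • y) x w) = 0
    rw [map_sub, sub_apply, h3]
    exact sub_eq_zero.mpr (h1.trans (h4.trans h2.symm))
  show sys.formL (g • x) (sys.hamVec f (g • x)) (sys.hamVec k (g • x)) = _
  rw [key hf, key hk]
  exact sys.form_symmetry g x (sys.hamVec f x) (sys.hamVec k x)

/-- The reduced Poisson bracket on `S/G`: `{f, k}([x]) = {f ∘ ℘, k ∘ ℘}(x)`, `℘ : S → S/G`. -/
noncomputable def reducedPoisson [FiniteDimensional ℝ E] (f k : Orb G S → ℝ) : Orb G S → ℝ :=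
  Quotient.lift (fun x => sys.sympl.poisson (fun y => f (orb G y)) (fun y => k (orb G y)) x) (by
    rintro _ x ⟨g, rfl⟩
    have h : ∀ (g : G) (y : S), orb G (g • y) = orb G y := fun g y => orb_eq_orb.mpr ⟨g, rfl⟩
    exact sys.poisson_symmetry (fun g y => by rw [h]) (fun g y => by rw [h]) g x)

/-- The reduced Hamiltonian `H^G` on `S/G`: `H^G([x]) = H x`. -/
def reducedHam : Orb G S → ℝ :=
  Quotient.lift sys.ham (by
    rintro _ x ⟨g, rfl⟩
    exact sys.ham_symmetry g x)

end CompatibleSystem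

section kirillov

variable {EB B : Type*} [NormedAddCommGroup EB] [NormedSpace ℝ EB] [TopologicalSpace B]
  [ChartedSpace EB B]

variable (EB) in
/-- The smooth sections of the dual `V^*` of a line bundle `V → B`: families of linear forms on
the fibres which are smooth as functions on the total space. -/
def dualSections (V : B → Type*) [∀ b, AddCommGroup (V b)] [∀ b, Module ℝ (V b)]
    [∀ b, TopologicalSpace (V b)] [TopologicalSpace (TotalSpace ℝ V)] [FiberBundle ℝ V] :
    Submodule ℝ (∀ b, V b →ₗ[ℝ] ℝ) where
  carrier := {h | ContMDiff (𝓘(ℝ, EB).prod 𝓘(ℝ, ℝ)) 𝓘(ℝ, ℝ) ∞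
    (fun v : TotalSpace ℝ V => h v.1 v.2)}
  add_mem' := fun ha hb => ContMDiff.add ha hb
  zero_mem' := contMDiff_const
  smul_mem' r _ ha := ContMDiff.mul (contMDiff_const (c := r)) ha

variable (EB) in
/-- A Kirillov structure on the line bundle `V → B`: a Lie bracket on the sections of `V^*` which
is a first order differential operator, `[f h₁, h₂] = f [h₁, h₂] + X_{h₂}(f) h₁`. The smooth vector
field `X_h = symbol h` is the Hamiltonian vector field of `h`. In `bracket_mul`, `k = f h₁`. -/
structure KirillovStructure [IsManifold 𝓘(ℝ, EB) ∞ B] (V : B → Type*) [∀ b, AddCommGroup (V b)]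
    [∀ b, Module ℝ (V b)]
    [∀ b, TopologicalSpace (V b)] [TopologicalSpace (TotalSpace ℝ V)] [FiberBundle ℝ V] where
  bracket : dualSections EB V →ₗ[ℝ] dualSections EB V →ₗ[ℝ] dualSections EB V
  bracket_self : ∀ h, bracket h h = 0
  jacobi : ∀ h₁ h₂ h₃, bracket h₁ (bracket h₂ h₃) + bracket h₂ (bracket h₃ h₁) +
    bracket h₃ (bracket h₁ h₂) = 0
  symbol : dualSections EB V → ∀ b : B, TangentSpace 𝓘(ℝ, EB) b
  isSmoothField_symbol : ∀ h, IsSmoothField (symbol h)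
  bracket_mul : ∀ f : B → ℝ, ContMDiff 𝓘(ℝ, EB) 𝓘(ℝ, ℝ) ∞ f → ∀ h₁ k h₂ : dualSections EB V,
    (∀ b v, k.1 b v = f b * h₁.1 b v) → ∀ b v,
      (bracket k h₂).1 b v = f b * (bracket h₁ h₂).1 b v +
        differential f b (symbol h₂ b) * h₁.1 b v

variable {EB' B' : Type*} [NormedAddCommGroup EB'] [NormedSpace ℝ EB'] [TopologicalSpace B']
  [ChartedSpace EB' B']

variable (EB EB') in
/-- An isomorphism of line bundles: a diffeomorphism of the total spaces which is linear on the
fibres and covers a diffeomorphism of the bases. -/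
structure LineBundleIso (V : B → Type*) [∀ b, AddCommGroup (V b)] [∀ b, Module ℝ (V b)]
    [∀ b, TopologicalSpace (V b)] [TopologicalSpace (TotalSpace ℝ V)] [FiberBundle ℝ V]
    (W : B' → Type*) [∀ b, AddCommGroup (W b)] [∀ b, Module ℝ (W b)]
    [∀ b, TopologicalSpace (W b)] [TopologicalSpace (TotalSpace ℝ W)] [FiberBundle ℝ W] where
  base : Diffeomorph 𝓘(ℝ, EB) 𝓘(ℝ, EB') B B' ∞
  total : Diffeomorph (𝓘(ℝ, EB).prod 𝓘(ℝ, ℝ)) (𝓘(ℝ, EB').prod 𝓘(ℝ, ℝ))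
    (TotalSpace ℝ V) (TotalSpace ℝ W) ∞
  fiber : ∀ b : B, V b ≃ₗ[ℝ] W (base b)
  total_mk : ∀ (b : B) (v : V b), total ⟨b, v⟩ = ⟨base b, fiber b v⟩

/-- The section `b ↦ Ψ_b^* (h (ψ b))` of `V^*`. -/
noncomputable def LineBundleIso.pullback {V : B → Type*} [∀ b, AddCommGroup (V b)] [∀ b, Module ℝ (V b)]
    [∀ b, TopologicalSpace (V b)] [TopologicalSpace (TotalSpace ℝ V)] [FiberBundle ℝ V]
    {W : B' → Type*} [∀ b, AddCommGroup (W b)] [∀ b, Module ℝ (W b)]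
    [∀ b, TopologicalSpace (W b)] [TopologicalSpace (TotalSpace ℝ W)] [FiberBundle ℝ W]
    (Ψ : LineBundleIso EB EB' V W) (h : dualSections EB' W) : dualSections EB V :=
  ⟨fun b => h.1 (Ψ.base b) ∘ₗ (Ψ.fiber b).toLinearMap, by
    have e : (fun v : TotalSpace ℝ V => (h.1 (Ψ.base v.1) ∘ₗ (Ψ.fiber v.1).toLinearMap) v.2) =
        (fun w : TotalSpace ℝ W => h.1 w.1 w.2) ∘ Ψ.total := by
      funext ⟨b, v⟩
      exact congrArg (fun w : TotalSpace ℝ W => h.1 w.1 w.2) (Ψ.total_mk b v).symm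
    have hc := ContMDiff.comp h.2 Ψ.total.contMDiff
    rw [← e] at hc
    exact hc⟩

end kirillov

namespace CompatibleSystem
variable {E E₁ E₂ E₃ E₄ EG S G : Type*} {Γ : Subgroup ℝˣ} [Fact (Γ = ⊤ ∨ Γ = Units.posSubgroup ℝ)]
  [NormedAddCommGroup E] [NormedSpace ℝ E] [NormedAddCommGroup E₁] [NormedSpace ℝ E₁]
  [NormedAddCommGroup E₂] [NormedSpace ℝ E₂] [NormedAddCommGroup E₃] [NormedSpace ℝ E₃]
  [NormedAddCommGroup E₄] [NormedSpace ℝ E₄] [NormedAddCommGroup EG] [NormedSpace ℝ EG]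
  [TopologicalSpace S] [ChartedSpace E S] [IsManifold 𝓘(ℝ, E) ∞ S]
  [Group G] [TopologicalSpace G] [ChartedSpace EG G]
  [MulAction G S] [MulAction Γ S] [SMulCommClass G Γ S] [SMulCommClass Γ G S]
  [ChartedSpace E₁ (Orb G S)] [ChartedSpace E₂ (Orb Γ S)]
  [ChartedSpace E₃ (Orb Γ (Orb G S))] [ChartedSpace E₄ (Orb G (Orb Γ S))]
  (sys : CompatibleSystem E E₁ E₂ E₃ E₄ EG S G Γ)


/-- The line bundle `L = (S/G × ℝ)/Γ` over `(S/G)/Γ`. -/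
abbrev LineL : Orb Γ (Orb G S) → Type _ := AssocFiber sys.principal_scaling_quotient

/-- The homogeneous function `y ↦ h([(y, 1)])` on `S/G` of a section `h` of `L^*`. -/
noncomputable def hamL [IsManifold 𝓘(ℝ, E₃) ∞ (Orb Γ (Orb G S))] (h : dualSections E₃ sys.LineL)
    (y : Orb G S) : ℝ :=
  h.1 (orb Γ y) (AssocFiber.mk sys.principal_scaling_quotient y 1)

/-- The homogeneous function `x ↦ h(α_x)` on `S` of a section `h` of `(𝒟°)^*`. -/
noncomputable def hamC (h : dualSections E₂ sys.AnnFiber) (x : S) : ℝ :=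
  h.1 (orb Γ x) (sys.covector x)

variable [IsManifold 𝓘(ℝ, E₂) ∞ (Orb Γ S)]

/-- The projection `𝒟° → 𝒟°/G`. -/
noncomputable def annMk (c : Orb Γ S) (α : sys.AnnFiber c) : sys.AnnQuot (orb G c) :=
  AnnQuot.mkAt sys c (orb G c) rfl α

variable [LieGroup 𝓘(ℝ, EG) ∞ G]

/-- The section `k` of `(𝒟°/G)^*` is induced by the (then `G`-invariant) section `h` of `(𝒟°)^*`. -/
def Induces (h : dualSections E₂ sys.AnnFiber) (k : dualSections E₄ sys.AnnQuot) : Prop :=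
  ∀ (c : Orb Γ S) (α : sys.AnnFiber c), k.1 (orb G c) (sys.annMk c α) = h.1 c α

end CompatibleSystem

/-! Both reduced line bundles are framed by the same space `S`. The vectors `[([x], 1)]` of `L` and
`[α_x]` of `𝒟°/G` are nonzero, depend smoothly on `x`, lie over one base point exactly when the
points `x` belong to one orbit of `G × Γ`, and are multiplied by `s` when `(g, s)` acts. A line
bundle with such a frame is determined by it up to a unique isomorphism matching the frames. So
matching the frames gives `Ψ`, with `t [([x], 1)] ↦ t [α_x]`, and no direct comparison of the two
iterated quotients is needed.

`FrameMap` isolates this situation for any family of transformations `T i` of a manifold `M` with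
weights `χ i`. A section of the dual bundle is evaluated on the frame vectors, which gives a
function of weight `χ` on `M`; conversely such a function prescribes consistent values on vectors
spanning every fibre (`FrameMap.ham_surjective`). Hence the sections of `L^*` and of `(𝒟°/G)^*` are
the same functions on `S`: those invariant under `G` and homogeneous under `Γ`. The sections of
`(𝒟°)^*` are the functions homogeneous under `Γ`, and inducing a section on the quotient leaves its
function unchanged.

If `T i` multiplies the symplectic form by `χ i`, the Hamiltonian vector field of a function of
weight `χ` is invariant, because the two factors cancel
(`SymplecticForm.IsConformal.hamiltonianField_act`). Two consequences follow: functions of weight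
`χ` are closed under the Poisson bracket, and their Hamiltonian fields descend to the base. The
negative of the Poisson bracket is therefore a bracket on sections. Its Jacobi identity is the
closedness of the form (`SymplecticForm.poisson_jacobi`), and the Leibniz rule shows that it is a
Kirillov structure whose symbol is the projected field (`FrameMap.kirillovStructure`).

All brackets, Hamiltonian sections and symbols are thus read off from the Poisson bracket and `H` on
`S` itself. The isomorphism preserves the functions on `S` (`FrameMap.hamEquiv_pullback`), so it
preserves everything defined from them. -/

/-! ### Hamiltonian vector fields and the Poisson algebra of a symplectic manifold. -/

section hamiltonian

variable {E : Type*} [NormedAddCommGroup E] [NormedSpace ℝ E] {M : Type*} [TopologicalSpace M]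
  [ChartedSpace E M]

/-- In the trivializations at `x₀` this is the smoothness of operator inversion at an invertible
operator. It makes Hamiltonian fields smooth, since `X_f` is the inverse of the form applied to
`df`. -/
theorem contMDiffAt_clm_inverse_apply [CompleteSpace E] [IsManifold 𝓘(ℝ, E) ∞ M]
    {A : ∀ x : M, TangentSpace 𝓘(ℝ, E) x →L[ℝ] TangentSpace 𝓘(ℝ, E) x →L[ℝ] ℝ}
    {α : ∀ x : M, TangentSpace 𝓘(ℝ, E) x →L[ℝ] ℝ} {x₀ : M}
    (hA : ContMDiffAt 𝓘(ℝ, E) (𝓘(ℝ, E).prod 𝓘(ℝ, E →L[ℝ] E →L[ℝ] ℝ)) ∞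
      (fun x => TotalSpace.mk' (E →L[ℝ] E →L[ℝ] ℝ)
        (E := fun x : M => TangentSpace 𝓘(ℝ, E) x →L[ℝ] TangentSpace 𝓘(ℝ, E) x →L[ℝ] ℝ) x (A x)) x₀)
    (hα : ContMDiffAt 𝓘(ℝ, E) (𝓘(ℝ, E).prod 𝓘(ℝ, E →L[ℝ] ℝ)) ∞
      (fun x => TotalSpace.mk' (E →L[ℝ] ℝ)
        (E := fun x : M => TangentSpace 𝓘(ℝ, E) x →L[ℝ] ℝ) x (α x)) x₀)
    (hinv : (A x₀).IsInvertible) :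
    ContMDiffAt 𝓘(ℝ, E) 𝓘(ℝ, E).tangent ∞
      (fun x => (⟨x, (A x).inverse (α x)⟩ : TangentBundle 𝓘(ℝ, E) M)) x₀ := by
  have h1 := ((contMDiffAt_hom_bundle _).mp hA).2
  refine ContMDiffAt.clm_apply_of_inCoordinates (b₁ := id) (b₂ := id) (F₁ := E →L[ℝ] ℝ)
    (E₁ := fun x : M => TangentSpace 𝓘(ℝ, E) x →L[ℝ] ℝ) (F₂ := E)
    (E₂ := fun x : M => TangentSpace 𝓘(ℝ, E) x) (ϕ := fun x => (A x).inverse) ?_ hα contMDiffAt_id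
  have h2 : ContMDiffAt 𝓘(ℝ, E) 𝓘(ℝ, (E →L[ℝ] ℝ) →L[ℝ] E) ∞
      (ContinuousLinearMap.inverse ∘ (fun x : M => ContinuousLinearMap.inCoordinates
        E (fun x : M => TangentSpace 𝓘(ℝ, E) x) (E →L[ℝ] ℝ)
        (fun x : M => TangentSpace 𝓘(ℝ, E) x →L[ℝ] ℝ) x₀ x x₀ x (A x))) x₀ := by
    refine ContMDiffAt.comp x₀ (ContDiffAt.contMDiffAt ?_) h1
    apply ContinuousLinearMap.IsInvertible.contDiffAt_map_inverse
    rw [ContinuousLinearMap.inCoordinates_eq (FiberBundle.mem_baseSet_trivializationAt' x₀)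
      (FiberBundle.mem_baseSet_trivializationAt' x₀)]
    exact ContinuousLinearMap.isInvertible_equiv.comp
      (hinv.comp ContinuousLinearMap.isInvertible_equiv)
  refine h2.congr_of_eventuallyEq ?_
  filter_upwards [(trivializationAt E (TangentSpace 𝓘(ℝ, E)) x₀).open_baseSet.mem_nhds
      (FiberBundle.mem_baseSet_trivializationAt' x₀),
    (trivializationAt (E →L[ℝ] ℝ) (fun x : M => TangentSpace 𝓘(ℝ, E) x →L[ℝ] ℝ) x₀
      ).open_baseSet.mem_nhds (FiberBundle.mem_baseSet_trivializationAt' x₀)] with x hx hx'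
  simp only [Function.comp_apply, id]
  rw [ContinuousLinearMap.inCoordinates_eq hx hx', ContinuousLinearMap.inCoordinates_eq hx' hx]
  -- These rules for composition with an equivalence hold without invertibility of `A x`, so only
  -- the point `x₀` needs the hypothesis `hinv`.
  simp only [ContinuousLinearMap.inverse_equiv_comp, ContinuousLinearMap.inverse_comp_equiv,
    ContinuousLinearEquiv.symm_symm]
  rfl

theorem contMDiff_differential [IsManifold 𝓘(ℝ, E) ∞ M] {f : M → ℝ}
    (hf : ContMDiff 𝓘(ℝ, E) 𝓘(ℝ, ℝ) ∞ f) :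
    ContMDiff 𝓘(ℝ, E) (𝓘(ℝ, E).prod 𝓘(ℝ, E →L[ℝ] ℝ)) ∞
      (fun x => TotalSpace.mk' (E →L[ℝ] ℝ)
        (E := fun x : M => TangentSpace 𝓘(ℝ, E) x →L[ℝ] ℝ) x (differential f x)) := by
  intro x₀
  refine (contMDiffAt_hom_bundle _).mpr ⟨contMDiffAt_id, ?_⟩
  have h := (hf x₀).mfderiv_const (m := ∞) le_rfl
  refine h.congr_of_eventuallyEq (Filter.Eventually.of_forall fun x => ?_)
  ext v
  simp only [inTangentCoordinates, ContinuousLinearMap.inCoordinates]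
  simp [differential]
  rfl

theorem differential_mul {f g : M → ℝ} {x : M} (hf : MDifferentiableAt 𝓘(ℝ, E) 𝓘(ℝ, ℝ) f x)
    (hg : MDifferentiableAt 𝓘(ℝ, E) 𝓘(ℝ, ℝ) g x) (v : TangentSpace 𝓘(ℝ, E) x) :
    differential (fun y => f y * g y) x v = f x * differential g x v + differential f x v * g x := by
  have h := (hf.hasMFDerivAt.mul hg.hasMFDerivAt).mfderiv
  refine (congrArg (fun L : E →L[ℝ] ℝ => L v) h).trans ?_
  show f x * differential g x v + g x * differential f x v = _
  ring

theorem differential_add {f g : M → ℝ} {x : M} (hf : MDifferentiableAt 𝓘(ℝ, E) 𝓘(ℝ, ℝ) f x)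
    (hg : MDifferentiableAt 𝓘(ℝ, E) 𝓘(ℝ, ℝ) g x) :
    (differential (f + g) x : TangentSpace 𝓘(ℝ, E) x →L[ℝ] ℝ) =
      differential f x + differential g x :=
  mfderiv_add hf hg

theorem differential_const_smul {f : M → ℝ} {x : M}
    (hf : MDifferentiableAt 𝓘(ℝ, E) 𝓘(ℝ, ℝ) f x) (r : ℝ) :
    (differential (r • f) x : TangentSpace 𝓘(ℝ, E) x →L[ℝ] ℝ) = r • differential f x :=
  const_smul_mfderiv hf r

theorem contMDiff_differential_apply [IsManifold 𝓘(ℝ, E) ∞ M] {f : M → ℝ}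
    (hf : ContMDiff 𝓘(ℝ, E) 𝓘(ℝ, ℝ) ∞ f) {X : ∀ x : M, TangentSpace 𝓘(ℝ, E) x} (hX : IsSmoothField X) :
    ContMDiff 𝓘(ℝ, E) 𝓘(ℝ, ℝ) ∞ (fun x => differential f x (X x)) := by
  have h := ContMDiff.clm_bundle_apply (F₁ := E) (E₁ := fun x : M => TangentSpace 𝓘(ℝ, E) x)
    (F₂ := ℝ) (E₂ := Bundle.Trivial M ℝ) (b := id) (contMDiff_differential hf) hX
  intro x
  exact ((contMDiffAt_totalSpace).mp (h x)).2

/-- The Lie bracket of vector fields acts on functions as the commutator of derivations. -/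
theorem differential_mlieBracket [CompleteSpace E] [IsManifold 𝓘(ℝ, E) ∞ M] {f : M → ℝ}
    (hf : ContMDiff 𝓘(ℝ, E) 𝓘(ℝ, ℝ) ∞ f) {X Y : ∀ x : M, TangentSpace 𝓘(ℝ, E) x}
    (hX : IsSmoothField X) (hY : IsSmoothField Y) (x : M) :
    differential f x (VectorField.mlieBracket 𝓘(ℝ, E) X Y x) =
      differential (fun y => differential f y (Y y)) x (X x) -
        differential (fun y => differential f y (X y)) x (Y x) := by
  have two_le : (2 : ℕ∞ω) ≤ ∞ := by
    rw [show (2 : ℕ∞ω) = ((2 : ℕ∞) : ℕ∞ω) from rfl]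
    exact WithTop.coe_le_coe.mpr le_top
  have : IsManifold 𝓘(ℝ, E) 2 M := IsManifold.of_le (n := ∞) two_le
  have : IsManifold 𝓘(ℝ, E) 1 M := IsManifold.of_le (n := ∞) (by simp)
  have hrange : Set.range 𝓘(ℝ, E) = Set.univ := by simp
  set φ := extChartAt 𝓘(ℝ, E) x with hφ
  have hxs : φ.symm (φ x) = x := extChartAt_to_inv x
  -- `mlieBracket` is defined by pulling the fields back to the chart at `x`. The identity thus
  -- reduces to the one in the model space, for `f ∘ φ.symm` and the fields `pull X`, `pull Y`.
  let pull : (∀ x : M, TangentSpace 𝓘(ℝ, E) x) → E → E := fun Z =>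
    VectorField.mpullbackWithin 𝓘(ℝ, E) 𝓘(ℝ, E) φ.symm Z (Set.range 𝓘(ℝ, E))
  have htgt : ∀ᶠ y in nhds (φ x), y ∈ φ.target := extChartAt_target_mem_nhds x
  have hsymm : ∀ y ∈ φ.target, MDifferentiableAt 𝓘(ℝ, E) 𝓘(ℝ, E) φ.symm y := fun y hy =>
    ((contMDiffOn_extChartAt_symm (n := ∞) x).contMDiffAt
      ((isOpen_extChartAt_target x).mem_nhds hy)).mdifferentiableAt (by simp)
  have hwithin : ∀ y, (mfderivWithin 𝓘(ℝ, E) 𝓘(ℝ, E) φ.symm (Set.range 𝓘(ℝ, E)) y : E →L[ℝ] E) =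
      tmap E E φ.symm y := by
    intro y
    rw [hrange, mfderivWithin_univ]
    rfl
  have hinv : ∀ y ∈ φ.target, ∀ Z : (∀ x : M, TangentSpace 𝓘(ℝ, E) x),
      tmap E E φ.symm y (pull Z y) = Z (φ.symm y) := by
    intro y hy Z
    have h := isInvertible_mfderivWithin_extChartAt_symm (I := 𝓘(ℝ, E)) hy
    have h2 := h.self_apply_inverse (y := Z (φ.symm y))
    rw [← hwithin]
    exact h2
  have hcomp : ∀ g : M → ℝ, ∀ y ∈ φ.target, MDifferentiableAt 𝓘(ℝ, E) 𝓘(ℝ, ℝ) g (φ.symm y) →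
      ∀ Z : (∀ x : M, TangentSpace 𝓘(ℝ, E) x),
      fderiv ℝ (fun y => g (φ.symm y)) y (pull Z y) = differential g (φ.symm y) (Z (φ.symm y)) := by
    intro g y hy hg Z
    have h := tmap_comp hg (hsymm y hy) rfl
    rw [tmap, mfderiv_eq_fderiv] at h
    rw [h, ContinuousLinearMap.comp_apply, hinv y hy]
    rfl
  have hxt : φ x ∈ φ.target := mem_extChartAt_target x
  have hdiff : ∀ Z : (∀ x : M, TangentSpace 𝓘(ℝ, E) x), IsSmoothField Z →
      DifferentiableAt ℝ (pull Z) (φ x) := by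
    intro Z hZ
    have h : MDifferentiableWithinAt 𝓘(ℝ, E) 𝓘(ℝ, E).tangent
        (fun x => (⟨x, Z x⟩ : TangentBundle 𝓘(ℝ, E) M)) Set.univ x :=
      ((hZ x).mdifferentiableAt (by simp)).mdifferentiableWithinAt
    have h3 := h.differentiableWithinAt_mpullbackWithin_vectorField
    have h4 : DifferentiableWithinAt ℝ (pull Z) (φ.symm ⁻¹' Set.univ ∩ Set.range 𝓘(ℝ, E)) (φ x) := h3
    rwa [hrange, Set.preimage_univ, Set.univ_inter, differentiableWithinAt_univ] at h4
  have hsm : ∀ Z : (∀ x : M, TangentSpace 𝓘(ℝ, E) x), IsSmoothField Z → ∀ z,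
      MDifferentiableAt 𝓘(ℝ, E) 𝓘(ℝ, ℝ) (fun y => differential f y (Z y)) z := fun Z hZ z =>
    (contMDiff_differential_apply hf hZ).mdifferentiable (by simp) z
  have hfd := hf.mdifferentiable (by simp)
  have hfC : ContDiffAt ℝ ∞ (fun y => f (φ.symm y)) (φ x) := by
    rw [← contMDiffAt_iff_contDiffAt]
    exact (hf _).comp _ ((contMDiffOn_extChartAt_symm (n := ∞) x).contMDiffAt
      ((isOpen_extChartAt_target x).mem_nhds hxt))
  have h := VectorField.fderiv_apply_lieBracket (hfC.of_le two_le) (by simp)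
    (hdiff Y hY) (hdiff X hX)
  have hev : ∀ Z : (∀ x : M, TangentSpace 𝓘(ℝ, E) x),
      (fun y => fderiv ℝ (fun y => f (φ.symm y)) y (pull Z y)) =ᶠ[nhds (φ x)]
        fun y => (fun z => differential f z (Z z)) (φ.symm y) := fun Z => by
    filter_upwards [htgt] with y hy using hcomp f y hy (hfd _) Z
  rw [(hev X).fderiv_eq, (hev Y).fderiv_eq, hcomp _ _ hxt (hsm X hX _), hcomp _ _ hxt (hsm Y hY _),
    hxs] at h
  rw [← h]
  -- At its own centre the chart has the identity as derivative, because the tangent space is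
  -- identified with the model space through this very chart. No conversion factor remains.
  have e1 : VectorField.mlieBracket 𝓘(ℝ, E) X Y x =
      VectorField.lieBracket ℝ (pull X) (pull Y) (φ x) := by
    have hid : (mfderiv 𝓘(ℝ, E) 𝓘(ℝ, E) (extChartAt 𝓘(ℝ, E) x) x : E →L[ℝ] E) =
        ContinuousLinearMap.id ℝ E := mfderiv_extChartAt_self
    rw [VectorField.mlieBracket, VectorField.mlieBracketWithin_apply]
    refine (congrArg (fun L : E →L[ℝ] E => L.inverse _) hid).trans ?_
    rw [ContinuousLinearMap.inverse_id, ContinuousLinearMap.id_apply, Set.preimage_univ,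
      Set.univ_inter, ← VectorField.lieBracketWithin_univ, ← hrange]
  have e2 : fderiv ℝ (fun y => f (φ.symm y)) (φ x) = tmap E ℝ f x := by
    have h := tmap_comp (hfd x) (hsymm _ hxt) hxs
    rw [tmap, mfderiv_eq_fderiv] at h
    have h3 : tmap E E φ.symm (φ x) = ContinuousLinearMap.id ℝ E := by
      have := mfderivWithin_range_extChartAt_symm (I := 𝓘(ℝ, E)) (x := x)
      rw [← hwithin]
      exact this
    rw [h, h3, ContinuousLinearMap.comp_id]
  rw [e2, e1]
  rfl

namespace SymplecticForm
variable [IsManifold 𝓘(ℝ, E) ∞ M] (Ω : SymplecticForm E M)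

theorem injective_form (x : M) : Function.Injective (fun v => Ω.form x v) := by
  intro v w h
  refine sub_eq_zero.mp (Ω.nondegenerate x (v - w) fun u => ?_)
  have h2 : Ω.form x (v - w) = 0 := by
    rw [map_sub, show Ω.form x v = Ω.form x w from h, sub_self]
  rw [h2]; rfl

theorem poisson_skew (f g : M → ℝ) (x : M) : Ω.poisson f g x = -Ω.poisson g f x :=
  Ω.skew x _ _

theorem poisson_swap (f g : M → ℝ) : Ω.poisson f g = -Ω.poisson g f :=
  funext fun x => Ω.poisson_skew f g x

variable [FiniteDimensional ℝ E]

theorem isInvertible_form (x : M) : (Ω.form x).IsInvertible := by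
  let A : E →L[ℝ] E →L[ℝ] ℝ := Ω.form x
  have hd : Module.finrank ℝ E = Module.finrank ℝ (E →L[ℝ] ℝ) := by
    rw [← (LinearMap.toContinuousLinearMap (𝕜 := ℝ) (E := E) (F' := ℝ)).finrank_eq]
    exact (Subspace.dual_finrank_eq).symm
  have hinj : Function.Injective A.toLinearMap := Ω.injective_form x
  exact ⟨(LinearEquiv.ofInjectiveOfFinrankEq A.toLinearMap hinj hd).toContinuousLinearEquiv, by ext; rfl⟩

theorem form_hamiltonianField (f : M → ℝ) (x : M) :
    Ω.form x (Ω.hamiltonianField f x) = differential f x := by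
  obtain ⟨e, he⟩ := Ω.isInvertible_form x
  refine Function.invFun_eq (f := fun v => Ω.form x v) ⟨e.symm (differential f x), ?_⟩
  rw [← he]
  exact e.apply_symm_apply _

theorem hamiltonianField_eq_of_form {f : M → ℝ} {x : M} {v : TangentSpace 𝓘(ℝ, E) x}
    (h : ∀ w, Ω.form x v w = differential f x w) : Ω.hamiltonianField f x = v :=
  Ω.injective_form x ((Ω.form_hamiltonianField f x).trans (ContinuousLinearMap.ext h).symm)

/-- Replaces the pointwise choice `invFun` by `ContinuousLinearMap.inverse`, whose smoothness is
available. -/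
theorem hamiltonianField_eq_inverse (f : M → ℝ) (x : M) :
    Ω.hamiltonianField f x = (Ω.form x).inverse (differential f x) := by
  obtain ⟨e, he⟩ := Ω.isInvertible_form x
  refine Ω.hamiltonianField_eq_of_form fun w => ?_
  rw [← he, ContinuousLinearMap.inverse_equiv]
  exact congrArg (fun L : TangentSpace 𝓘(ℝ, E) x →L[ℝ] ℝ => L w) (e.apply_symm_apply _)

theorem isSmoothField_hamiltonianField {f : M → ℝ} (hf : ContMDiff 𝓘(ℝ, E) 𝓘(ℝ, ℝ) ∞ f) :
    IsSmoothField (Ω.hamiltonianField f) := by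
  have := FiniteDimensional.complete ℝ E
  intro x₀
  simp only [hamiltonianField_eq_inverse]
  exact contMDiffAt_clm_inverse_apply (Ω.contMDiff_form x₀) (contMDiff_differential hf x₀)
    (Ω.isInvertible_form x₀)

theorem poisson_eq (f g : M → ℝ) (x : M) :
    Ω.poisson f g x = differential f x (Ω.hamiltonianField g x) := by
  rw [poisson, form_hamiltonianField]

theorem poisson_neg_left (f g : M → ℝ) (x : M) : Ω.poisson (-f) g x = -Ω.poisson f g x := by
  have h : (differential (-f) x : TangentSpace 𝓘(ℝ, E) x →L[ℝ] ℝ) = -differential f x :=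
    mfderiv_neg
  rw [poisson_eq, poisson_eq, h]
  rfl

theorem poisson_add_left {f₁ f₂ : M → ℝ} (h₁ : ContMDiff 𝓘(ℝ, E) 𝓘(ℝ, ℝ) ∞ f₁)
    (h₂ : ContMDiff 𝓘(ℝ, E) 𝓘(ℝ, ℝ) ∞ f₂) (g : M → ℝ) :
    Ω.poisson (f₁ + f₂) g = Ω.poisson f₁ g + Ω.poisson f₂ g := by
  funext x
  rw [Pi.add_apply, poisson_eq, poisson_eq, poisson_eq,
    differential_add (h₁.mdifferentiable (by simp) x) (h₂.mdifferentiable (by simp) x)]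
  rfl

theorem poisson_smul_left {f : M → ℝ} (hf : ContMDiff 𝓘(ℝ, E) 𝓘(ℝ, ℝ) ∞ f) (r : ℝ) (g : M → ℝ) :
    Ω.poisson (r • f) g = r • Ω.poisson f g := by
  funext x
  rw [Pi.smul_apply, poisson_eq, poisson_eq,
    differential_const_smul (hf.mdifferentiable (by simp) x)]
  rfl

theorem contMDiff_poisson {f g : M → ℝ} (hf : ContMDiff 𝓘(ℝ, E) 𝓘(ℝ, ℝ) ∞ f)
    (hg : ContMDiff 𝓘(ℝ, E) 𝓘(ℝ, ℝ) ∞ g) : ContMDiff 𝓘(ℝ, E) 𝓘(ℝ, ℝ) ∞ (Ω.poisson f g) := by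
  have h := contMDiff_differential_apply hf (Ω.isSmoothField_hamiltonianField hg)
  simpa only [← poisson_eq] using h

/-- Closedness of the form is evaluated on three Hamiltonian fields. The three derivative terms and
the three Lie bracket terms are all iterated Poisson brackets, nine in total; up to sign, one cyclic
sum survives. -/
theorem poisson_jacobi {f g k : M → ℝ} (hf : ContMDiff 𝓘(ℝ, E) 𝓘(ℝ, ℝ) ∞ f)
    (hg : ContMDiff 𝓘(ℝ, E) 𝓘(ℝ, ℝ) ∞ g) (hk : ContMDiff 𝓘(ℝ, E) 𝓘(ℝ, ℝ) ∞ k) (x : M) :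
    Ω.poisson f (Ω.poisson g k) x + Ω.poisson g (Ω.poisson k f) x +
      Ω.poisson k (Ω.poisson f g) x = 0 := by
  have := FiniteDimensional.complete ℝ E
  have hXf := Ω.isSmoothField_hamiltonianField hf
  have hXg := Ω.isSmoothField_hamiltonianField hg
  have hXk := Ω.isSmoothField_hamiltonianField hk
  have h := Ω.closed _ _ _ hXf hXg hXk x
  -- By skew-symmetry `ω([X_p, X_q], X_r) = -dr([X_p, X_q])`, and the Lie bracket acts on `r` as the
  -- commutator of `{·, p}` and `{·, q}`.
  have key : ∀ (p q r : M → ℝ), ContMDiff 𝓘(ℝ, E) 𝓘(ℝ, ℝ) ∞ p → ContMDiff 𝓘(ℝ, E) 𝓘(ℝ, ℝ) ∞ q →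
      ContMDiff 𝓘(ℝ, E) 𝓘(ℝ, ℝ) ∞ r →
      Ω.form x (VectorField.mlieBracket 𝓘(ℝ, E) (Ω.hamiltonianField p) (Ω.hamiltonianField q) x)
        (Ω.hamiltonianField r x) =
      -(Ω.poisson (Ω.poisson r q) p x - Ω.poisson (Ω.poisson r p) q x) := by
    intro p q r hp hq hr
    rw [Ω.skew, form_hamiltonianField, differential_mlieBracket hr
      (Ω.isSmoothField_hamiltonianField hp) (Ω.isSmoothField_hamiltonianField hq),
      poisson_eq, poisson_eq _ (Ω.poisson r p)]
    simp only [← poisson_eq]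
  rw [key f g k hf hg hk, key f k g hf hk hg, key g k f hg hk hf] at h
  have e : ∀ p q : M → ℝ, (fun y => Ω.form y (Ω.hamiltonianField p y) (Ω.hamiltonianField q y)) =
    Ω.poisson p q := fun p q => rfl
  rw [e, e, e, ← poisson_eq, ← poisson_eq, ← poisson_eq, Ω.poisson_swap f k, Ω.poisson_swap k g,
    Ω.poisson_swap g f] at h
  simp only [poisson_neg_left] at h
  rw [Ω.poisson_skew f, Ω.poisson_skew g, Ω.poisson_skew k]
  linarith

end SymplecticForm

end hamiltonian

/-! ### Sections of a dual line bundle as homogeneous functions. -/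

section frameMap

variable {EB E B M : Type*} [NormedAddCommGroup EB] [NormedSpace ℝ EB] [TopologicalSpace B]
  [ChartedSpace EB B] [NormedAddCommGroup E] [NormedSpace ℝ E] [TopologicalSpace M]
  [ChartedSpace E M] {ι : Type*}

/-- Functions which are homogeneous of weight `χ` with respect to the transformations `T i`. -/
def homogeneousFunctions (E : Type*) [NormedAddCommGroup E] [NormedSpace ℝ E]
    [ChartedSpace E M] (T : ι → M → M) (χ : ι → ℝ) :
    Submodule ℝ (M → ℝ) where
  carrier := {F | ContMDiff 𝓘(ℝ, E) 𝓘(ℝ, ℝ) ∞ F ∧ ∀ i x, F (T i x) = χ i * F x}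
  add_mem' ha hb := ⟨ha.1.add hb.1, fun i x => by
    simp only [Pi.add_apply, ha.2, hb.2, mul_add]⟩
  zero_mem' := ⟨contMDiff_const, fun i x => by simp⟩
  smul_mem' r F ha := ⟨contMDiff_const.mul ha.1, fun i x => by
    simp only [Pi.smul_apply, ha.2, smul_eq_mul]; ring⟩

/-- A smooth map from `M` to the nonzero vectors of a line bundle `V → B` which covers a surjection
with smooth local sections, whose fibres are the orbits of the transformations `T i`, and
on which `T i` acts as multiplication by `χ i`. -/
structure FrameMap (E EB : Type*) [NormedAddCommGroup EB] [NormedSpace ℝ EB] [ChartedSpace EB B]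
    [NormedAddCommGroup E] [NormedSpace ℝ E] [ChartedSpace E M]
    (V : B → Type*) [∀ b, AddCommGroup (V b)] [∀ b, Module ℝ (V b)]
    [∀ b, TopologicalSpace (V b)] [TopologicalSpace (TotalSpace ℝ V)] [FiberBundle ℝ V]
    (T : ι → M → M) (χ : ι → ℝ) where
  toFun : M → TotalSpace ℝ V
  contMDiff_toFun : ContMDiff 𝓘(ℝ, E) (𝓘(ℝ, EB).prod 𝓘(ℝ, ℝ)) ∞ toFun
  ne_zero : ∀ x, (toFun x).2 ≠ 0
  exists_lift : ∀ b, ∃ U : Set B, IsOpen U ∧ b ∈ U ∧ ∃ σ : B → M, (∀ c, (toFun (σ c)).1 = c) ∧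
    ContMDiffOn 𝓘(ℝ, EB) 𝓘(ℝ, E) ∞ σ U
  equivariant : ∀ i x, toFun (T i x) = ⟨(toFun x).1, χ i • (toFun x).2⟩
  transitive : ∀ x y, (toFun x).1 = (toFun y).1 → ∃ i, y = T i x

namespace FrameMap

variable {V : B → Type*} [∀ b, AddCommGroup (V b)] [∀ b, Module ℝ (V b)]
    [∀ b, TopologicalSpace (V b)] [TopologicalSpace (TotalSpace ℝ V)] [FiberBundle ℝ V]
    {T : ι → M → M} {χ : ι → ℝ} (ε : FrameMap E EB V T χ)

/-- The projection `M → B`. -/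
def proj (x : M) : B := (ε.toFun x).1

theorem contMDiff_proj : ContMDiff 𝓘(ℝ, E) 𝓘(ℝ, EB) ∞ ε.proj :=
  (Bundle.contMDiff_proj V).comp ε.contMDiff_toFun

theorem proj_act (i : ι) (x : M) : ε.proj (T i x) = ε.proj x := by
  rw [proj, ε.equivariant]; rfl

theorem exists_proj_eq (b : B) : ∃ x, (ε.toFun x).1 = b := by
  obtain ⟨-, -, -, σ, hσ, -⟩ := ε.exists_lift b
  exact ⟨σ b, hσ b⟩

variable [VectorBundle ℝ ℝ V]

theorem exists_eq_smul_of_ne_zero {b : B} {w : V b} (hw : w ≠ 0) (v : V b) :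
    ∃ t : ℝ, v = t • w := by
  let e := (trivializationAt ℝ V b).continuousLinearEquivAt ℝ b
    (FiberBundle.mem_baseSet_trivializationAt' b)
  have h : e w ≠ 0 := fun h0 => hw (by simpa using h0)
  refine ⟨e v / e w, e.injective ?_⟩
  rw [map_smul, smul_eq_mul, div_mul_cancel₀ _ h]

theorem exists_eq_smul (x : M) (v : V (ε.toFun x).1) : ∃ t : ℝ, v = t • (ε.toFun x).2 :=
  exists_eq_smul_of_ne_zero (ε.ne_zero x) v

/-- The homogeneous function on `M` defined by a section of the dual bundle. -/
def ham : dualSections EB V →ₗ[ℝ] homogeneousFunctions E T χ where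
  toFun h := ⟨fun x => h.1 (ε.toFun x).1 (ε.toFun x).2, h.2.comp ε.contMDiff_toFun, fun i x =>
    (congrArg (fun w : TotalSpace ℝ V => h.1 w.1 w.2) (ε.equivariant i x)).trans (map_smul _ _ _)⟩
  map_add' _ _ := rfl
  map_smul' _ _ := rfl

theorem ham_injective : Function.Injective ε.ham := by
  intro h k e
  refine Subtype.ext (funext fun b => LinearMap.ext fun v => ?_)
  obtain ⟨x, rfl⟩ := ε.exists_proj_eq b
  obtain ⟨t, rfl⟩ := ε.exists_eq_smul x v
  rw [map_smul, map_smul]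
  exact congrArg (t • ·) (congrFun (congrArg Subtype.val e) x)

variable [ContMDiffVectorBundle ∞ ℝ V 𝓘(ℝ, EB)]

/-- Over small open sets, the coordinate of a vector with respect to the frame given by a local
section is smooth. -/
theorem exists_local_coord (b : B) : ∃ W : Set B, IsOpen W ∧ b ∈ W ∧
    ∃ (σ : B → M) (c : TotalSpace ℝ V → ℝ), (∀ d, (ε.toFun (σ d)).1 = d) ∧
      ContMDiffOn 𝓘(ℝ, EB) 𝓘(ℝ, E) ∞ σ W ∧
      ContMDiffOn (𝓘(ℝ, EB).prod 𝓘(ℝ, ℝ)) 𝓘(ℝ, ℝ) ∞ c (π ℝ V ⁻¹' W) ∧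
      ∀ v : TotalSpace ℝ V, v.1 ∈ W → v = ⟨(ε.toFun (σ v.1)).1, c v • (ε.toFun (σ v.1)).2⟩ := by
  obtain ⟨U, hU, hbU, σ, hσ, hσs⟩ := ε.exists_lift b
  set e := trivializationAt ℝ V b with he
  have hb : b ∈ e.baseSet := FiberBundle.mem_baseSet_trivializationAt' b
  -- The trivialization `e` reads both the vector and the frame vector as real numbers. Their ratio
  -- is the coordinate, and the denominator does not vanish over `e.baseSet` because frame vectors
  -- are nonzero.
  let c : TotalSpace ℝ V → ℝ := fun v => (e v).2 / (e (ε.toFun (σ v.1))).2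
  have hne : ∀ d ∈ e.baseSet, (e (ε.toFun (σ d))).2 ≠ 0 := by
    intro d hd h0
    have hd' : (ε.toFun (σ d)).1 ∈ e.baseSet := by rwa [hσ]
    have h1 : e.continuousLinearEquivAt ℝ _ hd' (ε.toFun (σ d)).2 = 0 := h0
    exact ε.ne_zero (σ d) ((map_eq_zero_iff _ (ContinuousLinearEquiv.injective _)).mp h1)
  have he2 : ContMDiffOn (𝓘(ℝ, EB).prod 𝓘(ℝ, ℝ)) 𝓘(ℝ, ℝ) ∞ (fun v : TotalSpace ℝ V => (e v).2)
      (π ℝ V ⁻¹' e.baseSet) := by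
    have h := e.contMDiffOn (IB := 𝓘(ℝ, EB)) (n := ∞)
    rw [e.source_eq] at h
    exact contMDiff_snd.comp_contMDiffOn h
  refine ⟨U ∩ e.baseSet, hU.inter e.open_baseSet, ⟨hbU, hb⟩, σ, c, hσ,
    hσs.mono Set.inter_subset_left, ?_, ?_⟩
  · refine (he2.mono fun v hv => hv.2).div₀ (he2.comp (t := π ℝ V ⁻¹' e.baseSet)
      (ε.contMDiff_toFun.comp_contMDiffOn (hσs.comp (Bundle.contMDiff_proj V).contMDiffOn
        fun v hv => hv.1)) fun v hv => ?_) fun v hv => hne _ hv.2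
    show (ε.toFun (σ v.1)).1 ∈ e.baseSet
    rw [hσ]
    exact hv.2
  · rintro ⟨d, v⟩ ⟨-, hd⟩
    -- Stated for an arbitrary `w` over `d`, because the base point of `ε.toFun (σ d)` is only
    -- propositionally equal to `d`.
    have key : ∀ w : TotalSpace ℝ V, w.1 = d → (e w).2 ≠ 0 →
        (⟨d, v⟩ : TotalSpace ℝ V) = ⟨w.1, ((e ⟨d, v⟩).2 / (e w).2) • w.2⟩ := by
      rintro ⟨d', w⟩ rfl hw
      refine congrArg _ ((e.continuousLinearEquivAt ℝ _ hd).injective ?_)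
      rw [map_smul]
      exact (div_mul_cancel₀ _ hw).symm
    exact key _ (hσ d) (hne d hd)

/-- A function `F` prescribes the value `F x` on the frame vector of `x`. Two frame vectors in one
fibre come from points related by some `T i`, which multiplies vector and value by the same `χ i`,
so the prescription is consistent. In the frame of a local section `σ` the resulting form is `v ↦ c
v * F (σ v.1)`, hence smooth. -/
theorem ham_surjective : Function.Surjective ε.ham := by
  rintro ⟨F, hF, hFh⟩
  have key : ∀ b, ∃ l : V b →ₗ[ℝ] ℝ, ∀ x (w : V b), ε.toFun x = ⟨b, w⟩ → l w = F x := by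
    intro b
    obtain ⟨x, rfl⟩ := ε.exists_proj_eq b
    let e := LinearEquiv.ofBijective (LinearMap.toSpanSingleton ℝ _ (ε.toFun x).2)
      ⟨smul_left_injective ℝ (ε.ne_zero x), fun v => (ε.exists_eq_smul x v).imp fun _ h => h.symm⟩
    refine ⟨F x • (e.symm : V (ε.toFun x).1 →ₗ[ℝ] ℝ), fun y w hy => ?_⟩
    obtain ⟨i, rfl⟩ := ε.transitive x y (congrArg TotalSpace.proj hy).symm
    rw [ε.equivariant] at hy
    obtain rfl := TotalSpace.mk_inj.mp hy
    have h1 : e (χ i) = χ i • (ε.toFun x).2 := rfl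
    rw [hFh, ← h1, LinearMap.smul_apply, LinearEquiv.coe_coe, LinearEquiv.symm_apply_apply,
      smul_eq_mul, mul_comm]
  choose h hh using key
  have hx : ∀ x, h (ε.toFun x).1 (ε.toFun x).2 = F x := fun x => hh _ x _ rfl
  refine ⟨⟨h, fun v => ?_⟩, Subtype.ext (funext hx)⟩
  obtain ⟨W, hW, hbW, σ, c, hσ, hσs, hc, hcv⟩ := ε.exists_local_coord v.1
  have hW' : π ℝ V ⁻¹' W ∈ nhds v := (hW.preimage (FiberBundle.continuous_proj ℝ V)).mem_nhds hbW
  have h1 : ContMDiffAt (𝓘(ℝ, EB).prod 𝓘(ℝ, ℝ)) 𝓘(ℝ, ℝ) ∞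
      (fun v : TotalSpace ℝ V => c v * F (σ v.1)) v :=
    (hc.contMDiffAt hW').mul (hF.contMDiffAt.comp v ((hσs.contMDiffAt (hW.mem_nhds hbW)).comp v
      (Bundle.contMDiff_proj V v)))
  refine h1.congr_of_eventuallyEq ?_
  filter_upwards [hW'] with u hu
  have h2 := congrArg (fun w : TotalSpace ℝ V => h w.1 w.2) (hcv u hu)
  refine h2.trans ?_
  rw [map_smul, hx, smul_eq_mul]

/-- Sections of the dual bundle are the homogeneous functions. -/
noncomputable def hamEquiv : dualSections EB V ≃ₗ[ℝ] homogeneousFunctions E T χ :=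
  LinearEquiv.ofBijective ε.ham ⟨ε.ham_injective, ε.ham_surjective⟩

theorem hamEquiv_apply (h : dualSections EB V) (x : M) :
    (ε.hamEquiv h).1 x = h.1 (ε.toFun x).1 (ε.toFun x).2 := rfl

end FrameMap
end frameMap

/-! ### Isomorphism of line bundles framed on the same space. -/

section fiberSMul

variable {B : Type*} {V : B → Type*} [∀ b, AddCommGroup (V b)] [∀ b, Module ℝ (V b)]

/-- Scalar multiplication in the fibres. -/
def fiberSMul (t : ℝ) (v : TotalSpace ℝ V) : TotalSpace ℝ V := ⟨v.1, t • v.2⟩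

theorem fiberSMul_fiberSMul (s t : ℝ) (v : TotalSpace ℝ V) :
    fiberSMul s (fiberSMul t v) = fiberSMul (s * t) v :=
  congrArg (TotalSpace.mk v.1) (smul_smul s t v.2)

theorem one_fiberSMul (v : TotalSpace ℝ V) : fiberSMul 1 v = v :=
  congrArg (TotalSpace.mk v.1) (one_smul ℝ v.2)

end fiberSMul

section frameMapIso

variable {EB E B M : Type*} [NormedAddCommGroup EB] [NormedSpace ℝ EB] [TopologicalSpace B]
  [ChartedSpace EB B] [NormedAddCommGroup E] [NormedSpace ℝ E] [TopologicalSpace M]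
  [ChartedSpace E M] {ι : Type*}
  {V : B → Type*} [∀ b, AddCommGroup (V b)] [∀ b, Module ℝ (V b)]
  [∀ b, TopologicalSpace (V b)] [TopologicalSpace (TotalSpace ℝ V)] [FiberBundle ℝ V]
  {EB' B' : Type*} [NormedAddCommGroup EB'] [NormedSpace ℝ EB'] [TopologicalSpace B']
  [ChartedSpace EB' B'] {V' : B' → Type*} [∀ b, AddCommGroup (V' b)] [∀ b, Module ℝ (V' b)]
  [∀ b, TopologicalSpace (V' b)] [TopologicalSpace (TotalSpace ℝ V')] [FiberBundle ℝ V']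
  {T : ι → M → M} {χ : ι → ℝ}

theorem ContMDiffAt.fiberSMul [VectorBundle ℝ ℝ V] {EN HN N : Type*} [NormedAddCommGroup EN]
    [NormedSpace ℝ EN] [TopologicalSpace HN] {I : ModelWithCorners ℝ EN HN} [TopologicalSpace N]
    [ChartedSpace HN N] {c : N → ℝ} {f : N → TotalSpace ℝ V} {x : N}
    (hc : ContMDiffAt I 𝓘(ℝ, ℝ) ∞ c x) (hf : ContMDiffAt I (𝓘(ℝ, EB).prod 𝓘(ℝ, ℝ)) ∞ f x) :
    ContMDiffAt I (𝓘(ℝ, EB).prod 𝓘(ℝ, ℝ)) ∞ (fun y => _root_.fiberSMul (c y) (f y)) x := by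
  have hf' := contMDiffAt_totalSpace.mp hf
  refine contMDiffAt_totalSpace.mpr ⟨hf'.1, ?_⟩
  refine (hc.mul hf'.2).congr_of_eventuallyEq ?_
  filter_upwards [hf'.1.continuousAt.preimage_mem_nhds
    ((trivializationAt ℝ V (f x).1).open_baseSet.mem_nhds
      (FiberBundle.mem_baseSet_trivializationAt' _))] with y hy
  exact ((trivializationAt ℝ V (f x).1).continuousLinearEquivAt ℝ _ hy).map_smul (c y) (f y).2

namespace FrameMap
variable (ε : FrameMap E EB V T χ) (ε' : FrameMap E EB' V' T χ)

/-- A point over `b`. -/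
noncomputable def point (b : B) : M := (ε.exists_proj_eq b).choose

theorem proj_point (b : B) : (ε.toFun (ε.point b)).1 = b := (ε.exists_proj_eq b).choose_spec

/-- The vector of `V b` determined by a point over `b`. -/
def vec (x : M) (b : B) (hx : (ε.toFun x).1 = b) : V b := hx ▸ (ε.toFun x).2

theorem vec_ne_zero (x : M) (b : B) (hx : (ε.toFun x).1 = b) : ε.vec x b hx ≠ 0 := by
  subst hx; exact ε.ne_zero x

/-- The map between the bases of two line bundles with frame maps on the same space. -/
noncomputable def baseMap (b : B) : B' := (ε'.toFun (ε.point b)).1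

/-- Independence of the choice made by `point`: two points over the same `b` differ by some `T i`,
which does not change the base point of `ε'` either. -/
theorem baseMap_proj (x : M) : ε.baseMap ε' (ε.toFun x).1 = (ε'.toFun x).1 := by
  obtain ⟨i, hi⟩ := ε.transitive _ _ (ε.proj_point (ε.toFun x).1)
  rw [baseMap]
  conv_rhs => rw [hi, ε'.equivariant]

/-- The choice `point` need not be smooth, but `baseMap_proj` allows it to be replaced by a section
that is smooth near `b`. -/
theorem contMDiff_baseMap : ContMDiff 𝓘(ℝ, EB) 𝓘(ℝ, EB') ∞ (ε.baseMap ε') := by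
  intro b
  obtain ⟨U, hU, hbU, σ, hσ, hσs⟩ := ε.exists_lift b
  have h : ε.baseMap ε' = fun c => ε'.proj (σ c) := by
    funext c
    conv_lhs => rw [← hσ c, baseMap_proj]
    rfl
  rw [h]
  exact ε'.contMDiff_proj.contMDiffAt.comp b (hσs.contMDiffAt (hU.mem_nhds hbU))

theorem baseMap_baseMap (b : B) : ε'.baseMap ε (ε.baseMap ε' b) = b := by
  obtain ⟨x, rfl⟩ := ε.exists_proj_eq b
  rw [baseMap_proj, baseMap_proj]

variable [VectorBundle ℝ ℝ V] [VectorBundle ℝ ℝ V']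

/-- The parametrization of the fibre over `b` by the multiples of the vector of a point. -/
noncomputable def fiberEquiv (x : M) (b : B) (hx : (ε.toFun x).1 = b) : ℝ ≃ₗ[ℝ] V b :=
  LinearEquiv.ofBijective (LinearMap.toSpanSingleton ℝ _ (ε.vec x b hx))
    ⟨smul_left_injective ℝ (ε.vec_ne_zero x b hx), fun v =>
      (exists_eq_smul_of_ne_zero (ε.vec_ne_zero x b hx) v).imp fun _ h => h.symm⟩

theorem mk_fiberEquiv (x : M) (b : B) (hx : (ε.toFun x).1 = b) (t : ℝ) :
    ⟨b, ε.fiberEquiv x b hx t⟩ = fiberSMul t (ε.toFun x) := by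
  subst hx; rfl

theorem exists_eq_fiberSMul (v : TotalSpace ℝ V) : ∃ t x, v = fiberSMul t (ε.toFun x) := by
  obtain ⟨b, v⟩ := v
  refine ⟨(ε.fiberEquiv _ b (ε.proj_point b)).symm v, ε.point b, ?_⟩
  rw [← ε.mk_fiberEquiv _ b (ε.proj_point b), LinearEquiv.apply_symm_apply]

/-- The linear isomorphism of the fibres. -/
noncomputable def fiberMap (b : B) : V b ≃ₗ[ℝ] V' (ε.baseMap ε' b) :=
  (ε.fiberEquiv _ b (ε.proj_point b)).symm.trans (ε'.fiberEquiv (ε.point b) _ rfl)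

/-- The map between the total spaces. -/
noncomputable def totalMap (v : TotalSpace ℝ V) : TotalSpace ℝ V' :=
  ⟨ε.baseMap ε' v.1, ε.fiberMap ε' v.1 v.2⟩

/-- At the chosen point of each fibre this is the construction of `totalMap`. Passing to another
point multiplies the frame vectors of `ε` and of `ε'` by the same `χ i`, so the frames match
everywhere. Inverses and smoothness of the isomorphism follow from this formula. -/
theorem totalMap_fiberSMul (t : ℝ) (x : M) :
    ε.totalMap ε' (fiberSMul t (ε.toFun x)) = fiberSMul t (ε'.toFun x) := by
  obtain ⟨i, hi⟩ := ε.transitive _ _ (ε.proj_point (ε.toFun x).1)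
  have key : ∀ (b : B) (s : ℝ), ε.totalMap ε' (fiberSMul s (ε.toFun (ε.point b))) =
      fiberSMul s (ε'.toFun (ε.point b)) := by
    intro b s
    rw [← ε.mk_fiberEquiv _ b (ε.proj_point b), totalMap, fiberMap, LinearEquiv.trans_apply,
      LinearEquiv.symm_apply_apply]
    exact ε'.mk_fiberEquiv (ε.point b) _ rfl s
  -- Since `x` is `T i` of the chosen point, its frame vector is `χ i` times the chosen one; the
  -- scalar `t` at `x` is `t * χ i` at the chosen point.
  have h1 := key (ε.toFun x).1 (t * χ i)
  rw [← fiberSMul_fiberSMul, ← fiberSMul_fiberSMul] at h1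
  rw [show fiberSMul (χ i) (ε.toFun (ε.point (ε.toFun x).1)) = ε.toFun x by
      conv_rhs => rw [hi, ε.equivariant]
      rfl,
    show fiberSMul (χ i) (ε'.toFun (ε.point (ε.toFun x).1)) = ε'.toFun x by
      conv_rhs => rw [hi, ε'.equivariant]
      rfl] at h1
  exact h1

theorem totalMap_totalMap (v : TotalSpace ℝ V) : ε'.totalMap ε (ε.totalMap ε' v) = v := by
  obtain ⟨t, x, rfl⟩ := ε.exists_eq_fiberSMul v
  rw [totalMap_fiberSMul, totalMap_fiberSMul]

variable [ContMDiffVectorBundle ∞ ℝ V 𝓘(ℝ, EB)]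

theorem contMDiff_totalMap :
    ContMDiff (𝓘(ℝ, EB).prod 𝓘(ℝ, ℝ)) (𝓘(ℝ, EB').prod 𝓘(ℝ, ℝ)) ∞ (ε.totalMap ε') := by
  intro v
  obtain ⟨W, hW, hbW, σ, c, hσ, hσs, hc, hcv⟩ := ε.exists_local_coord v.1
  have hW' : π ℝ V ⁻¹' W ∈ nhds v := (hW.preimage (FiberBundle.continuous_proj ℝ V)).mem_nhds hbW
  have h1 := ContMDiffAt.fiberSMul (hc.contMDiffAt hW')
    (ε'.contMDiff_toFun.contMDiffAt.comp v ((hσs.contMDiffAt (hW.mem_nhds hbW)).comp v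
      (Bundle.contMDiff_proj V v)))
  refine h1.congr_of_eventuallyEq ?_
  filter_upwards [hW'] with u hu
  conv_lhs => rw [hcv u hu]
  exact ε.totalMap_fiberSMul ε' _ _

variable [ContMDiffVectorBundle ∞ ℝ V' 𝓘(ℝ, EB')]

/-- Line bundles with frame maps on the same space are isomorphic. -/
noncomputable def lineBundleIso : LineBundleIso EB EB' V V' where
  base :=
    { toFun := ε.baseMap ε'
      invFun := ε'.baseMap ε
      left_inv := ε.baseMap_baseMap ε'
      right_inv := ε'.baseMap_baseMap ε
      contMDiff_toFun := ε.contMDiff_baseMap ε'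
      contMDiff_invFun := ε'.contMDiff_baseMap ε }
  total :=
    { toFun := ε.totalMap ε'
      invFun := ε'.totalMap ε
      left_inv := ε.totalMap_totalMap ε'
      right_inv := ε'.totalMap_totalMap ε
      contMDiff_toFun := ε.contMDiff_totalMap ε'
      contMDiff_invFun := ε'.contMDiff_totalMap ε }
  fiber := ε.fiberMap ε'
  total_mk _ _ := rfl

theorem lineBundleIso_total (t : ℝ) (x : M) :
    (ε.lineBundleIso ε').total (fiberSMul t (ε.toFun x)) = fiberSMul t (ε'.toFun x) :=
  ε.totalMap_fiberSMul ε' t x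

/-- The isomorphism carries frame vectors to frame vectors, so evaluating a pulled-back section on
the frame of `ε` is evaluating the original one on the frame of `ε'`. -/
theorem hamEquiv_pullback (h : dualSections EB' V') :
    ε.hamEquiv ((ε.lineBundleIso ε').pullback h) = ε'.hamEquiv h := by
  refine Subtype.ext (funext fun x => ?_)
  have h1 := ε.totalMap_fiberSMul ε' 1 x
  rw [one_fiberSMul, one_fiberSMul] at h1
  exact congrArg (fun w : TotalSpace ℝ V' => h.1 w.1 w.2) h1

end FrameMap
end frameMapIso

/-! ### The Kirillov structure given by the Poisson bracket of homogeneous functions. -/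

section reduction

variable {EB E B M : Type*} [NormedAddCommGroup EB] [NormedSpace ℝ EB] [TopologicalSpace B]
  [ChartedSpace EB B] [NormedAddCommGroup E] [NormedSpace ℝ E] [TopologicalSpace M]
  [ChartedSpace E M] [IsManifold 𝓘(ℝ, E) ∞ M] {ι : Type*} {T : ι → M → M} {χ : ι → ℝ}

/-- The transformations `T i` are smooth and multiply the symplectic form by `χ i ≠ 0`. -/
structure SymplecticForm.IsConformal (Ω : SymplecticForm E M) (T : ι → M → M) (χ : ι → ℝ) :
    Prop where
  contMDiff : ∀ i, ContMDiff 𝓘(ℝ, E) 𝓘(ℝ, E) ∞ (T i)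
  ne_zero : ∀ i, χ i ≠ 0
  form : ∀ i (x : M) (v w : E), Ω.form (T i x) (tmap E E (T i) x v) (tmap E E (T i) x w) =
    χ i * Ω.form x v w

namespace SymplecticForm.IsConformal
variable [FiniteDimensional ℝ E] {Ω : SymplecticForm E M} (hΩ : Ω.IsConformal T χ)
include hΩ

/-- No inverse of `T i` is assumed. A vector killed by the tangent map is `ω`-orthogonal to
everything because `χ i ≠ 0`, so the map is injective, and equality of dimensions does the rest. -/
theorem tmap_surjective (i : ι) (x : M) : Function.Surjective (tmap E E (T i) x) := by
  refine LinearMap.surjective_of_injective (f := (tmap E E (T i) x).toLinearMap) ?_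
  refine (injective_iff_map_eq_zero _).mpr fun v hv => Ω.nondegenerate x v fun w => ?_
  have h := hΩ.form i x v w
  have h0 : tmap E E (T i) x v = 0 := hv
  rw [h0] at h
  have h1 : Ω.form (T i x) (0 : E) (tmap E E (T i) x w) = 0 := by
    rw [show Ω.form (T i x) (0 : E) = 0 from map_zero (Ω.form (T i x))]; rfl
  rw [h1] at h
  exact (mul_eq_zero.mp h.symm).resolve_left (hΩ.ne_zero i)

/-- The form and `F` scale by the same factor: with `T_*` for the tangent map of `T i`, `ω(T_* X_F,
T_* w) = χ i ω(X_F, w) = χ i dF(w) = dF(T_* w)`. Vectors `T_* w` suffice as test vectors by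
`tmap_surjective`. -/
theorem hamiltonianField_act {F : M → ℝ} (hF : F ∈ homogeneousFunctions E T χ) (i : ι) (x : M) :
    (Ω.hamiltonianField F (T i x) : E) = tmap E E (T i) x (Ω.hamiltonianField F x) := by
  refine Ω.hamiltonianField_eq_of_form fun w' => ?_
  obtain ⟨w, rfl⟩ := hΩ.tmap_surjective i x w'
  refine (hΩ.form i x _ w).trans ?_
  have h1 : Ω.form x (Ω.hamiltonianField F x) w = tmap E ℝ F x w :=
    congrArg (fun L : E →L[ℝ] ℝ => L w) (Ω.form_hamiltonianField F x)
  have h2 := tmap_comp (hF.1.mdifferentiable (by simp) (T i x))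
    ((hΩ.contMDiff i).mdifferentiable (by simp) x) rfl
  have h3 : (fun y => F (T i y)) = χ i • F := funext fun y => hF.2 i y
  have h4 : tmap E ℝ (χ i • F) x = χ i • tmap E ℝ F x :=
    const_smul_mfderiv (hF.1.mdifferentiable (by simp) x) (χ i)
  rw [h3, h4] at h2
  rw [h1]
  exact congrArg (fun L : E →L[ℝ] ℝ => L w) h2

/-- Both Hamiltonian fields are invariant, so `ω(X_F, X_K)` inherits the weight of `ω` alone: it is
`χ`, not its square. -/
theorem poisson_mem {F K : M → ℝ} (hF : F ∈ homogeneousFunctions E T χ)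
    (hK : K ∈ homogeneousFunctions E T χ) : Ω.poisson F K ∈ homogeneousFunctions E T χ := by
  refine ⟨Ω.contMDiff_poisson hF.1 hK.1, fun i x => ?_⟩
  have h := hΩ.form i x (Ω.hamiltonianField F x) (Ω.hamiltonianField K x)
  rw [← hΩ.hamiltonianField_act hF, ← hΩ.hamiltonianField_act hK] at h
  exact h

/-- The negative of the Poisson bracket on homogeneous functions. -/
noncomputable def bracket : homogeneousFunctions E T χ →ₗ[ℝ] homogeneousFunctions E T χ →ₗ[ℝ]
    homogeneousFunctions E T χ :=
  -- Exchanging the arguments accounts for the minus sign.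
  LinearMap.mk₂ ℝ (fun F K => ⟨Ω.poisson K.1 F.1, hΩ.poisson_mem K.2 F.2⟩)
    (fun F₁ F₂ K => Subtype.ext (by
      show Ω.poisson K.1 (F₁.1 + F₂.1) = Ω.poisson K.1 F₁.1 + Ω.poisson K.1 F₂.1
      rw [Ω.poisson_swap, Ω.poisson_add_left F₁.2.1 F₂.2.1, neg_add, ← Ω.poisson_swap,
        ← Ω.poisson_swap]))
    (fun r F K => Subtype.ext (by
      show Ω.poisson K.1 (r • F.1) = r • Ω.poisson K.1 F.1
      rw [Ω.poisson_swap, Ω.poisson_smul_left F.2.1, Ω.poisson_swap K.1, smul_neg]))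
    (fun F K₁ K₂ => Subtype.ext (Ω.poisson_add_left K₁.2.1 K₂.2.1 F.1))
    (fun r F K => Subtype.ext (Ω.poisson_smul_left K.2.1 r F.1))

theorem bracket_apply (F K : homogeneousFunctions E T χ) :
    (hΩ.bracket F K).1 = -Ω.poisson F.1 K.1 := by
  rw [← Ω.poisson_swap]; rfl

theorem bracket_self (F : homogeneousFunctions E T χ) : hΩ.bracket F F = 0 := by
  refine Subtype.ext (funext fun x => ?_)
  have h := Ω.poisson_skew F.1 F.1 x
  show Ω.poisson F.1 F.1 x = 0
  linarith

theorem bracket_jacobi (F K L : homogeneousFunctions E T χ) :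
    hΩ.bracket F (hΩ.bracket K L) + hΩ.bracket K (hΩ.bracket L F) +
      hΩ.bracket L (hΩ.bracket F K) = 0 := by
  refine Subtype.ext (funext fun x => ?_)
  have h := Ω.poisson_jacobi F.2.1 L.2.1 K.2.1 x
  show Ω.poisson (Ω.poisson L.1 K.1) F.1 x + Ω.poisson (Ω.poisson F.1 L.1) K.1 x +
    Ω.poisson (Ω.poisson K.1 F.1) L.1 x = 0
  rw [Ω.poisson_skew _ F.1, Ω.poisson_skew _ K.1, Ω.poisson_skew _ L.1]
  linarith

end SymplecticForm.IsConformal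

namespace FrameMap
variable {V : B → Type*} [∀ b, AddCommGroup (V b)] [∀ b, Module ℝ (V b)]
  [∀ b, TopologicalSpace (V b)] [TopologicalSpace (TotalSpace ℝ V)] [FiberBundle ℝ V]
  [VectorBundle ℝ ℝ V] [ContMDiffVectorBundle ∞ ℝ V 𝓘(ℝ, EB)]
  [FiniteDimensional ℝ E]
  {Ω : SymplecticForm E M} (ε : FrameMap E EB V T χ) (hΩ : Ω.IsConformal T χ)

/-- The projection of the Hamiltonian vector field of the opposite of a homogeneous function. -/
noncomputable def symbol (Ω : SymplecticForm E M) (h : dualSections EB V) (b : B) :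
    TangentSpace 𝓘(ℝ, EB) b :=
  (tmap E EB ε.proj (ε.point b) (Ω.hamiltonianField (ε.hamEquiv (-h)).1 (ε.point b)) : EB)

include hΩ in
-- The Hamiltonian field of a homogeneous function is invariant under the `T i`, so its projection
-- is constant along each fibre of `M → B` and the choice of `point` is immaterial.
theorem symbol_proj (h : dualSections EB V) (x : M) : (ε.symbol Ω h (ε.toFun x).1 : EB) =
    tmap E EB ε.proj x (Ω.hamiltonianField (ε.hamEquiv (-h)).1 x) := by
  obtain ⟨i, hi⟩ := ε.transitive _ _ (ε.proj_point (ε.toFun x).1).symm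
  rw [symbol, hi, hΩ.hamiltonianField_act (ε.hamEquiv (-h)).2]
  have h1 := tmap_comp (ε.contMDiff_proj.mdifferentiable (by simp) (T i x))
    ((hΩ.contMDiff i).mdifferentiable (by simp) x) rfl
  simp only [ε.proj_act] at h1
  exact (congrArg (fun L : E →L[ℝ] EB => L (Ω.hamiltonianField (ε.hamEquiv (-h)).1 x)) h1).symm

include hΩ in
-- Explains the sign in `symbol`: the bracket is minus the Poisson bracket, so its first order part
-- is `f ↦ -{f, H_h}`, which is differentiation along the Hamiltonian field of `-H_h`.
theorem differential_symbol {f : B → ℝ} (hf : ContMDiff 𝓘(ℝ, EB) 𝓘(ℝ, ℝ) ∞ f)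
    (h : dualSections EB V) (x : M) :
    differential f (ε.toFun x).1 (ε.symbol Ω h (ε.toFun x).1) =
      -Ω.poisson (fun y => f (ε.proj y)) (ε.hamEquiv h).1 x := by
  have h1 := tmap_comp (hf.mdifferentiable (by simp) (ε.proj x))
    (ε.contMDiff_proj.mdifferentiable (by simp) x) rfl
  have h2 : Ω.poisson (fun y => f (ε.proj y)) (ε.hamEquiv (-h)).1 x =
      differential f (ε.toFun x).1 (ε.symbol Ω h (ε.toFun x).1) := by
    rw [Ω.poisson_eq]
    refine (congrArg (fun L : E →L[ℝ] ℝ => L _) h1).trans ?_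
    exact (congrArg (tmap EB ℝ f (ε.proj x)) (ε.symbol_proj hΩ h x)).symm
  have hneg : (ε.hamEquiv (-h)).1 = -(ε.hamEquiv h).1 := congrArg Subtype.val (map_neg ε.hamEquiv h)
  rw [← h2, hneg, Ω.poisson_skew, Ω.poisson_skew _ (ε.hamEquiv h).1]
  exact congrArg Neg.neg (Ω.poisson_neg_left _ _ x)

variable [IsManifold 𝓘(ℝ, EB) ∞ B]

include hΩ in
-- By `symbol_proj` the field is, near each point, the tangent map of the projection applied to a
-- smooth Hamiltonian field along a smooth local section.
theorem isSmoothField_symbol (h : dualSections EB V) : IsSmoothField (ε.symbol Ω h) := by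
  intro b
  obtain ⟨U, hU, hbU, σ, hσ, hσs⟩ := ε.exists_lift b
  have h1 := (ε.contMDiff_proj.contMDiff_tangentMap (m := ∞) le_rfl).comp
    (Ω.isSmoothField_hamiltonianField (ε.hamEquiv (-h)).2.1)
  have h2 := h1.contMDiffAt.comp b (hσs.contMDiffAt (hU.mem_nhds hbU))
  refine h2.congr_of_eventuallyEq (Filter.Eventually.of_forall fun c => ?_)
  -- Naming the point `σ c` lets its base point be substituted for `c`, so that both tangent vectors
  -- live in the same space.
  obtain ⟨x, hx⟩ : ∃ x, x = σ c := ⟨_, rfl⟩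
  have hc : c = (ε.toFun x).1 := hx ▸ (hσ c).symm
  simp only [Function.comp_apply]
  rw [← hx]
  subst hc
  exact congrArg (TotalSpace.mk (F := EB) (E := TangentSpace 𝓘(ℝ, EB)) (ε.toFun x).1)
    (ε.symbol_proj hΩ h x)

/-- The Kirillov structure induced by the Poisson bracket of homogeneous functions. -/
noncomputable def kirillovStructure : KirillovStructure EB V where
  bracket := (hΩ.bracket.compl₁₂ ε.hamEquiv.toLinearMap ε.hamEquiv.toLinearMap).compr₂
    ε.hamEquiv.symm.toLinearMap
  bracket_self h := by
    simp [hΩ.bracket_self]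
  jacobi h₁ h₂ h₃ := by
    have h := hΩ.bracket_jacobi (ε.hamEquiv h₁) (ε.hamEquiv h₂) (ε.hamEquiv h₃)
    apply ε.hamEquiv.injective
    simpa using h
  symbol := ε.symbol Ω
  isSmoothField_symbol := ε.isSmoothField_symbol hΩ
  -- Multiples of frame vectors exhaust the fibres, so the claim is the Leibniz rule `{f H₁, H₂} = f
  -- {H₁, H₂} + {f, H₂} H₁` at a point `x` of `M`, multiplied by `-t`.
  bracket_mul f hf h₁ k h₂ hk b v := by
    obtain ⟨x, rfl⟩ := ε.exists_proj_eq b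
    obtain ⟨t, rfl⟩ := ε.exists_eq_smul x v
    rw [map_smul, map_smul, map_smul, differential_symbol ε hΩ hf]
    have hb : ∀ F K : homogeneousFunctions E T χ,
        (ε.hamEquiv.symm (hΩ.bracket F K)).1 (ε.toFun x).1 (ε.toFun x).2 = -Ω.poisson F.1 K.1 x := by
      intro F K
      rw [← ε.hamEquiv_apply, LinearEquiv.apply_symm_apply, hΩ.bracket_apply]
      rfl
    have hkf : (ε.hamEquiv k).1 = fun y => f (ε.proj y) * (ε.hamEquiv h₁).1 y :=
      funext fun y => hk _ _
    have hfp := (hf.comp ε.contMDiff_proj).mdifferentiable (by simp) x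
    have h1 := differential_mul hfp ((ε.hamEquiv h₁).2.1.mdifferentiable (by simp) x)
      (Ω.hamiltonianField (ε.hamEquiv h₂).1 x)
    have e1 := hb (ε.hamEquiv k) (ε.hamEquiv h₂)
    have e2 := hb (ε.hamEquiv h₁) (ε.hamEquiv h₂)
    have e3 : Ω.poisson (ε.hamEquiv k).1 (ε.hamEquiv h₂).1 x =
        f (ε.proj x) * Ω.poisson (ε.hamEquiv h₁).1 (ε.hamEquiv h₂).1 x +
          Ω.poisson (fun y => f (ε.proj y)) (ε.hamEquiv h₂).1 x * (ε.hamEquiv h₁).1 x := by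
      rw [hkf, Ω.poisson_eq, Ω.poisson_eq, Ω.poisson_eq]
      exact h1
    rw [e3] at e1
    simp only [smul_eq_mul]
    refine (congrArg (t * ·) e1).trans ?_
    refine Eq.trans ?_ (congrArg (fun r => f (ε.proj x) * (t * r) +
      -Ω.poisson (fun y => f (ε.proj y)) (ε.hamEquiv h₂).1 x * (t * (ε.hamEquiv h₁).1 x)) e2.symm)
    ring

theorem hamEquiv_bracket (h k : dualSections EB V) :
    ε.hamEquiv ((ε.kirillovStructure hΩ).bracket h k) = hΩ.bracket (ε.hamEquiv h) (ε.hamEquiv k) :=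
  ε.hamEquiv.apply_symm_apply _

end FrameMap
end reduction

/-! ### The frame maps of `L`, `𝒟°` and `𝒟°/G`. -/

section assocFrame

variable {Γ : Subgroup ℝˣ} [Fact (Γ = ⊤ ∨ Γ = Units.posSubgroup ℝ)]
  {E EB M : Type*} [NormedAddCommGroup E] [NormedSpace ℝ E]
  [NormedAddCommGroup EB] [NormedSpace ℝ EB]
  [TopologicalSpace M] [ChartedSpace E M] [MulAction Γ M] [ChartedSpace EB (Orb Γ M)]
  (h : IsPrincipalAction ℝ E EB Γ M)

namespace AssocFiber

/-- The vector `[(x, 1)]`. -/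
def frameVec (x : M) : TotalSpace ℝ (AssocFiber h) := ⟨orb Γ x, mk h x 1⟩

/-- Moves the base point along `orb Γ x = k`, so that vectors given by different points of an orbit
can be compared in one fibre. `mk_covectorAt` and `mk_annMk` serve the same purpose for `𝒟°` and
`𝒟°/G`. -/
theorem mk_mkAt (x : M) (k : Orb Γ M) (hx : orb Γ x = k) (t : ℝ) :
    (⟨orb Γ x, mk h x t⟩ : TotalSpace ℝ (AssocFiber h)) = ⟨k, mkAt h x k hx t⟩ := by
  subst hx; rfl

theorem mkAt_eq_smul (x : M) (k : Orb Γ M) (hx : orb Γ x = k) (t : ℝ) :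
    mkAt h x k hx t = t • mkAt h x k hx 1 := by
  rw [← coord_symm, ← coord_symm, ← map_smul, smul_eq_mul, mul_one]

theorem mkAt_one_ne_zero (x : M) (k : Orb Γ M) (hx : orb Γ x = k) : mkAt h x k hx 1 ≠ 0 := by
  rw [← coord_symm]
  exact fun h0 => one_ne_zero ((map_eq_zero_iff _ (ContinuousLinearEquiv.injective _)).mp h0)

theorem frameVec_smul (s : Γ) (x : M) : frameVec h (s • x) =
    ⟨orb Γ x, scalingCoord s • mk h x 1⟩ := by
  have hx : orb Γ (s • x) = orb Γ x := orb_eq_orb.mpr ⟨s, rfl⟩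
  rw [frameVec, mk_mkAt h _ _ hx, mkAt_eq h x (s • x) _ rfl hx s rfl, one_mul, mkAt_eq_smul]
  rfl

variable [IsManifold 𝓘(ℝ, EB) ∞ (Orb Γ M)]

/-- In the trivialization defined by a local section `σ`, the vector `[(y, 1)]` has as coordinate
the scaling factor taking `σ [y]` to `y`, which is smooth in `y` by `exists_div`. -/
theorem contMDiff_frameVec :
    ContMDiff 𝓘(ℝ, E) (𝓘(ℝ, EB).prod 𝓘(ℝ, ℝ)) ∞ (frameVec h) := by
  intro x
  refine contMDiffAt_totalSpace.mpr ⟨h.contMDiff_orb x, ?_⟩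
  set i := orb Γ x with hi
  have hsp := (h.locally_trivial i).choose_spec
  have hU : IsOpen (orb Γ ⁻¹' (h.locally_trivial i).choose : Set M) :=
    hsp.1.preimage h.contMDiff_orb.continuous
  obtain ⟨g, hg, hgx⟩ := h.exists_div hU
    (hsp.2.2.choose_spec.2.1.comp h.contMDiff_orb.contMDiffOn fun y hy => hy)
    (contMDiff_id (M := M)).contMDiffOn
    fun y _ => hsp.2.2.choose_spec.1 _
  have hg' := (contMDiff_scalingCoord Γ).contMDiffAt.comp x (hg.contMDiffAt (hU.mem_nhds hsp.2.1))
  refine hg'.congr_of_eventuallyEq ?_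
  filter_upwards [hU.mem_nhds hsp.2.1] with y hy
  show coord h (hsp.2.2.choose (orb Γ y)) (orb Γ y) (hsp.2.2.choose_spec.1 _) (mkAt h y _ rfl 1) = _
  rw [mkAt_eq h (hsp.2.2.choose (orb Γ y)) y _ (hsp.2.2.choose_spec.1 _) rfl (g y) (hgx y hy),
    coord_mkAt, one_mul]
  rfl

end AssocFiber
end assocFrame

section pairAct

variable {S G : Type*} {Γ : Subgroup ℝˣ} [Group G] [MulAction G S] [MulAction Γ S]

/-- The action of a pair in `G × Γ`. -/
def pairAct (p : G × Γ) (x : S) : S := p.2 • p.1 • x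

/-- The weight of a pair in `G × Γ`. -/
def pairWeight (p : G × Γ) : ℝ := scalingCoord p.2

theorem orb_pairAct [SMulCommClass G Γ S] (p : G × Γ) (x : S) : orb G (pairAct p x) = p.2 • orb G x :=
  orb_eq_orb.mpr ⟨p.1, smul_comm _ _ _⟩

theorem orb_orb_pairAct [SMulCommClass Γ G S] (p : G × Γ) (x : S) :
    orb G (orb Γ (pairAct p x)) = orb G (orb Γ x) := by
  have h : orb Γ (pairAct p x) = p.1 • orb Γ x := orb_eq_orb.mpr ⟨p.2, rfl⟩
  rw [h]
  exact orb_eq_orb.mpr ⟨p.1, rfl⟩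

end pairAct

namespace CompatibleSystem
variable {E E₁ E₂ E₃ E₄ EG S G : Type*} {Γ : Subgroup ℝˣ} [Fact (Γ = ⊤ ∨ Γ = Units.posSubgroup ℝ)]
  [NormedAddCommGroup E] [NormedSpace ℝ E] [NormedAddCommGroup E₁] [NormedSpace ℝ E₁]
  [NormedAddCommGroup E₂] [NormedSpace ℝ E₂] [NormedAddCommGroup E₃] [NormedSpace ℝ E₃]
  [NormedAddCommGroup E₄] [NormedSpace ℝ E₄] [NormedAddCommGroup EG] [NormedSpace ℝ EG]
  [TopologicalSpace S] [ChartedSpace E S] [IsManifold 𝓘(ℝ, E) ∞ S]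
  [Group G] [TopologicalSpace G] [ChartedSpace EG G]
  [MulAction G S] [MulAction Γ S] [SMulCommClass G Γ S] [SMulCommClass Γ G S]
  [ChartedSpace E₁ (Orb G S)] [ChartedSpace E₂ (Orb Γ S)]
  [ChartedSpace E₃ (Orb Γ (Orb G S))] [ChartedSpace E₄ (Orb G (Orb Γ S))]
  (sys : CompatibleSystem E E₁ E₂ E₃ E₄ EG S G Γ)

theorem isConformal_scaling :
    sys.sympl.IsConformal (fun (s : Γ) (x : S) => s • x) scalingCoord where
  contMDiff s := sys.principal_scaling.contMDiff_const_smul s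
  ne_zero := scalingCoord_ne_zero
  form := sys.form_scaling

/-- `G` preserves the form and `Γ` scales it, so only the second component of a pair contributes to
the weight. -/
theorem isConformal_pair :
    sys.sympl.IsConformal (pairAct : G × Γ → S → S) pairWeight where
  contMDiff p := (sys.principal_scaling.contMDiff_const_smul p.2).comp
    (sys.principal_symmetry.contMDiff_const_smul p.1)
  ne_zero p := scalingCoord_ne_zero p.2
  form p x v w := by
    have h := tmap_comp
      ((sys.principal_scaling.contMDiff_const_smul p.2).mdifferentiable (by simp) (p.1 • x))
      ((sys.principal_symmetry.contMDiff_const_smul p.1).mdifferentiable (by simp) x) rfl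
    have h' : tmap E E (pairAct p) x = _ := h
    rw [h']
    refine (sys.form_scaling p.2 (p.1 • x) _ _).trans ?_
    exact congrArg (scalingCoord p.2 * ·) (sys.form_symmetry p.1 x v w)

theorem mk_covectorAt (x : S) (c : Orb Γ S) (hx : orb Γ x = c) :
    (⟨orb Γ x, sys.covector x⟩ : TotalSpace ℝ sys.AnnFiber) = ⟨c, sys.covectorAt x c hx⟩ := by
  subst hx; rfl

/-- The frame map `x ↦ α_x` of `𝒟°`. -/
noncomputable def frameC [IsManifold 𝓘(ℝ, E₂) ∞ (Orb Γ S)] :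
    FrameMap E E₂ sys.AnnFiber (fun (s : Γ) (x : S) => s • x) scalingCoord where
  toFun x := ⟨orb Γ x, sys.covector x⟩
  contMDiff_toFun := by
    intro x
    have hp := sys.principal_scaling
    refine contMDiffAt_totalSpace.mpr ⟨hp.contMDiff_orb x, ?_⟩
    set i := orb Γ x with hi
    have hsp := (hp.locally_trivial i).choose_spec
    have hU : IsOpen (orb Γ ⁻¹' (hp.locally_trivial i).choose : Set S) :=
      hsp.1.preimage hp.contMDiff_orb.continuous
    -- The element `g y` of `Γ` takes `σ [y]` to `y`; its scaling factor is the coordinate of `α_y`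
    -- in the frame of `σ`.
    obtain ⟨g, hg, hgx⟩ := hp.exists_div hU
      (hsp.2.2.choose_spec.2.1.comp hp.contMDiff_orb.contMDiffOn fun y hy => hy)
      (contMDiff_id (M := S)).contMDiffOn
      fun y _ => hsp.2.2.choose_spec.1 _
    have hg' := (contMDiff_scalingCoord Γ).contMDiffAt.comp x (hg.contMDiffAt (hU.mem_nhds hsp.2.1))
    refine hg'.congr_of_eventuallyEq ?_
    filter_upwards [hU.mem_nhds hsp.2.1] with y hy
    have h1 := sys.coordAt_coordAt_symm (hsp.2.2.choose (orb Γ y)) y (orb Γ y)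
      (hsp.2.2.choose_spec.1 _) rfl (g y) (hgx y hy) 1
    rw [coordAt_symm, one_smul, mul_one] at h1
    exact h1
  ne_zero x := sys.covectorAt_ne_zero x _ rfl
  exists_lift b := by
    obtain ⟨U, hU, hbU, σ, hσ, hσs, -⟩ := sys.principal_scaling.locally_trivial b
    exact ⟨U, hU, hbU, σ, hσ, hσs⟩
  equivariant s x := by
    have hx : orb Γ (s • x) = orb Γ x := orb_eq_orb.mpr ⟨s, rfl⟩
    rw [sys.mk_covectorAt _ _ hx, sys.covectorAt_smul x (s • x) _ rfl hx s rfl]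
    rfl
  transitive x y h := by
    obtain ⟨s, hs⟩ := orb_eq_orb.mp h.symm
    exact ⟨s, hs.symm⟩

theorem exists_lift_quotient (sys : CompatibleSystem E E₁ E₂ E₃ E₄ EG S G Γ)
    (b : Orb Γ (Orb G S)) :
    ∃ U : Set (Orb Γ (Orb G S)), IsOpen U ∧ b ∈ U ∧ ∃ ξ : Orb Γ (Orb G S) → S,
      (∀ c, orb Γ (orb G (ξ c)) = c) ∧ ContMDiffOn 𝓘(ℝ, E₃) 𝓘(ℝ, E) ∞ ξ U := by
  obtain ⟨V, hV, hbV, τ, hτ, hτs, -⟩ := sys.principal_scaling_quotient.locally_trivial b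
  obtain ⟨U, hU, hbU, σ, hσ, hσs, -⟩ := sys.principal_symmetry.locally_trivial (τ b)
  refine ⟨V ∩ τ ⁻¹' U, hτs.continuousOn.isOpen_inter_preimage hV hU, ⟨hbV, hbU⟩,
    fun c => σ (τ c), fun c => by rw [hσ, hτ], ?_⟩
  exact hσs.comp (hτs.mono Set.inter_subset_left) fun c hc => hc.2

/-- The frame map `x ↦ [([x], 1)]` of `L`. -/
noncomputable def frameL [IsManifold 𝓘(ℝ, E₃) ∞ (Orb Γ (Orb G S))] :
    FrameMap E E₃ sys.LineL (pairAct : G × Γ → S → S) pairWeight where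
  toFun x := AssocFiber.frameVec sys.principal_scaling_quotient (orb G x)
  contMDiff_toFun := (AssocFiber.contMDiff_frameVec _).comp sys.principal_symmetry.contMDiff_orb
  ne_zero x := AssocFiber.mkAt_one_ne_zero _ _ _ rfl
  exists_lift := sys.exists_lift_quotient
  equivariant p x := by
    rw [orb_pairAct]
    exact AssocFiber.frameVec_smul _ p.2 (orb G x)
  transitive x y h := by
    obtain ⟨s, hs⟩ := orb_eq_orb.mp h.symm
    obtain ⟨g, hg⟩ := orb_eq_orb.mp hs
    -- The two orbit relations give `g • y = s • x`; since the actions commute, `y = s • g⁻¹ • x`.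
    refine ⟨(g⁻¹, s), ?_⟩
    have hg' : g • y = s • x := hg
    rw [pairAct, smul_comm, ← hg', inv_smul_smul]

section quotient
variable [IsManifold 𝓘(ℝ, E₂) ∞ (Orb Γ S)]

theorem mk_annMk (x : S) (b : Orb G (Orb Γ S)) (hx : orb G (orb Γ x) = b) (t : ℝ) :
    (⟨orb G (orb Γ x), sys.annMk (orb Γ x) (t • sys.covector x)⟩ : TotalSpace ℝ sys.AnnQuot) =
      ⟨b, (AnnQuot.coordAt sys x b hx).symm t⟩ := by
  subst hx
  rw [AnnQuot.coordAt_symm]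
  rfl

/-- The linear structure on a fibre of `𝒟°/G` is transported from one chosen representative of the
orbit, which need not be `orb Γ x`. Linearity over `orb Γ x` is recovered from the linear coordinate
attached to `x`. -/
theorem annMk_smul (x : S) (t : ℝ) : sys.annMk (orb Γ x) (t • sys.covector x) =
    t • sys.annMk (orb Γ x) (sys.covector x) := by
  have h : ∀ t, sys.annMk (orb Γ x) (t • sys.covector x) =
      (AnnQuot.coordAt sys x _ rfl).symm t := fun t => (AnnQuot.coordAt_symm sys x _ rfl t).symm
  have h1 := h 1
  rw [one_smul] at h1
  rw [h, h1, ← map_smul, smul_eq_mul, mul_one]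

variable [LieGroup 𝓘(ℝ, EG) ∞ G]

/-- The frame map `x ↦ [α_x]` of `𝒟°/G`. -/
noncomputable def frameCG [IsManifold 𝓘(ℝ, E₄) ∞ (Orb G (Orb Γ S))] :
    FrameMap E E₄ sys.AnnQuot (pairAct : G × Γ → S → S) pairWeight where
  toFun x := ⟨orb G (orb Γ x), sys.annMk (orb Γ x) (sys.covector x)⟩
  contMDiff_toFun := by
    intro x
    have hp := sys.principal_scaling
    have hq : ContMDiff 𝓘(ℝ, E) 𝓘(ℝ, E₄) ∞ (fun x : S => orb G (orb Γ x)) :=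
      sys.principal_symmetry_quotient.contMDiff_orb.comp hp.contMDiff_orb
    refine contMDiffAt_totalSpace.mpr ⟨hq x, ?_⟩
    set i := orb G (orb Γ x) with hi
    have hsp := (sys.exists_local_lift i).choose_spec
    set ξ := hsp.2.2.choose with hξ
    have hξs := hsp.2.2.choose_spec
    rw [← hξ] at hξs
    have hU : IsOpen ((fun x : S => orb G (orb Γ x)) ⁻¹' (sys.exists_local_lift i).choose) :=
      hsp.1.preimage hq.continuous
    set U := (fun x : S => orb G (orb Γ x)) ⁻¹' (sys.exists_local_lift i).choose with hUdef
    have hlift : ContMDiffOn 𝓘(ℝ, E) 𝓘(ℝ, E) ∞ (fun y => ξ (orb G (orb Γ y))) U :=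
      hξs.2.comp hq.contMDiffOn fun y hy => hy
    -- The lift `ξ [[y]]` differs from `y` by both groups. Division in `C` gives `g` with `g • ξ
    -- [[y]]` in the `Γ`-orbit of `y`, and division in `S` gives `s`. Only `s` enters the coordinate
    -- of `[α_y]`.
    obtain ⟨g, hg, hgx⟩ := sys.principal_symmetry_quotient.exists_div hU
      (hp.contMDiff_orb.comp_contMDiffOn hlift) hp.contMDiff_orb.contMDiffOn
      fun y _ => hξs.1 _
    obtain ⟨s, hs, hsx⟩ := hp.exists_div hU
      (sys.principal_symmetry.contMDiff_smul.comp_contMDiffOn (hg.prodMk hlift))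
      (contMDiff_id (M := S)).contMDiffOn fun y hy => (hgx y hy).symm
    have hxU : x ∈ U := hsp.2.1
    have hs' := (contMDiff_scalingCoord Γ).contMDiffAt.comp x (hs.contMDiffAt (hU.mem_nhds hxU))
    refine hs'.congr_of_eventuallyEq ?_
    filter_upwards [hU.mem_nhds hxU] with y hy
    have h1 := AnnQuot.coordAt_coordAt_symm sys (ξ (orb G (orb Γ y))) y (orb G (orb Γ y))
      (hξs.1 _) rfl (g y) (s y) (hsx y hy) 1
    rw [AnnQuot.coordAt_symm, one_smul, mul_one] at h1
    exact h1
  ne_zero x := by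
    have h := AnnQuot.coordAt_symm sys x _ rfl 1
    rw [one_smul] at h
    show AnnQuot.mkAt sys (orb Γ x) _ rfl (sys.covector x) ≠ 0
    rw [← h]
    exact fun h0 => one_ne_zero ((map_eq_zero_iff _ (ContinuousLinearEquiv.injective _)).mp h0)
  exists_lift := sys.exists_local_lift
  equivariant p x := by
    have hx := orb_orb_pairAct p x
    have h1 := sys.mk_annMk (pairAct p x) _ hx 1
    rw [one_smul] at h1
    rw [h1, ← sys.annMk_smul]
    refine Eq.trans (congrArg _ ?_) (sys.mk_annMk x _ rfl (pairWeight p)).symm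
    rw [ContinuousLinearEquiv.eq_symm_apply,
      AnnQuot.coordAt_coordAt_symm sys x (pairAct p x) _ rfl hx p.1 p.2 rfl, mul_one]
    rfl
  transitive x y h := by
    obtain ⟨g, hg⟩ := orb_eq_orb.mp h.symm
    obtain ⟨s, hs⟩ := orb_eq_orb.mp hg
    refine ⟨(g, s⁻¹), ?_⟩
    have hs' : s • y = g • x := hs
    rw [pairAct, ← hs', inv_smul_smul]

end quotient
end CompatibleSystem

section pairInvariant

variable {E S G : Type*} {Γ : Subgroup ℝˣ} [NormedAddCommGroup E] [NormedSpace ℝ E]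
  [TopologicalSpace S] [ChartedSpace E S] [Group G] [MulAction G S] [MulAction Γ S]

/-- Pairs `(1, s)` recover the action of `Γ` alone. Forgetting the invariance in this way produces
the section of `(𝒟°)^*` that induces a given section on the quotient. -/
theorem homogeneous_of_invariant {F : S → ℝ}
    (hF : F ∈ homogeneousFunctions E (pairAct : G × Γ → S → S) pairWeight) :
    F ∈ homogeneousFunctions E (fun (s : Γ) (x : S) => s • x) scalingCoord :=
  ⟨hF.1, fun s x => by
    have h := hF.2 (1, s) x
    rwa [pairAct, one_smul] at h⟩

end pairInvariant

/-! ### Comparison of brackets and Hamiltonian vector fields. -/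

section symbolRelated

variable {EB E B M : Type*} [NormedAddCommGroup EB] [NormedSpace ℝ EB] [TopologicalSpace B]
  [ChartedSpace EB B] [NormedAddCommGroup E] [NormedSpace ℝ E] [TopologicalSpace M]
  [ChartedSpace E M] [IsManifold 𝓘(ℝ, E) ∞ M] [FiniteDimensional ℝ E]
  {ι : Type*} {T : ι → M → M} {χ : ι → ℝ}
  {V : B → Type*} [∀ b, AddCommGroup (V b)] [∀ b, Module ℝ (V b)]
  [∀ b, TopologicalSpace (V b)] [TopologicalSpace (TotalSpace ℝ V)] [FiberBundle ℝ V]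
  [VectorBundle ℝ ℝ V] [ContMDiffVectorBundle ∞ ℝ V 𝓘(ℝ, EB)]
  {EB' B' : Type*} [NormedAddCommGroup EB'] [NormedSpace ℝ EB'] [TopologicalSpace B']
  [ChartedSpace EB' B'] {V' : B' → Type*} [∀ b, AddCommGroup (V' b)] [∀ b, Module ℝ (V' b)]
  [∀ b, TopologicalSpace (V' b)] [TopologicalSpace (TotalSpace ℝ V')] [FiberBundle ℝ V']
  [VectorBundle ℝ ℝ V'] [ContMDiffVectorBundle ∞ ℝ V' 𝓘(ℝ, EB')]
  {Ω : SymplecticForm E M} (hΩ : Ω.IsConformal T χ)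
  (ε : FrameMap E EB V T χ) (ε' : FrameMap E EB' V' T χ)

namespace FrameMap

/-- Both brackets are the same operation on functions on `M`, and pull-back does not change these
functions; `hamEquiv` is injective. -/
theorem bracket_pullback [IsManifold 𝓘(ℝ, EB) ∞ B] [IsManifold 𝓘(ℝ, EB') ∞ B']
    (h k : dualSections EB' V') :
    (ε.kirillovStructure hΩ).bracket ((ε.lineBundleIso ε').pullback h)
      ((ε.lineBundleIso ε').pullback k) =
    (ε.lineBundleIso ε').pullback ((ε'.kirillovStructure hΩ).bracket h k) := by
  apply ε.hamEquiv.injective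
  rw [hamEquiv_bracket, hamEquiv_pullback, hamEquiv_pullback, hamEquiv_pullback, hamEquiv_bracket]

include hΩ in
/-- The Hamiltonian vector fields of the sections of the same homogeneous function are related by
the isomorphism of the bases. -/
theorem mfderiv_symbol {h : dualSections EB V} {h' : dualSections EB' V'}
    (hh : ε.hamEquiv h = ε'.hamEquiv h') (b : B) :
    mfderiv 𝓘(ℝ, EB) 𝓘(ℝ, EB') (ε.lineBundleIso ε').base b (ε.symbol Ω h b) =
      ε'.symbol Ω h' ((ε.lineBundleIso ε').base b) := by
  obtain ⟨x, rfl⟩ := ε.exists_proj_eq b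
  have hF : ε.hamEquiv (-h) = ε'.hamEquiv (-h') :=
    (map_neg ε.hamEquiv h).trans ((congrArg Neg.neg hh).trans (map_neg ε'.hamEquiv h').symm)
  have h1 := tmap_comp ((ε.contMDiff_baseMap ε').mdifferentiable (by simp) (ε.toFun x).1)
    (ε.contMDiff_proj.mdifferentiable (by simp) x) rfl
  -- The two symbols are projections of one field on `M`, and the base map carries one projection to
  -- the other, so the chain rule relates them.
  have e : (fun y => ε.baseMap ε' (ε.proj y)) = ε'.proj := funext fun y => ε.baseMap_proj ε' y
  rw [e] at h1
  have h2 := congrArg (fun L : E →L[ℝ] EB' => L (Ω.hamiltonianField (ε.hamEquiv (-h)).1 x)) h1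
  have h3 : ∀ b', b' = (ε'.toFun x).1 → (ε'.symbol Ω h' b' : EB') =
      ε'.symbol Ω h' (ε'.toFun x).1 := by rintro _ rfl; rfl
  refine Eq.trans ?_ ((h3 _ (ε.baseMap_proj ε' x)).trans (ε'.symbol_proj hΩ h' x)).symm
  rw [← hF]
  refine Eq.trans ?_ h2.symm
  exact congrArg (tmap EB EB' (ε.baseMap ε') (ε.toFun x).1) (ε.symbol_proj hΩ h x)

end FrameMap
end symbolRelated

/-! ### Induced sections and the equivalence of the two reductions. -/

namespace CompatibleSystem
variable {E E₁ E₂ E₃ E₄ EG S G : Type*} {Γ : Subgroup ℝˣ} [Fact (Γ = ⊤ ∨ Γ = Units.posSubgroup ℝ)]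
  [NormedAddCommGroup E] [NormedSpace ℝ E] [NormedAddCommGroup E₁] [NormedSpace ℝ E₁]
  [NormedAddCommGroup E₂] [NormedSpace ℝ E₂] [NormedAddCommGroup E₃] [NormedSpace ℝ E₃]
  [NormedAddCommGroup E₄] [NormedSpace ℝ E₄] [NormedAddCommGroup EG] [NormedSpace ℝ EG]
  [TopologicalSpace S] [ChartedSpace E S] [IsManifold 𝓘(ℝ, E) ∞ S]
  [Group G] [TopologicalSpace G] [ChartedSpace EG G]
  [MulAction G S] [MulAction Γ S] [SMulCommClass G Γ S] [SMulCommClass Γ G S]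
  [ChartedSpace E₁ (Orb G S)] [ChartedSpace E₂ (Orb Γ S)]
  [ChartedSpace E₃ (Orb Γ (Orb G S))] [ChartedSpace E₄ (Orb G (Orb Γ S))]
  (sys : CompatibleSystem E E₁ E₂ E₃ E₄ EG S G Γ)

/-- The Hamiltonian as a homogeneous function. -/
def homHam : homogeneousFunctions E (fun (s : Γ) (x : S) => s • x) scalingCoord :=
  ⟨sys.ham, sys.contMDiff_ham, sys.ham_scaling⟩

/-- The Hamiltonian as a homogeneous invariant function. -/
def homHamInv : homogeneousFunctions E (pairAct : G × Γ → S → S) pairWeight :=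
  ⟨sys.ham, sys.contMDiff_ham, fun p x => by
    rw [pairAct, sys.ham_scaling, sys.ham_symmetry]; rfl⟩

/-- Every element of `𝒟°` is a multiple of some `α_x`, and the projection to `𝒟°/G` respects
multiples, so it suffices to compare values on the covectors `α_x`, that is, functions on `S`. -/
theorem induces_iff [IsManifold 𝓘(ℝ, E₂) ∞ (Orb Γ S)] [LieGroup 𝓘(ℝ, EG) ∞ G]
    [IsManifold 𝓘(ℝ, E₄) ∞ (Orb G (Orb Γ S))]
    (h : dualSections E₂ sys.AnnFiber) (k : dualSections E₄ sys.AnnQuot) :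
    sys.Induces h k ↔ (sys.frameCG.hamEquiv k).1 = (sys.frameC.hamEquiv h).1 := by
  constructor
  · intro hI
    exact funext fun x => hI (orb Γ x) (sys.covector x)
  · intro e c α
    obtain ⟨x, rfl⟩ := Quotient.exists_rep c
    obtain ⟨t, rfl⟩ := sys.exists_eq_smul_covectorAt x _ rfl α
    have h1 : sys.annMk (orb Γ x) (t • sys.covector x) =
      t • sys.annMk (orb Γ x) (sys.covector x) := sys.annMk_smul x t
    refine (congrArg _ h1).trans ?_
    refine (map_smul (k.1 _) t _).trans (Eq.trans ?_ (map_smul (h.1 _) t (sys.covector x)).symm)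
    exact congrArg (t • ·) (congrFun e x)

end CompatibleSystem

theorem mainTheorem5 {E E₁ E₂ E₃ E₄ EG S G : Type*}
    [NormedAddCommGroup E] [NormedSpace ℝ E] [FiniteDimensional ℝ E]
    [NormedAddCommGroup E₁] [NormedSpace ℝ E₁] [FiniteDimensional ℝ E₁]
    [NormedAddCommGroup E₂] [NormedSpace ℝ E₂] [FiniteDimensional ℝ E₂]
    [NormedAddCommGroup E₃] [NormedSpace ℝ E₃] [FiniteDimensional ℝ E₃]
    [NormedAddCommGroup E₄] [NormedSpace ℝ E₄] [FiniteDimensional ℝ E₄]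
    [NormedAddCommGroup EG] [NormedSpace ℝ EG] [FiniteDimensional ℝ EG]
    -- the symplectic manifold, the Lie group and the multiplicative group
    [TopologicalSpace S] [ChartedSpace E S] [IsManifold 𝓘(ℝ, E) ∞ S] [T2Space S]
    [SecondCountableTopology S]
    [Group G] [TopologicalSpace G] [ChartedSpace EG G] [LieGroup 𝓘(ℝ, EG) ∞ G]
    (Γ : Subgroup ℝˣ) [Fact (Γ = ⊤ ∨ Γ = Units.posSubgroup ℝ)]
    [MulAction G S] [MulAction Γ S] [SMulCommClass G Γ S] [SMulCommClass Γ G S]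
    -- the manifolds `S/G`, `S/Γ`, `(S/G)/Γ`, `(S/Γ)/G`
    [ChartedSpace E₁ (Orb G S)] [IsManifold 𝓘(ℝ, E₁) ∞ (Orb G S)] [T2Space (Orb G S)]
    [ChartedSpace E₂ (Orb Γ S)] [IsManifold 𝓘(ℝ, E₂) ∞ (Orb Γ S)] [T2Space (Orb Γ S)]
    [ChartedSpace E₃ (Orb Γ (Orb G S))] [IsManifold 𝓘(ℝ, E₃) ∞ (Orb Γ (Orb G S))]
    [T2Space (Orb Γ (Orb G S))]
    [ChartedSpace E₄ (Orb G (Orb Γ S))] [IsManifold 𝓘(ℝ, E₄) ∞ (Orb G (Orb Γ S))]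
    [T2Space (Orb G (Orb Γ S))]
    (sys : CompatibleSystem E E₁ E₂ E₃ E₄ EG S G Γ) :
    -- the Kirillov structures on `L`, `𝒟°`, `𝒟°/G`, the Hamiltonian sections, the isomorphism
    ∃ (κL : KirillovStructure E₃ sys.LineL) (κC : KirillovStructure E₂ sys.AnnFiber)
      (κCG : KirillovStructure E₄ sys.AnnQuot)
      (hL : dualSections E₃ sys.LineL) (hC : dualSections E₂ sys.AnnFiber)
      (hCG : dualSections E₄ sys.AnnQuot)
      (Ψ : LineBundleIso E₃ E₄ sys.LineL sys.AnnQuot),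
      -- the bracket and the section on `L` correspond to the Poisson bracket and to `H` on `S/G`
      (∀ h k, sys.hamL (κL.bracket h k) = -sys.reducedPoisson (sys.hamL h) (sys.hamL k)) ∧
      sys.hamL hL = sys.reducedHam ∧
      -- the bracket and the section on `𝒟°` correspond to the Poisson bracket and to `H` on `S`
      (∀ h k, sys.hamC (κC.bracket h k) = -sys.sympl.poisson (sys.hamC h) (sys.hamC k)) ∧
      sys.hamC hC = sys.ham ∧
      -- the bracket and the section on `𝒟°/G` are induced by those on `𝒟°`; every section of
      -- `(𝒟°/G)^*` is induced by a section of `(𝒟°)^*`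
      (∀ k, ∃ h, sys.Induces h k) ∧
      (∀ h k h₂ k₂, sys.Induces h h₂ → sys.Induces k k₂ →
        sys.Induces (κC.bracket h k) (κCG.bracket h₂ k₂)) ∧
      sys.Induces hC hCG ∧
      -- the isomorphism is `[[x], t] ↦ [t α_x]` over `[[x]] ↦ [[x]]`
      (∀ (x : S) (t : ℝ), Ψ.total ⟨orb Γ (orb G x), AssocFiber.mk _ (orb G x) t⟩ =
        ⟨orb G (orb Γ x), sys.annMk (orb Γ x) (t • sys.covector x)⟩) ∧
      -- it relates the Hamiltonian sections, the brackets and the Hamiltonian vector fields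
      hL = Ψ.pullback hCG ∧
      (∀ h k, κL.bracket (Ψ.pullback h) (Ψ.pullback k) = Ψ.pullback (κCG.bracket h k)) ∧
      (∀ b, mfderiv 𝓘(ℝ, E₃) 𝓘(ℝ, E₄) Ψ.base b (κL.symbol hL b) =
        κCG.symbol hCG (Ψ.base b)) := by
  have hS := sys.isConformal_scaling
  have hP := sys.isConformal_pair
  -- `L` and `𝒟°/G` are treated with the transformations of `G × Γ`, `𝒟°` with those of `Γ` alone.
  -- The three Hamiltonian sections all come from the one function `H`.
  refine ⟨sys.frameL.kirillovStructure hP, sys.frameC.kirillovStructure hS,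
    sys.frameCG.kirillovStructure hP, sys.frameL.hamEquiv.symm sys.homHamInv,
    sys.frameC.hamEquiv.symm sys.homHam, sys.frameCG.hamEquiv.symm sys.homHamInv,
    sys.frameL.lineBundleIso sys.frameCG, ?_, ?_, ?_, ?_, ?_, ?_, ?_, ?_, ?_, ?_, ?_⟩
  · intro h k
    funext y
    obtain ⟨x, rfl⟩ := Quotient.exists_rep y
    have h1 := sys.frameL.hamEquiv_bracket hP h k
    have h2 := congrFun (congrArg Subtype.val h1) x
    -- At `orb G x` the reduced bracket is by definition the Poisson bracket on `S` of the functions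
    -- composed with the projection, and these are the functions attached to `h` and `k` by
    -- `frameL`.
    rw [hP.bracket_apply] at h2
    exact h2
  · funext y
    obtain ⟨x, rfl⟩ := Quotient.exists_rep y
    exact congrFun (congrArg Subtype.val (sys.frameL.hamEquiv.apply_symm_apply sys.homHamInv)) x
  · intro h k
    have h1 := congrArg Subtype.val (sys.frameC.hamEquiv_bracket hS h k)
    rw [hS.bracket_apply] at h1
    exact h1
  · exact congrArg Subtype.val (sys.frameC.hamEquiv.apply_symm_apply sys.homHam)
  · intro k
    refine ⟨sys.frameC.hamEquiv.symm ⟨_, homogeneous_of_invariant (sys.frameCG.hamEquiv k).2⟩, ?_⟩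
    rw [sys.induces_iff, LinearEquiv.apply_symm_apply]
  -- On `S` both sides are minus the Poisson bracket, formed from equal functions.
  · intro h k h₂ k₂ hh hk
    rw [sys.induces_iff] at hh hk ⊢
    rw [FrameMap.hamEquiv_bracket, FrameMap.hamEquiv_bracket, hP.bracket_apply, hS.bracket_apply,
      hh, hk]
  · rw [sys.induces_iff, LinearEquiv.apply_symm_apply, LinearEquiv.apply_symm_apply]
    rfl
  · intro x t
    have h := sys.frameL.lineBundleIso_total sys.frameCG t x
    have h1 : (⟨orb Γ (orb G x), AssocFiber.mk _ (orb G x) t⟩ : TotalSpace ℝ sys.LineL) =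
        fiberSMul t (sys.frameL.toFun x) :=
      congrArg (TotalSpace.mk _) (AssocFiber.mkAt_eq_smul _ (orb G x) _ rfl t)
    rw [h1, h, sys.annMk_smul]
    rfl
  · apply sys.frameL.hamEquiv.injective
    rw [FrameMap.hamEquiv_pullback, LinearEquiv.apply_symm_apply, LinearEquiv.apply_symm_apply]
  · exact sys.frameL.bracket_pullback hP sys.frameCG
  · exact sys.frameL.mfderiv_symbol hP sys.frameCG (by
      rw [LinearEquiv.apply_symm_apply, LinearEquiv.apply_symm_apply])
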